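/- There is a universal constant $c>0$ such that the following holds. Let $d$ be a dimension, $A_\star\in\mathbb R^{d\times d}$ a matrix with spectral radius $\rho(A_\star)<1$, $\gamma\in(\rho(A_\star),1)$, $\Sigma_w\in\mathbb R^{d\times d}$ positive semidefinite and $\sigma_\epsilon\ge 0$. Let $\Sigma_\infty$ be the unique positive semidefinite solution $P$ of $P=A_\star PA_\star^\top+\Sigma_w$, and let $\tau=\tau(A_\star,\gamma):=\sup_{k\ge0}\|A_\star^k\|\gamma^{-k}$, where $\|\cdot\|$ is the operator norm; write $\|\cdot\|_F$ for the Frobenius norm. Let $$\beta_{t+1}=A_\star\beta_t+w_t,\qquad y_t=x_t^\top\beta_t+\epsilon_t\qquad(t\ge0),$$ where $x_t\sim N(0,I_d)$ i.i.d., $w_t\sim N(0,\Sigma_w)$ i.i.d., $\epsilon_t\sim N(0,\sigma_\epsilon^2)$ i.i.d. and $\beta_0\sim N(0,\Sigma_\infty)$, and the sequences $(x_t)$, $(w_t)$, $(\epsilon_t)$ and the vector $\beta_0$ are mutually independent. Let $\delta\in(0,1)$ and let $T$ be a natural number with $T\ge c\,d^4\log(c\,d^2/\delta)$. Then, with probability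 at least $1-\delta$, the least-squares estimates $$\widehat\Sigma_\infty\in\operatorname*{argmin}_{M=M^\top}\sum_{t=0}^{T-1}\bigl(y_t^2-x_t^\top Mx_t-\sigma_\epsilon^2\bigr)^2,\qquad \widehat M\in\operatorname*{argmin}_{M\in\mathbb R^{d\times d}}\sum_{t=0}^{T-1}\bigl(y_ty_{t+1}-x_{t+1}^\top Mx_t\bigr)^2$$ exist, and all such minimizers satisfy $$\|\widehat\Sigma_\infty-\Sigma_\infty\|_F\le\sqrt{\frac{cd^2}{T\delta}\Bigl[\sigma_\epsilon^4+\frac{\tau^2}{1-\gamma^2}\|\Sigma_\infty\|^2\Bigl(d^2+\log^2\frac{2T}{\delta}\Bigr)\Bigr]}$$ and $$\|\widehat M-A_\star\Sigma_\infty\|_F\le\sqrt{\frac{cd^2}{T\delta}\Bigl[\sigma_\epsilon^4+\frac{\tau^3}{1-\gamma^2}\|\Sigma_\infty\|^2\Bigl(d^2+\log^2\frac{2T}{\delta}\Bigr)\Bigr]}.$$ -/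

import Mathlib

open MeasureTheory ProbabilityTheory
open scoped Matrix NNReal ENNReal

namespace TVR

noncomputable section

/-- The operator norm of a square matrix with respect to the Euclidean norm. -/
def opNorm {d : ℕ} (A : Matrix (Fin d) (Fin d) ℝ) : ℝ :=
  ‖Matrix.toEuclideanCLM (n := Fin d) (𝕜 := ℝ) A‖

/-- The Frobenius norm. -/
def frobNorm {d : ℕ} (A : Matrix (Fin d) (Fin d) ℝ) : ℝ :=
  Real.sqrt (∑ i, ∑ j, A i j ^ 2)

/-- The spectral radius of a real matrix: the largest modulus of a complex eigenvalue. -/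
def rho {d : ℕ} (A : Matrix (Fin d) (Fin d) ℝ) : ℝ≥0∞ :=
  spectralRadius ℂ (A.map Complex.ofReal)

/-- `τ(A, γ) = sup_{k ≥ 0} ‖A ^ k‖ γ ^ (-k)`. -/
def tau {d : ℕ} (A : Matrix (Fin d) (Fin d) ℝ) (γ : ℝ) : ℝ :=
  ⨆ k : ℕ, opNorm (A ^ k) / γ ^ k

/-- Positive semidefinite solutions of the discrete Lyapunov equation. -/
def IsLyapunovSolution {d : ℕ} (A Sw P : Matrix (Fin d) (Fin d) ℝ) : Prop :=
  P.PosSemidef ∧ P = A * P * Aᵀ + Sw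

/-- The stationary covariance `Σ_∞`: the positive semidefinite solution of the Lyapunov equation
`P = A P Aᵀ + Σ_w`. It exists and is unique when `A` is stable and `Σ_w` is positive
semidefinite, see `stationaryCov_spec`. -/
def stationaryCov {d : ℕ} (A Sw : Matrix (Fin d) (Fin d) ℝ) : Matrix (Fin d) (Fin d) ℝ :=
  Classical.epsilon (IsLyapunovSolution A Sw)

section WellPosed

open scoped Matrix.Norms.L2Operator

theorem summable_lyapunov {d : ℕ} {A : Matrix (Fin d) (Fin d) ℝ} (hA : rho A < 1)
    (S : Matrix (Fin d) (Fin d) ℝ) : Summable fun k : ℕ => A ^ k * S * (A ^ k)ᵀ := by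
  set B : Matrix (Fin d) (Fin d) ℂ := A.map Complex.ofReal with hB
  obtain ⟨r, hr1, hr2⟩ := ENNReal.lt_iff_exists_nnreal_btwn.1 hA
  have hr2' : r < 1 := by exact_mod_cast hr2
  have hG := spectrum.pow_nnnorm_pow_one_div_tendsto_nhds_spectralRadius B
  have hev : ∀ᶠ k : ℕ in Filter.atTop, ‖B ^ k‖ ≤ (r : ℝ) ^ k := by
    filter_upwards [hG.eventually (gt_mem_nhds hr1), Filter.eventually_gt_atTop 0] with k hk hk0
    have hk' : ((‖B ^ k‖₊ : ℝ≥0∞) ^ (1 / k : ℝ)) ^ (k : ℝ) ≤ (r : ℝ≥0∞) ^ (k : ℝ) :=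
      ENNReal.rpow_le_rpow hk.le (by positivity)
    rw [← ENNReal.rpow_mul, one_div, inv_mul_cancel₀ (by positivity), ENNReal.rpow_one,
      ENNReal.rpow_natCast] at hk'
    have : ‖B ^ k‖₊ ≤ r ^ k := by exact_mod_cast hk'
    exact_mod_cast this
  have hsum : Summable fun k : ℕ => B ^ k * S.map Complex.ofReal * (B ^ k)ᴴ := by
    have hgeo : Summable fun k : ℕ => ‖S.map Complex.ofReal‖ * ((r : ℝ) ^ 2) ^ k := by
      refine (summable_geometric_of_lt_one (by positivity) ?_).mul_left _
      have : (r : ℝ) < 1 := by exact_mod_cast hr2'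
      have h0 : (0 : ℝ) ≤ r := r.2
      nlinarith
    refine Summable.of_norm_bounded_eventually_nat hgeo ?_
    filter_upwards [hev] with k hk
    calc ‖B ^ k * S.map Complex.ofReal * (B ^ k)ᴴ‖
        ≤ ‖B ^ k‖ * ‖S.map Complex.ofReal‖ * ‖(B ^ k)ᴴ‖ :=
          (norm_mul_le _ _).trans (mul_le_mul_of_nonneg_right (norm_mul_le _ _) (norm_nonneg _))
      _ = ‖S.map Complex.ofReal‖ * ‖B ^ k‖ ^ 2 := by
          rw [Matrix.l2_opNorm_conjTranspose]; ring
      _ ≤ ‖S.map Complex.ofReal‖ * ((r : ℝ) ^ 2) ^ k := by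
          rw [← pow_mul, mul_comm 2 k, pow_mul]
          gcongr
  have hmap : ∀ k : ℕ, B ^ k * S.map Complex.ofReal * (B ^ k)ᴴ
      = (A ^ k * S * (A ^ k)ᵀ).map Complex.ofReal := by
    intro k
    have h1 : B ^ k = (A ^ k).map Complex.ofReal :=
      (Matrix.map_pow A Complex.ofRealHom k).symm
    have h2 : (B ^ k)ᴴ = ((A ^ k)ᵀ).map Complex.ofReal := by
      rw [h1]; ext i j
      simp [Matrix.conjTranspose_apply, -Matrix.transpose_pow]
    rw [h2, h1]
    exact (((A ^ k * S).map_mul (f := Complex.ofRealHom)).trans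
      (by rw [Matrix.map_mul]; rfl)).symm
  simp_rw [hmap] at hsum
  refine Pi.summable.2 fun i => Pi.summable.2 fun j => ?_
  have := Pi.summable.1 (Pi.summable.1 hsum i) j
  exact Complex.summable_ofReal.1 this

/-- For a stable matrix the Lyapunov equation has exactly one positive semidefinite solution,
namely `stationaryCov A Sw`. -/
theorem stationaryCov_spec {d : ℕ} {A Sw : Matrix (Fin d) (Fin d) ℝ} (hA : rho A < 1)
    (hS : Sw.PosSemidef) :
    IsLyapunovSolution A Sw (stationaryCov A Sw) ∧
      ∀ P, IsLyapunovSolution A Sw P → P = stationaryCov A Sw := by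
  have hex : ∃ P, IsLyapunovSolution A Sw P := by
    have hs := summable_lyapunov hA Sw
    refine ⟨∑' k : ℕ, A ^ k * Sw * (A ^ k)ᵀ, ?_, ?_⟩
    · have hk : ∀ k : ℕ, (A ^ k * Sw * (A ^ k)ᵀ).PosSemidef := fun k => by
        simpa using hS.mul_mul_conjTranspose_same (A ^ k)
      refine Matrix.PosSemidef.of_dotProduct_mulVec_nonneg ?_ ?_
      · have h1 := hs.hasSum.matrix_conjTranspose
        have h2 : (fun k : ℕ => (A ^ k * Sw * (A ^ k)ᵀ)ᴴ) = fun k : ℕ => A ^ k * Sw * (A ^ k)ᵀ :=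
          funext fun k => (hk k).isHermitian
        rw [h2] at h1
        exact h1.unique hs.hasSum
      · intro v
        have hc : Continuous fun M : Matrix (Fin d) (Fin d) ℝ => star v ⬝ᵥ M *ᵥ v := by
          fun_prop
        let L : Matrix (Fin d) (Fin d) ℝ →+ ℝ :=
          { toFun := fun M => star v ⬝ᵥ M *ᵥ v
            map_zero' := by simp
            map_add' := fun M N => by simp [Matrix.add_mulVec] }
        have h1 : HasSum (fun k : ℕ => L (A ^ k * Sw * (A ^ k)ᵀ)) _ := hs.hasSum.map L hc
        exact h1.nonneg fun k => (hk k).dotProduct_mulVec_nonneg v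
    · have h2 : ∑' k : ℕ, A ^ (k + 1) * Sw * (A ^ (k + 1))ᵀ
          = A * (∑' k : ℕ, A ^ k * Sw * (A ^ k)ᵀ) * Aᵀ := by
        rw [← hs.tsum_mul_left, ← (hs.mul_left A).tsum_mul_right]
        refine tsum_congr fun k => ?_
        rw [pow_succ', Matrix.transpose_mul]
        simp only [Matrix.mul_assoc]
      rw [← h2, hs.tsum_eq_zero_add, add_comm]
      simp
  have hspec : IsLyapunovSolution A Sw (stationaryCov A Sw) := Classical.epsilon_spec hex
  refine ⟨hspec, fun P hP => ?_⟩
  set Q := stationaryCov A Sw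
  have hD : P - Q = A * (P - Q) * Aᵀ := by
    rw [Matrix.mul_sub, Matrix.sub_mul]
    nth_rw 1 [hP.2, hspec.2]
    abel
  have hk : ∀ k : ℕ, A ^ k * (P - Q) * (A ^ k)ᵀ = P - Q := by
    intro k
    induction k with
    | zero => simp
    | succ k ih =>
      rw [pow_succ, Matrix.transpose_mul]
      calc A ^ k * A * (P - Q) * (Aᵀ * (A ^ k)ᵀ)
          = A ^ k * (A * (P - Q) * Aᵀ) * (A ^ k)ᵀ := by simp only [Matrix.mul_assoc]
        _ = P - Q := by rw [← hD, ih]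
  have ht := (summable_lyapunov hA (P - Q)).tendsto_atTop_zero
  simp_rw [hk] at ht
  exact sub_eq_zero.1 (tendsto_nhds_unique tendsto_const_nhds ht)

end WellPosed

/-- The hidden states `β_{t+1} = A β_t + w_t`, started at `β_0`. -/
def state {d : ℕ} {Ω : Type*} (A : Matrix (Fin d) (Fin d) ℝ)
    (β₀ : Ω → EuclideanSpace ℝ (Fin d)) (w : ℕ → Ω → EuclideanSpace ℝ (Fin d)) :
    ℕ → Ω → EuclideanSpace ℝ (Fin d)
  | 0, ω => β₀ ω
  | t + 1, ω => Matrix.toEuclideanCLM (n := Fin d) (𝕜 := ℝ) A (state A β₀ w t ω) + w t ω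

/-- The observations `y_t = x_tᵀ β_t + ε_t`. -/
def obs {d : ℕ} {Ω : Type*} (A : Matrix (Fin d) (Fin d) ℝ)
    (β₀ : Ω → EuclideanSpace ℝ (Fin d)) (w x : ℕ → Ω → EuclideanSpace ℝ (Fin d))
    (ε : ℕ → Ω → ℝ) (t : ℕ) (ω : Ω) : ℝ :=
  inner ℝ (x t ω) (state A β₀ w t ω) + ε t ω

/-- The sources of randomness: `x_t` i.i.d. `N(0, I)`, `w_t` i.i.d. `N(0, Σ_w)`,
`ε_t` i.i.d. `N(0, σ²)`, and `β_0 ~ N(0, Σ_∞)`; the covariates, the initial state, the process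
noise and the observation noise are mutually independent. -/
structure IsGaussianModel {d : ℕ} {Ω : Type*} [MeasurableSpace Ω] (μ : Measure Ω)
    (A Sw : Matrix (Fin d) (Fin d) ℝ) (σ : ℝ≥0)
    (β₀ : Ω → EuclideanSpace ℝ (Fin d)) (w x : ℕ → Ω → EuclideanSpace ℝ (Fin d))
    (ε : ℕ → Ω → ℝ) : Prop where
  measurable_x : ∀ t, Measurable (x t)
  measurable_w : ∀ t, Measurable (w t)
  measurable_ε : ∀ t, Measurable (ε t)
  measurable_β₀ : Measurable β₀
  law_x : ∀ t, HasLaw (x t) (multivariateGaussian 0 1) μ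
  law_w : ∀ t, HasLaw (w t) (multivariateGaussian 0 Sw) μ
  law_ε : ∀ t, HasLaw (ε t) (gaussianReal 0 (σ ^ 2)) μ
  law_β₀ : HasLaw β₀ (multivariateGaussian 0 (stationaryCov A Sw)) μ
  indep_x : iIndepFun x μ
  indep_w : iIndepFun w μ
  indep_ε : iIndepFun ε μ
  indep_x_rest : IndepFun (fun ω t => x t ω) (fun ω => (β₀ ω, (fun t => w t ω), fun t => ε t ω)) μ
  indep_β₀_noise : IndepFun β₀ (fun ω => ((fun t => w t ω), fun t => ε t ω)) μ
  indep_w_ε : IndepFun (fun ω t => w t ω) (fun ω t => ε t ω) μ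

/-- Least-squares loss of regressing `y_t² - σ²` on `x_t x_tᵀ`. -/
def covLoss {d : ℕ} (T : ℕ) (σ : ℝ≥0) (x : ℕ → EuclideanSpace ℝ (Fin d)) (y : ℕ → ℝ)
    (M : Matrix (Fin d) (Fin d) ℝ) : ℝ :=
  ∑ t ∈ Finset.range T, (y t ^ 2 - (x t).ofLp ⬝ᵥ M *ᵥ (x t).ofLp - (σ : ℝ) ^ 2) ^ 2

/-- Least-squares loss of regressing `y_t y_{t+1}` on `x_{t+1} x_tᵀ`. -/
def crossLoss {d : ℕ} (T : ℕ) (x : ℕ → EuclideanSpace ℝ (Fin d)) (y : ℕ → ℝ)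
    (M : Matrix (Fin d) (Fin d) ℝ) : ℝ :=
  ∑ t ∈ Finset.range T, (y t * y (t + 1) - (x (t + 1)).ofLp ⬝ᵥ M *ᵥ (x t).ofLp) ^ 2

/-- `S` is an ordinary least squares estimate of the covariance, among symmetric matrices. -/
def IsCovEstimate {d : ℕ} (T : ℕ) (σ : ℝ≥0) (x : ℕ → EuclideanSpace ℝ (Fin d)) (y : ℕ → ℝ)
    (S : Matrix (Fin d) (Fin d) ℝ) : Prop :=
  S.IsSymm ∧ ∀ M : Matrix (Fin d) (Fin d) ℝ, M.IsSymm → covLoss T σ x y S ≤ covLoss T σ x y M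

/-- `N` is an ordinary least squares estimate of the lag-one cross-covariance. -/
def IsCrossEstimate {d : ℕ} (T : ℕ) (x : ℕ → EuclideanSpace ℝ (Fin d)) (y : ℕ → ℝ)
    (N : Matrix (Fin d) (Fin d) ℝ) : Prop :=
  ∀ M : Matrix (Fin d) (Fin d) ℝ, crossLoss T x y N ≤ crossLoss T x y M

/-- The error bound
`√( c d² / (T δ) * [σ⁴ + τ(A, γ)^p / (1 - γ²) * ‖Σ_∞‖² * (d² + log(2 T / δ)²)] )`. -/
def errorBound {d : ℕ} (c : ℝ) (p : ℕ) (A Sw : Matrix (Fin d) (Fin d) ℝ) (σ : ℝ≥0)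
    (γ δ : ℝ) (T : ℕ) : ℝ :=
  Real.sqrt (c * (d : ℝ) ^ 2 / (T * δ) *
    ((σ : ℝ) ^ 4 + tau A γ ^ p / (1 - γ ^ 2) * opNorm (stationaryCov A Sw) ^ 2 *
      ((d : ℝ) ^ 2 + Real.log (2 * T / δ) ^ 2)))

end

end TVR

namespace TVR

noncomputable section

/-! Both estimators are linear regressions with features `X_t = x_t x_tᵀ` and `X_t = x_{t+1} x_tᵀ`,
and true coefficients `Σ_∞` and `A Σ_∞`. A minimizer has at most the loss of the truth. Hence, if
the design satisfies `∑ ⟨M, X_t⟩² ≥ κ ‖M‖_F²`, Cauchy–Schwarz gives `κ ‖error‖_F ≤ 2 ‖∑ r_t X_t‖_F`,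
where `r_t` is the residual at the truth (`sq_mul_sum_sq_le_of_loss_le`). It remains to show that
`κ` is of order `T` with high probability and that the score `∑ r_t X_t` has second moment of order
`T`; Markov's inequality then yields the rate `1/(T δ)`. Minimizers always exist, by projection onto
a finite-dimensional subspace (`exists_leastSquares`).

Design (`exists_gram_lower_bound`). The entries of the Gram matrix are unbounded polynomials of
degree four. They are multiplied by the weight `exp(-|x|²/(2d))`, one factor for each covariate
involved. The weight is at most 1, so it only decreases the quadratic form; it makes the entries
bounded by `8d²`; and it turns `N(0, I)` into `N(0, d/(d+1) I)` up to a factor at least `1/2`, so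
all moments stay explicit. A Chernoff bound for each of the `d⁴` entries, at precision `1/(32d²)`,
accounts for the sample size `d⁴ log(d²/δ)`. In the cross regression only the disjoint pairs
`(x_{2n}, x_{2n+1})` are used, which are independent.

Score (`integral_sq_sum_le`). Scores whose covariates are disjoint are conditionally independent
given the states and the noise, so their correlation is that of their averages over the covariates.
With `D_t = β_t β_tᵀ - Σ_∞`, these averages are `D_t + D_tᵀ + tr(D_t) I` plus a centred noise term,
and `β_{t+1} β_tᵀ - A Σ_∞` (`integral_cov_decouple`, `integral_cross_decouple`). Tested against the
past up to `s`, `D_{s+m}` may be replaced by `A^m D_s (A^m)ᵀ` (`integral_past_mul_stateDev`), whose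
norm is at most `τ² γ^{2m} ‖D_s‖_F`. The correlations therefore decay geometrically with ratio `γ²`,
and their sum produces `τ²/(1-γ²)`. The terms with gap 0 or 1 are bounded by Gaussian moments of the
stationary state.

The argument yields `τ²` in both regressions and no logarithm; the stated bounds follow because `τ ≥
1` and the squared logarithm is nonnegative. -/

/-! ### Moments of the one-dimensional Gaussian. -/

theorem integrable_pow_gaussianReal (v : ℝ≥0) (n : ℕ) :
    Integrable (fun u : ℝ => u ^ n) (gaussianReal 0 v) := by
  rcases Nat.eq_zero_or_pos n with rfl | hn
  · simp
  · have h := (memLp_id_gaussianReal (μ := 0) (v := v) n).integrable_norm_pow hn.ne'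
    refine h.mono' (by fun_prop) (ae_of_all _ fun u => ?_)
    simp

theorem integrable_pow_mul_gaussianPDFReal {v : ℝ≥0} (hv : v ≠ 0) (n : ℕ) :
    Integrable (fun u : ℝ => u ^ n * gaussianPDFReal 0 v u) := by
  have h := integrable_pow_gaussianReal v n
  rw [gaussianReal_of_var_ne_zero _ hv, integrable_withDensity_iff_integrable_smul'
    (measurable_gaussianPDF _ _) (ae_of_all _ fun _ => gaussianPDF_lt_top)] at h
  refine h.congr (ae_of_all _ fun u => ?_)
  simp [toReal_gaussianPDF, mul_comm]

theorem hasDerivAt_gaussianPDFReal {v : ℝ≥0} (hv : v ≠ 0) (u : ℝ) :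
    HasDerivAt (gaussianPDFReal 0 v) (-(u / v) * gaussianPDFReal 0 v u) u := by
  have hv' : (v : ℝ) ≠ 0 := by exact_mod_cast hv
  rw [gaussianPDFReal_def]
  have h1 : HasDerivAt (fun x : ℝ => -(x - 0) ^ 2 / (2 * (v : ℝ))) (-(u / v)) u := by
    have := (((hasDerivAt_id u).sub_const 0).pow 2).neg.div_const (2 * (v : ℝ))
    refine this.congr_deriv ?_
    simp only [id, sub_zero, Nat.cast_ofNat]
    field_simp
    ring
  refine (h1.exp.const_mul _).congr_deriv ?_
  ring

/-- Gaussian integration by parts for monomials. -/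
theorem integral_pow_add_two_gaussianReal (v : ℝ≥0) (n : ℕ) :
    ∫ u, u ^ (n + 2) ∂(gaussianReal 0 v) = (n + 1) * v * ∫ u, u ^ n ∂(gaussianReal 0 v) := by
  -- At variance zero the measure is a Dirac mass, which has no density to differentiate.
  rcases eq_or_ne v 0 with rfl | hv
  · simp
  have hv' : (v : ℝ) ≠ 0 := by exact_mod_cast hv
  have h := integral_mul_deriv_eq_deriv_mul_of_integrable
    (u := fun u : ℝ => u ^ (n + 1)) (u' := fun u => (n + 1) * u ^ n)
    (v := gaussianPDFReal 0 v) (v' := fun u => -(u / v) * gaussianPDFReal 0 v u)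
    (fun x _ => by simpa using hasDerivAt_pow (n + 1) x)
    (fun x _ => hasDerivAt_gaussianPDFReal hv x)
    (((integrable_pow_mul_gaussianPDFReal hv (n + 2)).const_mul (-(1 / (v : ℝ)))).congr
      (ae_of_all _ fun u => by simp only [Pi.mul_apply]; ring))
    (((integrable_pow_mul_gaussianPDFReal hv n).const_mul (n + 1 : ℝ)).congr
      (ae_of_all _ fun u => by simp only [Pi.mul_apply]; ring))
    (integrable_pow_mul_gaussianPDFReal hv (n + 1))
  rw [integral_gaussianReal_eq_integral_smul hv, integral_gaussianReal_eq_integral_smul hv]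
  have h1 : ∫ u : ℝ, u ^ (n + 1) * (-(u / v) * gaussianPDFReal 0 v u)
      = -(1 / (v : ℝ)) * ∫ u, gaussianPDFReal 0 v u • u ^ (n + 2) := by
    rw [← integral_const_mul]
    congr 1; ext u; simp only [smul_eq_mul]; ring
  have h2 : ∫ u : ℝ, (n + 1) * u ^ n * gaussianPDFReal 0 v u
      = (n + 1) * ∫ u, gaussianPDFReal 0 v u • u ^ n := by
    rw [← integral_const_mul]
    congr 1; ext u; simp only [smul_eq_mul]; ring
  rw [h1, h2] at h
  field_simp at h
  linarith

theorem integral_pow_one_gaussianReal (v : ℝ≥0) : ∫ u, u ^ 1 ∂(gaussianReal 0 v) = 0 := by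
  simp

theorem integral_pow_two_gaussianReal (v : ℝ≥0) : ∫ u, u ^ 2 ∂(gaussianReal 0 v) = v := by
  have := integral_pow_add_two_gaussianReal v 0
  simpa using this

theorem integral_pow_three_gaussianReal (v : ℝ≥0) : ∫ u, u ^ 3 ∂(gaussianReal 0 v) = 0 := by
  have := integral_pow_add_two_gaussianReal v 1
  rw [integral_pow_one_gaussianReal] at this
  simpa using this

theorem integral_pow_four_gaussianReal (v : ℝ≥0) :
    ∫ u, u ^ 4 ∂(gaussianReal 0 v) = 3 * (v : ℝ) ^ 2 := by
  have := integral_pow_add_two_gaussianReal v 2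
  rw [integral_pow_two_gaussianReal] at this
  norm_num at this
  rw [this]; ring

theorem integral_pow_eight_gaussianReal (v : ℝ≥0) :
    ∫ u, u ^ 8 ∂(gaussianReal 0 v) = 105 * (v : ℝ) ^ 4 := by
  have h1 := integral_pow_add_two_gaussianReal v 4
  have h2 := integral_pow_add_two_gaussianReal v 6
  rw [integral_pow_four_gaussianReal] at h1
  norm_num at h1 h2
  rw [h2, h1]; ring

/-! ### Moments of the standard Gaussian vector under an exponential weight. -/

/-- A centered Gaussian weight turns the standard Gaussian into a narrower one. -/
theorem integral_exp_mul_pow_gaussianReal {s : ℝ≥0} (hs : s ≠ 0) (n : ℕ) :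
    ∫ u, Real.exp (-((s : ℝ)⁻¹ - 1) * u ^ 2 / 2) * u ^ n ∂(gaussianReal 0 1)
      = Real.sqrt s * ∫ u, u ^ n ∂(gaussianReal 0 s) := by
  have hs' : (0 : ℝ) < s := by positivity
  rw [integral_gaussianReal_eq_integral_smul hs,
    integral_gaussianReal_eq_integral_smul one_ne_zero, ← integral_const_mul]
  congr 1; ext u
  simp only [smul_eq_mul, gaussianPDFReal_def, NNReal.coe_one, mul_one, sub_zero]
  have h1 : Real.exp (-u ^ 2 / (2 * s))
      = Real.exp (-u ^ 2 / 2) * Real.exp (-((s : ℝ)⁻¹ - 1) * u ^ 2 / 2) := by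
    rw [← Real.exp_add]; congr 1; field_simp; ring
  have h2 : Real.sqrt (2 * Real.pi * s) = Real.sqrt (2 * Real.pi) * Real.sqrt s :=
    Real.sqrt_mul (by positivity) _
  have h3 : 0 < Real.sqrt s := Real.sqrt_pos.2 hs'
  have h4 : 0 < Real.sqrt (2 * Real.pi) := Real.sqrt_pos.2 (by positivity)
  rw [h1, h2]
  field_simp

theorem integral_prod_stdGaussian {d : ℕ} (f : Fin d → ℝ → ℝ) (hf : ∀ i, Measurable (f i)) :
    ∫ x, ∏ i, f i (x i) ∂(stdGaussian (EuclideanSpace ℝ (Fin d)))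
      = ∏ i, ∫ u, f i u ∂(gaussianReal 0 1) := by
  rw [← map_pi_eq_stdGaussian, integral_map (by fun_prop)
    (Measurable.aestronglyMeasurable (by fun_prop))]
  exact integral_fintype_prod_eq_prod f

/-- The Gaussian weight `exp (- (1/s - 1) |x|² / 2)`. -/
def gaussWeight {d : ℕ} (s : ℝ≥0) (x : EuclideanSpace ℝ (Fin d)) : ℝ :=
  ∏ i, Real.exp (-((s : ℝ)⁻¹ - 1) * x i ^ 2 / 2)

/-- Weight and monomial both factor over the coordinates; each coordinate contributes one factor
`√s` and one moment of `N(0, s)`. -/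
theorem integral_gaussWeight_mul_prod_pow {d : ℕ} {s : ℝ≥0} (hs : s ≠ 0) (n : Fin d → ℕ) :
    ∫ x, gaussWeight s x * ∏ i, x i ^ n i ∂(stdGaussian (EuclideanSpace ℝ (Fin d)))
      = Real.sqrt s ^ d * ∏ i, ∫ u, u ^ n i ∂(gaussianReal 0 s) := by
  simp_rw [gaussWeight, ← Finset.prod_mul_distrib]
  rw [integral_prod_stdGaussian
    (fun i u => Real.exp (-((s : ℝ)⁻¹ - 1) * u ^ 2 / 2) * u ^ n i) (fun i => by fun_prop)]
  simp_rw [integral_exp_mul_pow_gaussianReal hs]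
  rw [Finset.prod_mul_distrib]
  simp

/-- Encodes a coordinate as an exponent vector, so that products with repeated indices become a
single monomial. -/
theorem prod_pow_ite_eq {d : ℕ} (x : Fin d → ℝ) (i : Fin d) :
    ∏ r, x r ^ (if r = i then 1 else 0) = x i := by
  simp [Finset.prod_ite_eq']

theorem integral_gaussWeight_two {d : ℕ} {s : ℝ≥0} (hs : s ≠ 0) (i j : Fin d) :
    ∫ x, gaussWeight s x * (x i * x j) ∂(stdGaussian (EuclideanSpace ℝ (Fin d)))
      = Real.sqrt s ^ d * (s * if i = j then 1 else 0) := by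
  have h := integral_gaussWeight_mul_prod_pow hs
    (fun r : Fin d => (if r = i then 1 else 0) + (if r = j then 1 else 0))
  simp_rw [pow_add, Finset.prod_mul_distrib] at h
  simp_rw [prod_pow_ite_eq] at h
  rw [h]
  congr 1
  simp_rw [← pow_add]
  rw [← Finset.prod_subset (Finset.subset_univ {i, j}) (by
    intro r _ hr
    simp only [Finset.mem_insert, Finset.mem_singleton, not_or] at hr
    simp [hr])]
  have m1 := integral_pow_one_gaussianReal s
  have m2 := integral_pow_two_gaussianReal s
  rcases eq_or_ne i j with rfl | hij
  · simp [m2]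
  · rw [Finset.prod_pair hij]
    simp [hij, hij.symm]

/-- The total degree is odd, so some coordinate occurs with exponent 1 or 3, and its factor
vanishes. -/
theorem integral_gaussWeight_three {d : ℕ} {s : ℝ≥0} (hs : s ≠ 0) (i j k : Fin d) :
    ∫ x, gaussWeight s x * (x i * x j * x k) ∂(stdGaussian (EuclideanSpace ℝ (Fin d))) = 0 := by
  have h := integral_gaussWeight_mul_prod_pow hs
    (fun r : Fin d => (if r = i then 1 else 0) + (if r = j then 1 else 0)
      + (if r = k then 1 else 0))
  simp_rw [pow_add, Finset.prod_mul_distrib] at h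
  simp_rw [prod_pow_ite_eq] at h
  rw [h]
  simp_rw [← pow_add]
  have m3 := integral_pow_three_gaussianReal s
  refine mul_eq_zero_of_right _ ?_
  rcases eq_or_ne i j with rfl | hij
  · refine Finset.prod_eq_zero (Finset.mem_univ k) ?_
    rcases eq_or_ne i k with rfl | hik
    · simp [m3]
    · simp [hik.symm]
  · rcases eq_or_ne i k with rfl | hik
    · exact Finset.prod_eq_zero (Finset.mem_univ j) (by simp [hij.symm])
    · exact Finset.prod_eq_zero (Finset.mem_univ i) (by simp [hij, hik])

/-- Isserlis' formula for `N(0, s I)`. The proof splits according to which of `j, k, l` equal `i`;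
when all four indices agree, the moment `3s²` accounts for the three pairings together. -/
theorem integral_gaussWeight_four {d : ℕ} {s : ℝ≥0} (hs : s ≠ 0) (i j k l : Fin d) :
    ∫ x, gaussWeight s x * (x i * x j * x k * x l) ∂(stdGaussian (EuclideanSpace ℝ (Fin d)))
      = Real.sqrt s ^ d * (s ^ 2 * ((if i = j then 1 else 0) * (if k = l then 1 else 0)
        + (if i = k then 1 else 0) * (if j = l then 1 else 0)
        + (if i = l then 1 else 0) * (if j = k then 1 else 0))) := by
  have h := integral_gaussWeight_mul_prod_pow hs
    (fun r : Fin d => (if r = i then 1 else 0) + (if r = j then 1 else 0)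
      + (if r = k then 1 else 0) + (if r = l then 1 else 0))
  simp_rw [pow_add, Finset.prod_mul_distrib] at h
  simp_rw [prod_pow_ite_eq] at h
  rw [h]
  congr 1
  simp_rw [← pow_add]
  rw [← Finset.prod_subset (Finset.subset_univ {i, j, k, l}) (by
    intro r _ hr
    simp only [Finset.mem_insert, Finset.mem_singleton, not_or] at hr
    simp [hr])]
  have m1 := integral_pow_one_gaussianReal s
  have m2 := integral_pow_two_gaussianReal s
  have m3 := integral_pow_three_gaussianReal s
  have m4 := integral_pow_four_gaussianReal s
  have e : ∀ a b : Fin d, a ≠ b → b ≠ a := fun _ _ h => h.symm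
  rcases eq_or_ne i j with rfl | hij <;> rcases eq_or_ne i k with rfl | hik <;>
    rcases eq_or_ne i l with rfl | hil
  · simp [m4]; ring
  · simp [Finset.prod_pair hil, hil, hil.symm]
  · simp [hik, hik.symm]
  · rcases eq_or_ne k l with rfl | hkl
    · simp [Finset.prod_pair hik, hik, hik.symm, m2]; ring
    · simp [hik, hil, hkl, hik.symm, hil.symm, hkl.symm]
  · simp [Finset.prod_pair hij.symm, hij, hij.symm]
  · rcases eq_or_ne j l with rfl | hjl
    · simp [hij, hij.symm, m2]; ring
    · simp [hij, hil, hjl, hij.symm, hil.symm, hjl.symm]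
  · rcases eq_or_ne j k with rfl | hjk
    · simp [hij, hij.symm, m2]; ring
    · simp [hij, hik, hjk, hij.symm, hik.symm, hjk.symm]
  · simp [hij, hik, hil]

/-! ### Chernoff bounds and concentration of Gram matrices. -/

theorem exp_le_one_add_add_sq {u : ℝ} (hu : |u| ≤ 1) : Real.exp u ≤ 1 + u + u ^ 2 := by
  have := Real.abs_exp_sub_one_sub_id_le hu
  linarith [(abs_le.1 this).2]

/-- A Chernoff bound for the upper tail of sums of bounded independent variables. -/
theorem measure_sum_ge_le {Ω : Type*} [MeasurableSpace Ω] {μ : Measure Ω} [IsProbabilityMeasure μ]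
    {Z : ℕ → Ω → ℝ} (hZ : iIndepFun Z μ) (hm : ∀ n, Measurable (Z n)) {b q v l e : ℝ}
    (hb : ∀ n ω, |Z n ω| ≤ b) (hq : ∀ n, ∫ ω, Z n ω ∂μ = q)
    (hv : ∀ n, ∫ ω, Z n ω ^ 2 ∂μ ≤ v) (hl : 0 ≤ l) (hlb : l * b ≤ 1) (N : ℕ) :
    μ.real {ω | N * (q + e) ≤ ∑ n ∈ Finset.range N, Z n ω}
      ≤ Real.exp (-(N * (l * e - l ^ 2 * v))) := by
  have hint : ∀ n, Integrable (Z n) μ := fun n =>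
    Integrable.of_bound (hm n).aestronglyMeasurable b (ae_of_all _ fun ω => by simpa using hb n ω)
  have hint2 : ∀ n, Integrable (fun ω => Z n ω ^ 2) μ := fun n =>
    Integrable.of_bound ((hm n).pow_const 2).aestronglyMeasurable (b ^ 2)
      (ae_of_all _ fun ω => by
        rw [Real.norm_eq_abs, abs_pow]; exact pow_le_pow_left₀ (abs_nonneg _) (hb n ω) 2)
  have hmgf : ∀ n, mgf (Z n) μ l ≤ Real.exp (l * q + l ^ 2 * v) := by
    intro n
    have hpt : ∀ ω, Real.exp (l * Z n ω) ≤ 1 + l * Z n ω + l ^ 2 * Z n ω ^ 2 := by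
      intro ω
      have := exp_le_one_add_add_sq (u := l * Z n ω) (by
        rw [abs_mul, abs_of_nonneg hl]
        exact (mul_le_mul_of_nonneg_left (hb n ω) hl).trans hlb)
      rwa [mul_pow] at this
    have hi : Integrable (fun ω => 1 + l * Z n ω + l ^ 2 * Z n ω ^ 2) μ :=
      ((integrable_const _).add ((hint n).const_mul l)).add ((hint2 n).const_mul _)
    calc mgf (Z n) μ l = ∫ ω, Real.exp (l * Z n ω) ∂μ := rfl
      _ ≤ ∫ ω, (1 + l * Z n ω + l ^ 2 * Z n ω ^ 2) ∂μ :=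
          integral_mono_of_nonneg (ae_of_all _ fun ω => (Real.exp_pos _).le) hi
            (ae_of_all _ hpt)
      _ = 1 + l * q + l ^ 2 * ∫ ω, Z n ω ^ 2 ∂μ := by
          rw [integral_add (f := fun ω => 1 + l * Z n ω)
            ((integrable_const _).add ((hint n).const_mul l)) ((hint2 n).const_mul _),
            integral_add (integrable_const _) ((hint n).const_mul l),
            integral_const_mul, integral_const_mul, hq]
          simp
      _ ≤ (l * q + l ^ 2 * v) + 1 := by nlinarith [hv n, sq_nonneg l]
      _ ≤ _ := Real.add_one_le_exp _
  have hexpint : Integrable (fun ω => Real.exp (l * ∑ n ∈ Finset.range N, Z n ω)) μ := by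
    refine Integrable.of_bound (by fun_prop) (Real.exp (l * (N * b))) (ae_of_all _ fun ω => ?_)
    rw [Real.norm_eq_abs, Real.abs_exp]
    refine Real.exp_le_exp.2 (mul_le_mul_of_nonneg_left ?_ hl)
    calc ∑ n ∈ Finset.range N, Z n ω ≤ ∑ n ∈ Finset.range N, b :=
          Finset.sum_le_sum fun n _ => (le_abs_self _).trans (hb n ω)
      _ = N * b := by simp
  have h := measure_ge_le_exp_mul_mgf (X := fun ω => ∑ n ∈ Finset.range N, Z n ω) (μ := μ)
    (N * (q + e)) hl hexpint
  refine h.trans ?_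
  have hs : mgf (fun ω => ∑ n ∈ Finset.range N, Z n ω) μ l
      = ∏ n ∈ Finset.range N, mgf (Z n) μ l := by
    rw [← hZ.mgf_sum hm]
    congr 1; ext ω; simp
  rw [hs]
  calc Real.exp (-l * (N * (q + e))) * ∏ n ∈ Finset.range N, mgf (Z n) μ l
      ≤ Real.exp (-l * (N * (q + e))) * ∏ n ∈ Finset.range N, Real.exp (l * q + l ^ 2 * v) := by
        refine mul_le_mul_of_nonneg_left ?_ (Real.exp_pos _).le
        exact Finset.prod_le_prod (fun n _ => mgf_nonneg) fun n _ => hmgf n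
    _ = Real.exp (-(N * (l * e - l ^ 2 * v))) := by
        rw [Finset.prod_const, Finset.card_range, ← Real.exp_nat_mul, ← Real.exp_add]
        congr 1; ring

/-- The lower tail is the upper tail of `-Z`; the union bound over both tails costs the factor 2. -/
theorem measure_abs_sum_ge_le {Ω : Type*} [MeasurableSpace Ω] {μ : Measure Ω}
    [IsProbabilityMeasure μ] {Z : ℕ → Ω → ℝ} (hZ : iIndepFun Z μ) (hm : ∀ n, Measurable (Z n))
    {b q v l e : ℝ} (hb : ∀ n ω, |Z n ω| ≤ b) (hq : ∀ n, ∫ ω, Z n ω ∂μ = q)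
    (hv : ∀ n, ∫ ω, Z n ω ^ 2 ∂μ ≤ v) (hl : 0 ≤ l) (hlb : l * b ≤ 1) (N : ℕ) :
    μ.real {ω | N * e ≤ |∑ n ∈ Finset.range N, Z n ω - N * q|}
      ≤ 2 * Real.exp (-(N * (l * e - l ^ 2 * v))) := by
  have h1 := measure_sum_ge_le (e := e) hZ hm hb hq hv hl hlb N
  have h2 := measure_sum_ge_le (Z := fun n ω => -Z n ω) (q := -q) (v := v) (e := e)
    (hZ.comp (fun _ => Neg.neg) (fun _ => measurable_neg)) (fun n => (hm n).neg)
    (by simpa using hb) (by intro n; rw [integral_neg, hq]) (by simpa using hv) hl hlb N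
  calc _ ≤ μ.real ({ω | N * (q + e) ≤ ∑ n ∈ Finset.range N, Z n ω} ∪
        {ω | N * (-q + e) ≤ ∑ n ∈ Finset.range N, -Z n ω}) := by
        refine measureReal_mono (fun ω hω => ?_)
        simp only [Set.mem_ofPred_eq, Set.mem_union, Finset.sum_neg_distrib] at hω ⊢
        rcases le_abs.1 hω with h | h
        · left; linarith
        · right; linarith
    _ ≤ _ := (measureReal_union_le _ _).trans (by linarith)

theorem sq_sum_mul_le {ι : Type*} [Fintype ι] (m : ι → ℝ) :
    (∑ a, |m a|) ^ 2 ≤ Fintype.card ι * ∑ a, m a ^ 2 := by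
  have := sq_sum_le_card_mul_sum_sq (s := Finset.univ) (f := fun a => |m a|)
  simpa using this

/-- With high probability, the empirical Gram matrix of independent random features is bounded
below, up to a small multiple of the identity, by the expected weighted Gram matrix. -/
theorem exists_gram_lower_bound {Ω 𝓧 ι : Type*} [MeasurableSpace Ω] [MeasurableSpace 𝓧] [Fintype ι]
    {μ : Measure Ω} [IsProbabilityMeasure μ] {X : ℕ → Ω → 𝓧} (hX : iIndepFun X μ)
    (hXm : ∀ n, Measurable (X n)) {g : 𝓧 → ℝ} (hg : Measurable g) (hg1 : ∀ x, g x ≤ 1) {φ : ι → 𝓧 → ℝ} (hφ : ∀ a, Measurable (φ a)) {b v l e : ℝ}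
    {Q : ι → ι → ℝ} (hb : ∀ a a' x, |g x * (φ a x * φ a' x)| ≤ b)
    (hQ : ∀ n a a', ∫ ω, g (X n ω) * (φ a (X n ω) * φ a' (X n ω)) ∂μ = Q a a')
    (hv : ∀ n a a', ∫ ω, (g (X n ω) * (φ a (X n ω) * φ a' (X n ω))) ^ 2 ∂μ ≤ v)
    (hl : 0 ≤ l) (hlb : l * b ≤ 1) (N : ℕ) :
    ∃ G : Set Ω, MeasurableSet G ∧
      μ.real Gᶜ ≤ 2 * (Fintype.card ι) ^ 2 * Real.exp (-(N * (l * e - l ^ 2 * v))) ∧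
      ∀ ω ∈ G, ∀ m : ι → ℝ,
        N * (∑ a, ∑ a', m a * m a' * Q a a' - e * Fintype.card ι * ∑ a, m a ^ 2)
          ≤ ∑ n ∈ Finset.range N, (∑ a, m a * φ a (X n ω)) ^ 2 := by
  set Z : ι → ι → ℕ → Ω → ℝ := fun a a' n ω => g (X n ω) * (φ a (X n ω) * φ a' (X n ω)) with hZ
  have hZm : ∀ a a' n, Measurable (Z a a' n) := fun a a' n =>
    (hg.comp (hXm n)).mul (((hφ a).comp (hXm n)).mul ((hφ a').comp (hXm n)))
  set bad : ι × ι → Set Ω := fun p =>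
    {ω | N * e ≤ |∑ n ∈ Finset.range N, Z p.1 p.2 n ω - N * Q p.1 p.2|} with hbad
  have hbadm : ∀ p, MeasurableSet (bad p) := fun p => by
    refine measurableSet_le measurable_const ?_
    exact ((Finset.measurable_sum _ fun n _ => hZm _ _ n).sub_const _).abs
  refine ⟨(⋃ p, bad p)ᶜ, (MeasurableSet.iUnion hbadm).compl, ?_, ?_⟩
  · rw [compl_compl]
    calc μ.real (⋃ p, bad p) ≤ ∑ p, μ.real (bad p) := measureReal_iUnion_fintype_le _
      _ ≤ ∑ p : ι × ι, 2 * Real.exp (-(N * (l * e - l ^ 2 * v))) := by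
          refine Finset.sum_le_sum fun p _ => ?_
          refine measure_abs_sum_ge_le (b := b) ?_ (hZm _ _) (fun n ω => hb _ _ _)
            (fun n => hQ n _ _) (fun n => hv n _ _) hl hlb N
          exact hX.comp (fun _ x => g x * (φ p.1 x * φ p.2 x))
            (fun _ => hg.mul ((hφ _).mul (hφ _)))
      _ = _ := by simp; ring
  · intro ω hω m
    simp only [Set.mem_compl_iff, Set.mem_iUnion, not_exists, hbad, Set.mem_ofPred_eq, not_le,
      Prod.forall] at hω
    have h1 : ∑ n ∈ Finset.range N, g (X n ω) * (∑ a, m a * φ a (X n ω)) ^ 2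
        = ∑ a, ∑ a', m a * m a' * ∑ n ∈ Finset.range N, Z a a' n ω := by
      simp_rw [Finset.mul_sum]
      rw [Finset.sum_congr rfl fun a _ => Finset.sum_comm, Finset.sum_comm]
      refine Finset.sum_congr rfl fun n _ => ?_
      rw [sq, Finset.sum_mul_sum, Finset.mul_sum]
      refine Finset.sum_congr rfl fun a _ => ?_
      rw [Finset.mul_sum]
      refine Finset.sum_congr rfl fun a' _ => ?_
      simp only [hZ]; ring
    -- The summands are squares and `g ≤ 1`, so removing the weight can only increase the sum: the
    -- truncation is free for a lower bound.
    have h2 : ∑ n ∈ Finset.range N, g (X n ω) * (∑ a, m a * φ a (X n ω)) ^ 2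
        ≤ ∑ n ∈ Finset.range N, (∑ a, m a * φ a (X n ω)) ^ 2 :=
      Finset.sum_le_sum fun n _ => mul_le_of_le_one_left (sq_nonneg _) (hg1 _)
    refine le_trans ?_ (h1.symm.le.trans h2)
    have h3 : ∀ a a', m a * m a' * (N * Q a a') - |m a| * |m a'| * (N * e)
        ≤ m a * m a' * ∑ n ∈ Finset.range N, Z a a' n ω := by
      intro a a'
      have h4 : |m a * m a' * (∑ n ∈ Finset.range N, Z a a' n ω - N * Q a a')|
          ≤ |m a| * |m a'| * (N * e) := by
        rw [abs_mul, abs_mul]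
        exact mul_le_mul_of_nonneg_left (hω a a').le (by positivity)
      have := (abs_le.1 h4).1
      linarith
    have h5 := Finset.sum_le_sum fun a (_ : a ∈ Finset.univ) =>
      Finset.sum_le_sum fun a' (_ : a' ∈ Finset.univ) => h3 a a'
    refine le_trans ?_ h5
    simp_rw [Finset.sum_sub_distrib]
    have h6 : ∑ a, ∑ a', m a * m a' * (N * Q a a') = N * ∑ a, ∑ a', m a * m a' * Q a a' := by
      simp_rw [Finset.mul_sum]
      exact Finset.sum_congr rfl fun a _ => Finset.sum_congr rfl fun a' _ => by ring
    have h7 : ∑ a, ∑ a', |m a| * |m a'| * (N * e) = (N * e) * (∑ a, |m a|) ^ 2 := by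
      rw [sq, Finset.sum_mul_sum, Finset.mul_sum]
      refine Finset.sum_congr rfl fun a _ => ?_
      rw [Finset.mul_sum]
      exact Finset.sum_congr rfl fun a' _ => by ring
    rw [h6, h7]
    rcases isEmpty_or_nonempty ι with hι | ⟨⟨a0⟩⟩
    · simp
    -- No sign of `e` is assumed; outside the bad events `N * e` dominates an absolute value.
    · have hNe : 0 ≤ N * e := (abs_nonneg _).trans (hω a0 a0).le
      have := mul_le_mul_of_nonneg_left (sq_sum_mul_le m) hNe
      linarith

/-! ### Independence of disjoint pairs and moments read off from laws. -/

/-- Disjoint consecutive pairs of an independent sequence are independent. -/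
theorem iIndepFun_pairs {Ω E : Type*} [MeasurableSpace Ω] [MeasurableSpace E] {μ : Measure Ω}
    [IsProbabilityMeasure μ] {x : ℕ → Ω → E} (h : iIndepFun x μ) (hm : ∀ t, Measurable (x t)) :
    iIndepFun (fun n ω => (x (2 * n) ω, x (2 * n + 1) ω)) μ := by
  -- Indexing by pair number and position turns the grouping into pairs into the currying of an
  -- infinite product measure.
  let Y : ℕ × Fin 2 → Ω → E := fun p => x (2 * p.1 + p.2)
  have hYm : ∀ p, Measurable (Y p) := fun p => hm _
  have hinj : Function.Injective fun p : ℕ × Fin 2 => 2 * p.1 + (p.2 : ℕ) := by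
    rintro ⟨a, i⟩ ⟨b, j⟩ hab
    simp only at hab
    have := i.2; have := j.2
    ext <;> simp only <;> omega
  have hY : iIndepFun Y μ := h.precomp hinj
  have hpr : ∀ p, IsProbabilityMeasure (μ.map (Y p)) := fun p =>
    Measure.isProbabilityMeasure_map (hYm p).aemeasurable
  have h1 := hY.map_fun_eq_infinitePi_map hYm
  have h2 : iIndepFun (fun (n : ℕ) ω (j : Fin 2) => Y (n, j) ω) μ := by
    rw [iIndepFun_iff_map_fun_eq_infinitePi_map (by fun_prop)]
    have h3 := Measure.infinitePi_map_curry (fun (n : ℕ) (j : Fin 2) => μ.map (Y (n, j)))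
    rw [show (Measure.infinitePi fun p : ℕ × Fin 2 => μ.map (Y (p.1, p.2)))
      = μ.map (fun ω p => Y p ω) from h1.symm, Measure.map_map (by fun_prop) (by fun_prop)] at h3
    have h4 : (MeasurableEquiv.curry ℕ (Fin 2) E) ∘ (fun ω p => Y p ω)
        = fun ω n j => Y (n, j) ω := by
      ext; simp
    rw [h4] at h3
    rw [h3]
    congr 1; ext1 n
    have h5 : iIndepFun (fun j : Fin 2 => Y (n, j)) μ :=
      hY.precomp (g := fun j : Fin 2 => (n, j)) (fun _ _ h => (Prod.ext_iff.1 h).2)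
    exact (h5.map_fun_eq_infinitePi_map (fun j => hYm _)).symm
  exact h2.comp (fun _ f => (f 0, f 1)) (fun _ => by fun_prop)

/-- A continuous linear image of a Gaussian measure is Gaussian, hence determined by its mean and
variance. -/
theorem map_inner_multivariateGaussian {d : ℕ} {S : Matrix (Fin d) (Fin d) ℝ} (hS : S.PosSemidef)
    (u : EuclideanSpace ℝ (Fin d)) :
    (multivariateGaussian 0 S).map (fun x => inner ℝ u x)
      = gaussianReal 0 (u.ofLp ⬝ᵥ S *ᵥ u.ofLp).toNNReal := by
  have h := IsGaussian.map_eq_gaussianReal (μ := multivariateGaussian 0 S) (innerSL ℝ u)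
  have hmean : ∫ x, innerSL ℝ u x ∂(multivariateGaussian 0 S) = 0 := by
    rw [(innerSL ℝ u).integral_comp_id_comm IsGaussian.integrable_id]
    simp
  have hvar : Var[innerSL ℝ u; multivariateGaussian 0 S] = u.ofLp ⬝ᵥ S *ᵥ u.ofLp := by
    rw [← covarianceBilin_multivariateGaussian (μ := 0) hS u u,
      covarianceBilin_self IsGaussian.memLp_two_id]
    rfl
  rw [hmean, hvar] at h
  exact h

theorem hasLaw_coord {d : ℕ} {Ω : Type*} [MeasurableSpace Ω] {μ : Measure Ω}
    {X : Ω → EuclideanSpace ℝ (Fin d)} (hX : HasLaw X (stdGaussian (EuclideanSpace ℝ (Fin d))) μ)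
    (i : Fin d) : HasLaw (fun ω => X ω i) (gaussianReal 0 1) μ := by
  have h := (measurePreserving_eval_multivariateGaussian (μ := 0)
    (S := (1 : Matrix (Fin d) (Fin d) ℝ)) Matrix.PosSemidef.one (i := i)).hasLaw
  rw [multivariateGaussian_zero_one] at h
  simp only [PiLp.zero_apply, Matrix.one_apply_eq, Real.toNNReal_one] at h
  exact h.comp hX

theorem integral_comp_of_hasLaw {Ω 𝓧 : Type*} [MeasurableSpace Ω] [MeasurableSpace 𝓧]
    {μ : Measure Ω} {ν : Measure 𝓧} {X : Ω → 𝓧} (hX : HasLaw X ν μ) {f : 𝓧 → ℝ}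
    (hf : Measurable f) : ∫ ω, f (X ω) ∂μ = ∫ z, f z ∂ν :=
  hX.integral_comp hf.aestronglyMeasurable

theorem integral_pow_of_hasLaw {Ω : Type*} [MeasurableSpace Ω] {μ : Measure Ω} {Z : Ω → ℝ}
    {v : ℝ≥0} (hZ : HasLaw Z (gaussianReal 0 v) μ) (n : ℕ) :
    ∫ ω, Z ω ^ n ∂μ = ∫ u, u ^ n ∂(gaussianReal 0 v) :=
  hZ.integral_comp (f := fun u => u ^ n) (by fun_prop)

theorem integrable_pow_of_hasLaw {Ω : Type*} [MeasurableSpace Ω] {μ : Measure Ω} {Z : Ω → ℝ}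
    {v : ℝ≥0} (hZ : HasLaw Z (gaussianReal 0 v) μ) (n : ℕ) :
    Integrable (fun ω => Z ω ^ n) μ := by
  have h := integrable_pow_gaussianReal v n
  rw [← hZ.map_eq] at h
  exact h.comp_aemeasurable hZ.aemeasurable

/-- AM–GM bounds the squared product by the average of the four eighth powers, each of mean 105. The
four variables need not be independent, so repeated coordinates are covered. -/
theorem integral_sq_mul_four_le {Ω : Type*} [MeasurableSpace Ω] {μ : Measure Ω}
    {a b c e : Ω → ℝ} (ha : HasLaw a (gaussianReal 0 1) μ) (hb : HasLaw b (gaussianReal 0 1) μ)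
    (hc : HasLaw c (gaussianReal 0 1) μ) (he : HasLaw e (gaussianReal 0 1) μ)
    {g : Ω → ℝ} (hg0 : ∀ ω, 0 ≤ g ω) (hg1 : ∀ ω, g ω ≤ 1) :
    ∫ ω, (g ω * (a ω * b ω * (c ω * e ω))) ^ 2 ∂μ ≤ 105 := by
  have h8 : ∀ {Z : Ω → ℝ}, HasLaw Z (gaussianReal 0 1) μ → ∫ ω, Z ω ^ 8 ∂μ = 105 := fun hZ => by
    rw [integral_pow_of_hasLaw hZ, integral_pow_eight_gaussianReal]; simp
  have hi : ∀ {Z : Ω → ℝ}, HasLaw Z (gaussianReal 0 1) μ → Integrable (fun ω => Z ω ^ 8) μ :=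
    fun hZ => integrable_pow_of_hasLaw hZ 8
  calc ∫ ω, (g ω * (a ω * b ω * (c ω * e ω))) ^ 2 ∂μ
      ≤ ∫ ω, (1 / 4 * (a ω ^ 8 + b ω ^ 8) + 1 / 4 * (c ω ^ 8 + e ω ^ 8)) ∂μ := by
        refine integral_mono_of_nonneg (ae_of_all _ fun ω => sq_nonneg _)
          ((((hi ha).add (hi hb)).const_mul _).add (((hi hc).add (hi he)).const_mul _))
          (ae_of_all _ fun ω => ?_)
        have hg2 : g ω ^ 2 ≤ 1 := pow_le_one₀ (hg0 ω) (hg1 ω)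
        have h1 : (g ω * (a ω * b ω * (c ω * e ω))) ^ 2 ≤ (a ω * b ω * (c ω * e ω)) ^ 2 := by
          rw [mul_pow]; exact mul_le_of_le_one_left (sq_nonneg _) hg2
        refine h1.trans ?_
        nlinarith [sq_nonneg (a ω ^ 2 * b ω ^ 2 - c ω ^ 2 * e ω ^ 2),
          sq_nonneg (a ω ^ 4 - b ω ^ 4), sq_nonneg (c ω ^ 4 - e ω ^ 4)]
    _ = 105 := by
        have i1 : Integrable (fun ω => a ω ^ 8 + b ω ^ 8) μ := (hi ha).add (hi hb)
        have i2 : Integrable (fun ω => c ω ^ 8 + e ω ^ 8) μ := (hi hc).add (hi he)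
        rw [integral_add (i1.const_mul _) (i2.const_mul _),
          integral_const_mul, integral_const_mul, integral_add (hi ha) (hi hb),
          integral_add (hi hc) (hi he), h8 ha, h8 hb, h8 hc, h8 he]
        norm_num

/-! ### The tilt at scale `|x|² ~ d`. -/

theorem gaussWeight_nonneg {d : ℕ} (s : ℝ≥0) (x : EuclideanSpace ℝ (Fin d)) :
    0 ≤ gaussWeight s x := Finset.prod_nonneg fun _ _ => (Real.exp_pos _).le

@[fun_prop]
theorem measurable_gaussWeight {d : ℕ} (s : ℝ≥0) :
    Measurable (gaussWeight s : EuclideanSpace ℝ (Fin d) → ℝ) := by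
  unfold gaussWeight; fun_prop

/-- The variance `d / (d + 1)` of the standard Gaussian tilted by `exp (-|x|² / (2 d))`. -/
def tiltVar (d : ℕ) : ℝ≥0 := d / (d + 1)

theorem tiltVar_ne_zero {d : ℕ} (hd : 0 < d) : tiltVar d ≠ 0 := by
  have : (0 : ℝ≥0) < d := by exact_mod_cast hd
  unfold tiltVar; positivity

theorem coe_tiltVar (d : ℕ) : (tiltVar d : ℝ) = d / (d + 1) := by
  simp [tiltVar]

/-- The variance is chosen so that `1/s - 1 = 1/d`: then the weight cuts off just above the typical
size `|x|² ~ d`. -/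
theorem gaussWeight_tiltVar {d : ℕ} (hd : 0 < d) (x : EuclideanSpace ℝ (Fin d)) :
    gaussWeight (tiltVar d) x = Real.exp (-(‖x‖ ^ 2 / (2 * d))) := by
  have hd' : (0 : ℝ) < d := by exact_mod_cast hd
  rw [gaussWeight, ← Real.exp_sum, EuclideanSpace.real_norm_sq_eq, Finset.sum_div,
    ← Finset.sum_neg_distrib]
  congr 1
  refine Finset.sum_congr rfl fun i _ => ?_
  rw [coe_tiltVar]
  field_simp
  ring

theorem gaussWeight_tiltVar_le_one {d : ℕ} (hd : 0 < d) (x : EuclideanSpace ℝ (Fin d)) :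
    gaussWeight (tiltVar d) x ≤ 1 := by
  rw [gaussWeight_tiltVar hd]
  exact Real.exp_le_one_iff.2 (neg_nonpos.2 (by positivity))

theorem gaussWeight_mul_sq_le {d : ℕ} (hd : 0 < d) (x : EuclideanSpace ℝ (Fin d)) :
    gaussWeight (tiltVar d) x * ‖x‖ ^ 2 ≤ 2 * d := by
  have hd' : (0 : ℝ) < d := by exact_mod_cast hd
  rw [gaussWeight_tiltVar hd, Real.exp_neg, inv_mul_le_iff₀ (Real.exp_pos _)]
  have h := Real.add_one_le_exp (‖x‖ ^ 2 / (2 * d))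
  have h2 : ‖x‖ ^ 2 = (2 * d) * (‖x‖ ^ 2 / (2 * d)) := by field_simp
  nlinarith

/-- With `u = |x|²/(2d)` this is `u² ≤ 2 exp u`. The fourth power is the degree of a Gram entry of
`x xᵀ`. -/
theorem gaussWeight_mul_pow_four_le {d : ℕ} (hd : 0 < d) (x : EuclideanSpace ℝ (Fin d)) :
    gaussWeight (tiltVar d) x * ‖x‖ ^ 4 ≤ 8 * d ^ 2 := by
  have hd' : (0 : ℝ) < d := by exact_mod_cast hd
  rw [gaussWeight_tiltVar hd, Real.exp_neg, inv_mul_le_iff₀ (Real.exp_pos _)]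
  have h0 : 0 ≤ ‖x‖ ^ 2 / (2 * d) := by positivity
  have h := Real.quadratic_le_exp_of_nonneg h0
  have h2 : ‖x‖ ^ 4 = (2 * d) ^ 2 * (‖x‖ ^ 2 / (2 * d)) ^ 2 := by field_simp
  rw [h2]
  have h3 : (‖x‖ ^ 2 / (2 * d)) ^ 2 ≤ 2 * Real.exp (‖x‖ ^ 2 / (2 * d)) := by linarith
  calc (2 * (d : ℝ)) ^ 2 * (‖x‖ ^ 2 / (2 * d)) ^ 2
      ≤ (2 * d) ^ 2 * (2 * Real.exp (‖x‖ ^ 2 / (2 * d))) := by gcongr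
    _ = _ := by ring

theorem abs_coord_le_norm {d : ℕ} (x : EuclideanSpace ℝ (Fin d)) (i : Fin d) : |x i| ≤ ‖x‖ := by
  simpa using PiLp.norm_apply_le x i

/-- The square is `(1 + 1/d)^(-d) ≥ exp(-1) ≥ 1/4`, so the mass lost to the tilt is bounded
independently of the dimension. -/
theorem half_le_sqrt_tiltVar_pow {d : ℕ} (hd : 0 < d) :
    1 / 2 ≤ Real.sqrt (tiltVar d) ^ d := by
  have hd' : (0 : ℝ) < d := by exact_mod_cast hd
  have h1 : ((1 : ℝ) + 1 / d) ^ d ≤ 4 := by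
    calc ((1 : ℝ) + 1 / d) ^ d ≤ Real.exp (1 / d) ^ d := by
          gcongr; linarith [Real.add_one_le_exp (1 / (d : ℝ))]
      _ = Real.exp 1 := by rw [← Real.exp_nat_mul]; congr 1; field_simp
      _ ≤ 4 := by linarith [Real.exp_one_lt_d9]
  have h2 : (tiltVar d : ℝ) = (1 + 1 / (d : ℝ))⁻¹ := by rw [coe_tiltVar]; field_simp
  have h3 : (1 / 2 : ℝ) ^ 2 ≤ (Real.sqrt (tiltVar d) ^ d) ^ 2 := by
    rw [← pow_mul, mul_comm d 2, pow_mul, Real.sq_sqrt (by positivity), h2, inv_pow]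
    rw [le_inv_comm₀ (by norm_num) (by positivity)]
    norm_num at h1 ⊢
    exact h1
  exact (pow_le_pow_iff_left₀ (by norm_num) (by positivity) two_ne_zero).1 h3

theorem half_le_tiltVar {d : ℕ} (hd : 0 < d) : (1 / 2 : ℝ) ≤ tiltVar d := by
  have hd' : (1 : ℝ) ≤ d := by exact_mod_cast hd
  rw [coe_tiltVar, div_le_div_iff₀ (by norm_num) (by positivity)]
  linarith

/-! ### Lower bounds for the two designs. -/

theorem dotProduct_mulVec_eq_sum {d : ℕ} (M : Matrix (Fin d) (Fin d) ℝ) (u v : Fin d → ℝ) :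
    u ⬝ᵥ M *ᵥ v = ∑ p : Fin d × Fin d, M p.1 p.2 * (u p.1 * v p.2) := by
  rw [Fintype.sum_prod_type]
  simp only [dotProduct, Matrix.mulVec, Finset.mul_sum]
  exact Finset.sum_congr rfl fun i _ => Finset.sum_congr rfl fun j _ => by ring

theorem sum_frob_sq {d : ℕ} (M : Matrix (Fin d) (Fin d) ℝ) :
    ∑ p : Fin d × Fin d, M p.1 p.2 ^ 2 = frobNorm M ^ 2 := by
  have h : 0 ≤ ∑ i, ∑ j, M i j ^ 2 :=
    Finset.sum_nonneg fun i _ => Finset.sum_nonneg fun j _ => sq_nonneg _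
  rw [frobNorm, Real.sq_sqrt h, Fintype.sum_prod_type]

/-- Here `e = 1/(32d²)` and `v = 105`. The value `l = e/(2v) = 1/(6720d²)` maximizes `l e - l² v`,
with maximum `e²/(4v) = 1/(430080d⁴)`. -/
theorem gram_exponent {d : ℕ} (N : ℕ) :
    2 * (Fintype.card (Fin d × Fin d) : ℝ) ^ 2 * Real.exp (-(N * (1 / (6720 * d ^ 2)
        * (1 / (32 * d ^ 2)) - (1 / (6720 * d ^ 2)) ^ 2 * 105)))
      = 2 * (d : ℝ) ^ 4 * Real.exp (-(N / (430080 * d ^ 4))) := by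
  have h1 : (1 / (6720 * (d : ℝ) ^ 2) * (1 / (32 * d ^ 2)) - (1 / (6720 * (d : ℝ) ^ 2)) ^ 2 * 105)
      = 1 / (430080 * d ^ 4) := by
    rcases eq_or_ne (d : ℝ) 0 with h | h
    · simp [h]
    · field_simp; norm_num
  rw [h1]
  simp only [Fintype.card_prod, Fintype.card_fin, Nat.cast_mul]
  congr 1
  · ring
  · congr 1; ring

/-- By Isserlis' formula the tilted expectation of the quadratic form is `p s² ((tr M)² + 2 ‖M‖_F²)`
with `p s² ≥ 1/8`, that is at least `‖M‖_F²/4`; the fluctuations cost `‖M‖_F²/32`. -/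
theorem exists_cov_design_lower_bound {d : ℕ} (hd : 0 < d) {Ω : Type*} [MeasurableSpace Ω]
    {μ : Measure Ω} [IsProbabilityMeasure μ] {x : ℕ → Ω → EuclideanSpace ℝ (Fin d)}
    (hx : iIndepFun x μ) (hm : ∀ t, Measurable (x t))
    (hl : ∀ t, HasLaw (x t) (stdGaussian (EuclideanSpace ℝ (Fin d))) μ) (N : ℕ) :
    ∃ G : Set Ω, MeasurableSet G ∧
      μ.real Gᶜ ≤ 2 * (d : ℝ) ^ 4 * Real.exp (-(N / (430080 * d ^ 4))) ∧
      ∀ ω ∈ G, ∀ M : Matrix (Fin d) (Fin d) ℝ, M.IsSymm →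
        N / 32 * frobNorm M ^ 2
          ≤ ∑ n ∈ Finset.range N, ((x n ω).ofLp ⬝ᵥ M *ᵥ (x n ω).ofLp) ^ 2 := by
  have hd' : (1 : ℝ) ≤ d := by exact_mod_cast hd
  set s := tiltVar d
  set p : ℝ := Real.sqrt s ^ d
  have hp : 1 / 2 ≤ p := half_le_sqrt_tiltVar_pow hd
  have hs : (1 / 2 : ℝ) ≤ s := half_le_tiltVar hd
  obtain ⟨G, hG, hP, h⟩ := exists_gram_lower_bound (ι := Fin d × Fin d) hx hm
    (g := gaussWeight s) (measurable_gaussWeight s)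
    (gaussWeight_tiltVar_le_one hd) (φ := fun a x => x a.1 * x a.2) (fun a => by fun_prop)
    (b := 8 * d ^ 2) (v := 105) (l := 1 / (6720 * d ^ 2)) (e := 1 / (32 * d ^ 2))
    (Q := fun a a' => p * (s ^ 2 * ((if a.1 = a.2 then 1 else 0) * (if a'.1 = a'.2 then 1 else 0)
        + (if a.1 = a'.1 then 1 else 0) * (if a.2 = a'.2 then 1 else 0)
        + (if a.1 = a'.2 then 1 else 0) * (if a.2 = a'.1 then 1 else 0))))
    (fun a a' x => by
      rw [abs_mul, abs_of_nonneg (gaussWeight_nonneg _ _)]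
      refine le_trans (mul_le_mul_of_nonneg_left ?_ (gaussWeight_nonneg _ _))
        (gaussWeight_mul_pow_four_le hd x)
      rw [abs_mul, abs_mul, abs_mul]
      calc |x a.1| * |x a.2| * (|x a'.1| * |x a'.2|) ≤ ‖x‖ * ‖x‖ * (‖x‖ * ‖x‖) := by
            gcongr <;> exact abs_coord_le_norm _ _
        _ = ‖x‖ ^ 4 := by ring)
    (fun n a a' => by
      rw [← integral_gaussWeight_four (tiltVar_ne_zero hd)]
      rw [← integral_comp_of_hasLaw (hl n) (by fun_prop)]
      refine integral_congr_ae (ae_of_all _ fun ω => ?_)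
      simp only [s, mul_assoc])
    (fun n a a' => integral_sq_mul_four_le (hasLaw_coord (hl n) _) (hasLaw_coord (hl n) _)
      (hasLaw_coord (hl n) _) (hasLaw_coord (hl n) _) (fun _ => gaussWeight_nonneg _ _)
      (fun _ => gaussWeight_tiltVar_le_one hd _))
    (by positivity)
    (by rw [div_mul_eq_mul_div, div_le_one (by positivity)]; nlinarith) N
  rw [gram_exponent] at hP
  refine ⟨G, hG, hP, fun ω hω M hM => ?_⟩
  have h1 := h ω hω (fun a => M a.1 a.2)
  simp_rw [dotProduct_mulVec_eq_sum]
  refine le_trans ?_ h1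
  rw [div_mul_eq_mul_div, mul_div_assoc]
  refine mul_le_mul_of_nonneg_left ?_ (Nat.cast_nonneg _)
  rw [sum_frob_sq]
  have hcard : (1 / (32 * (d : ℝ) ^ 2)) * (Fintype.card (Fin d × Fin d) : ℝ) = 1 / 32 := by
    simp only [Fintype.card_prod, Fintype.card_fin, Nat.cast_mul]; field_simp
  rw [hcard]
  have hQ : ∑ a : Fin d × Fin d, ∑ a' : Fin d × Fin d, M a.1 a.2 * M a'.1 a'.2
      * (p * (s ^ 2 * ((if a.1 = a.2 then 1 else 0) * (if a'.1 = a'.2 then 1 else 0)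
        + (if a.1 = a'.1 then 1 else 0) * (if a.2 = a'.2 then 1 else 0)
        + (if a.1 = a'.2 then 1 else 0) * (if a.2 = a'.1 then 1 else 0))))
      = p * s ^ 2 * ((∑ i, M i i) ^ 2 + 2 * frobNorm M ^ 2) := by
    have e1 : ∑ a : Fin d × Fin d, ∑ a' : Fin d × Fin d, M a.1 a.2 * M a'.1 a'.2
        * ((if a.1 = a.2 then 1 else 0) * (if a'.1 = a'.2 then 1 else 0)) = (∑ i, M i i) ^ 2 := by
      have : ∀ a a' : Fin d × Fin d, M a.1 a.2 * M a'.1 a'.2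
        * ((if a.1 = a.2 then 1 else 0) * (if a'.1 = a'.2 then 1 else 0))
        = (M a.1 a.2 * if a.1 = a.2 then 1 else 0)
          * (M a'.1 a'.2 * if a'.1 = a'.2 then 1 else 0) := fun a a' => by ring
      simp_rw [this]
      rw [← Finset.sum_mul_sum, ← sq, Fintype.sum_prod_type]
      simp
    have e2 : ∑ a : Fin d × Fin d, ∑ a' : Fin d × Fin d, M a.1 a.2 * M a'.1 a'.2
        * ((if a.1 = a'.1 then 1 else 0) * (if a.2 = a'.2 then 1 else 0)) = frobNorm M ^ 2 := by
      rw [← sum_frob_sq]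
      refine Finset.sum_congr rfl fun a _ => ?_
      rw [Fintype.sum_prod_type]
      simp [sq]
    -- The crossed pairing gives `⟨M, Mᵀ⟩`; symmetry of `M` enters only here.
    have e3 : ∑ a : Fin d × Fin d, ∑ a' : Fin d × Fin d, M a.1 a.2 * M a'.1 a'.2
        * ((if a.1 = a'.2 then 1 else 0) * (if a.2 = a'.1 then 1 else 0)) = frobNorm M ^ 2 := by
      rw [← sum_frob_sq]
      refine Finset.sum_congr rfl fun a _ => ?_
      rw [Fintype.sum_prod_type]
      simp [sq, hM.apply a.1 a.2]
    have e4 : p * (s : ℝ) ^ 2 * ((∑ i, M i i) ^ 2 + 2 * frobNorm M ^ 2)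
        = p * (s : ℝ) ^ 2 * ((∑ i, M i i) ^ 2 + frobNorm M ^ 2 + frobNorm M ^ 2) := by ring
    rw [e4]
    nth_rw 2 [← e3]
    rw [← e2, ← e1, ← Finset.sum_add_distrib, ← Finset.sum_add_distrib, Finset.mul_sum]
    refine Finset.sum_congr rfl fun a _ => ?_
    rw [← Finset.sum_add_distrib, ← Finset.sum_add_distrib, Finset.mul_sum]
    exact Finset.sum_congr rfl fun a' _ => by ring
  rw [hQ]
  have h2 : 1 / 8 ≤ p * (s : ℝ) ^ 2 := by nlinarith
  have h3 : 0 ≤ (∑ i, M i i) ^ 2 := sq_nonneg _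
  have h4 : 0 ≤ frobNorm M ^ 2 := sq_nonneg _
  nlinarith

/-- Consecutive products share a covariate, so only pairs starting at even times are kept; these are
independent. Tilting both members gives the expected form `(p s)² ‖M‖_F² ≥ ‖M‖_F²/16`, for every
`M`. Subtracting `1/32` leaves exactly `1/32`, which is what fixes the precision `e`. -/
theorem exists_cross_design_lower_bound {d : ℕ} (hd : 0 < d) {Ω : Type*} [MeasurableSpace Ω]
    {μ : Measure Ω} [IsProbabilityMeasure μ] {x : ℕ → Ω → EuclideanSpace ℝ (Fin d)}
    (hx : iIndepFun x μ) (hm : ∀ t, Measurable (x t))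
    (hl : ∀ t, HasLaw (x t) (stdGaussian (EuclideanSpace ℝ (Fin d))) μ) (N : ℕ) :
    ∃ G : Set Ω, MeasurableSet G ∧
      μ.real Gᶜ ≤ 2 * (d : ℝ) ^ 4 * Real.exp (-(N / (430080 * d ^ 4))) ∧
      ∀ ω ∈ G, ∀ M : Matrix (Fin d) (Fin d) ℝ,
        N / 32 * frobNorm M ^ 2
          ≤ ∑ n ∈ Finset.range N,
            ((x (2 * n + 1) ω).ofLp ⬝ᵥ M *ᵥ (x (2 * n) ω).ofLp) ^ 2 := by
  have hd' : (1 : ℝ) ≤ d := by exact_mod_cast hd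
  set s := tiltVar d
  set p : ℝ := Real.sqrt s ^ d
  have hp : 1 / 2 ≤ p := half_le_sqrt_tiltVar_pow hd
  have hs : (1 / 2 : ℝ) ≤ s := half_le_tiltVar hd
  obtain ⟨G, hG, hP, h⟩ := exists_gram_lower_bound (ι := Fin d × Fin d) (iIndepFun_pairs hx hm)
    (fun n => (hm _).prodMk (hm _))
    (g := fun z => gaussWeight s z.1 * gaussWeight s z.2)
    (((measurable_gaussWeight s).comp measurable_fst).mul
      ((measurable_gaussWeight s).comp measurable_snd))
    (fun z => mul_le_one₀ (gaussWeight_tiltVar_le_one hd _) (gaussWeight_nonneg _ _)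
      (gaussWeight_tiltVar_le_one hd _))
    (φ := fun a z => z.2 a.1 * z.1 a.2) (fun a => by fun_prop)
    (b := 8 * d ^ 2) (v := 105) (l := 1 / (6720 * d ^ 2)) (e := 1 / (32 * d ^ 2))
    (Q := fun a a' => (p * (s * if a.1 = a'.1 then 1 else 0))
      * (p * (s * if a.2 = a'.2 then 1 else 0)))
    (fun a a' z => by
      rw [abs_mul, abs_of_nonneg (mul_nonneg (gaussWeight_nonneg _ _) (gaussWeight_nonneg _ _)),
        abs_mul, abs_mul, abs_mul]
      have h1 := gaussWeight_mul_sq_le hd z.1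
      have h2 := gaussWeight_mul_sq_le hd z.2
      have h3 := gaussWeight_nonneg s z.1
      have h4 := gaussWeight_nonneg s z.2
      calc gaussWeight s z.1 * gaussWeight s z.2 * (|z.2 a.1| * |z.1 a.2| * (|z.2 a'.1| * |z.1 a'.2|))
          ≤ gaussWeight s z.1 * gaussWeight s z.2 * (‖z.2‖ * ‖z.1‖ * (‖z.2‖ * ‖z.1‖)) := by
            gcongr <;> exact abs_coord_le_norm _ _
        _ = (gaussWeight s z.1 * ‖z.1‖ ^ 2) * (gaussWeight s z.2 * ‖z.2‖ ^ 2) := by ring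
        _ ≤ (2 * d) * (2 * d) := by gcongr
        _ ≤ 8 * d ^ 2 := by nlinarith)
    (fun n a a' => by
      rw [← integral_gaussWeight_two (tiltVar_ne_zero hd), ← integral_gaussWeight_two
        (tiltVar_ne_zero hd)]
      rw [← integral_comp_of_hasLaw (hl (2 * n + 1)) (by fun_prop),
        ← integral_comp_of_hasLaw (hl (2 * n)) (by fun_prop)]
      have hind : IndepFun (x (2 * n + 1)) (x (2 * n)) μ := hx.indepFun (by omega)
      have hf : ∀ i j : Fin d, Measurable
          fun z : EuclideanSpace ℝ (Fin d) => gaussWeight s z * (z i * z j) :=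
        fun i j => (measurable_gaussWeight s).mul (by fun_prop)
      have := (hind.comp (hf a.1 a'.1) (hf a.2 a'.2)).integral_fun_mul_eq_mul_integral
        ((hf _ _).comp (hm _)).aestronglyMeasurable ((hf _ _).comp (hm _)).aestronglyMeasurable
      refine Eq.trans ?_ this
      refine integral_congr_ae (ae_of_all _ fun ω => ?_)
      simp only [Function.comp_apply]; ring)
    (fun n a a' => integral_sq_mul_four_le (hasLaw_coord (hl _) _) (hasLaw_coord (hl _) _)
      (hasLaw_coord (hl _) _) (hasLaw_coord (hl _) _)
      (fun _ => mul_nonneg (gaussWeight_nonneg _ _) (gaussWeight_nonneg _ _))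
      (fun _ => mul_le_one₀ (gaussWeight_tiltVar_le_one hd _) (gaussWeight_nonneg _ _)
        (gaussWeight_tiltVar_le_one hd _)))
    (by positivity)
    (by rw [div_mul_eq_mul_div, div_le_one (by positivity)]; nlinarith) N
  rw [gram_exponent] at hP
  refine ⟨G, hG, hP, fun ω hω M => ?_⟩
  have h1 := h ω hω (fun a => M a.1 a.2)
  simp_rw [dotProduct_mulVec_eq_sum]
  refine le_trans ?_ h1
  rw [div_mul_eq_mul_div, mul_div_assoc]
  refine mul_le_mul_of_nonneg_left ?_ (Nat.cast_nonneg _)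
  rw [sum_frob_sq]
  have hcard : (1 / (32 * (d : ℝ) ^ 2)) * (Fintype.card (Fin d × Fin d) : ℝ) = 1 / 32 := by
    simp only [Fintype.card_prod, Fintype.card_fin, Nat.cast_mul]; field_simp
  rw [hcard]
  have hQ : ∑ a : Fin d × Fin d, ∑ a' : Fin d × Fin d, M a.1 a.2 * M a'.1 a'.2
      * ((p * (s * if a.1 = a'.1 then 1 else 0)) * (p * (s * if a.2 = a'.2 then 1 else 0)))
      = (p * s) ^ 2 * frobNorm M ^ 2 := by
    rw [← sum_frob_sq, Finset.mul_sum]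
    refine Finset.sum_congr rfl fun a _ => ?_
    rw [Fintype.sum_prod_type]
    simp [← mul_assoc]
    ring
  rw [hQ]
  have h2 : 1 / 4 ≤ p * (s : ℝ) := by nlinarith
  have h3 : (1 / 4) ^ 2 ≤ (p * (s : ℝ)) ^ 2 := by gcongr
  have h4 : 0 ≤ frobNorm M ^ 2 := sq_nonneg _
  nlinarith

/-! ### Variables with all moments and vectors with Gaussian marginals. -/

/-- All moments of `f` are finite. -/
def AllLp {Ω : Type*} [MeasurableSpace Ω] (f : Ω → ℝ) (μ : Measure Ω) : Prop :=
  ∀ p : ℝ≥0, MemLp f p μ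

section AllLp

variable {Ω : Type*} [MeasurableSpace Ω] {μ : Measure Ω} {f g : Ω → ℝ}

theorem AllLp.add (hf : AllLp f μ) (hg : AllLp g μ) : AllLp (fun ω => f ω + g ω) μ :=
  fun p => (hf p).add (hg p)

theorem AllLp.sub (hf : AllLp f μ) (hg : AllLp g μ) : AllLp (fun ω => f ω - g ω) μ :=
  fun p => (hf p).sub (hg p)

/-- Hölder with exponents `2p` and `2p`. Quantifying over all finite `p` makes the class an algebra,
so polynomials in Gaussians need no separate integrability proofs. -/
theorem AllLp.mul (hf : AllLp f μ) (hg : AllLp g μ) : AllLp (fun ω => f ω * g ω) μ := by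
  intro p
  have : ENNReal.HolderTriple ((2 * p : ℝ≥0) : ℝ≥0∞) ((2 * p : ℝ≥0) : ℝ≥0∞) (p : ℝ≥0∞) := by
    constructor
    rw [ENNReal.coe_mul, ENNReal.mul_inv (by simp) (by simp), ← add_mul]
    simp [ENNReal.inv_two_add_inv_two]
  exact (hg (2 * p)).mul (hf (2 * p))

theorem AllLp.const [IsFiniteMeasure μ] (c : ℝ) : AllLp (fun _ => c) μ := fun _ => memLp_const c

theorem AllLp.pow [IsFiniteMeasure μ] (hf : AllLp f μ) (n : ℕ) : AllLp (fun ω => f ω ^ n) μ := by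
  induction n with
  | zero => simpa using AllLp.const (μ := μ) 1
  | succ n ih => simpa only [pow_succ] using ih.mul hf

theorem AllLp.const_mul (hf : AllLp f μ) (c : ℝ) : AllLp (fun ω => c * f ω) μ :=
  fun p => (hf p).const_mul c

theorem AllLp.sum {ι : Type*} {s : Finset ι} {F : ι → Ω → ℝ} (h : ∀ i ∈ s, AllLp (F i) μ) :
    AllLp (fun ω => ∑ i ∈ s, F i ω) μ :=
  fun p => memLp_finsetSum s fun i hi => h i hi p

theorem AllLp.integrable (hf : AllLp f μ) : Integrable f μ :=
  memLp_one_iff_integrable.1 (by simpa using hf 1)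

theorem AllLp.aestronglyMeasurable (hf : AllLp f μ) : AEStronglyMeasurable f μ :=
  (hf 1).aestronglyMeasurable

theorem AllLp.of_hasLaw {Z : Ω → ℝ} {v : ℝ≥0} (hZ : HasLaw Z (gaussianReal 0 v) μ) :
    AllLp Z μ := by
  intro p
  have h := memLp_id_gaussianReal (μ := 0) (v := v) p
  rw [← hZ.map_eq] at h
  exact h.comp_of_map hZ.aemeasurable

end AllLp

/-- The one-dimensional marginals of `Z` are those of `N(0, S)`. -/
def HasGaussianMarginals {d : ℕ} {Ω : Type*} [MeasurableSpace Ω] (Z : Ω → EuclideanSpace ℝ (Fin d))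
    (S : Matrix (Fin d) (Fin d) ℝ) (μ : Measure Ω) : Prop :=
  ∀ u : EuclideanSpace ℝ (Fin d),
    HasLaw (fun ω => inner ℝ u (Z ω)) (gaussianReal 0 (u.ofLp ⬝ᵥ S *ᵥ u.ofLp).toNNReal) μ

section Marginals

variable {d : ℕ} {Ω : Type*} [MeasurableSpace Ω] {μ : Measure Ω}
  {Z : Ω → EuclideanSpace ℝ (Fin d)} {S : Matrix (Fin d) (Fin d) ℝ}

theorem HasGaussianMarginals.of_hasLaw (hS : S.PosSemidef)
    (hZ : HasLaw Z (multivariateGaussian 0 S) μ) : HasGaussianMarginals Z S μ := by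
  intro u
  have hm : Measurable fun x : EuclideanSpace ℝ (Fin d) => inner ℝ u x := by fun_prop
  refine ⟨hm.comp_aemeasurable hZ.aemeasurable, ?_⟩
  rw [← map_inner_multivariateGaussian hS u, ← hZ.map_eq,
    AEMeasurable.map_map_of_aemeasurable hm.aemeasurable hZ.aemeasurable]
  rfl

theorem inner_single_one_left (x : EuclideanSpace ℝ (Fin d)) (i : Fin d) :
    inner ℝ (EuclideanSpace.single i (1 : ℝ)) x = x i := by
  simp [EuclideanSpace.inner_single_left]

theorem posSemidef_quadForm_nonneg (hS : S.PosSemidef) (u : Fin d → ℝ) :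
    0 ≤ u ⬝ᵥ S *ᵥ u := by
  simpa using hS.dotProduct_mulVec_nonneg u

theorem HasGaussianMarginals.hasLaw_coord (hZ : HasGaussianMarginals Z S μ) (i : Fin d) :
    HasLaw (fun ω => Z ω i) (gaussianReal 0 (S i i).toNNReal) μ := by
  have h := hZ (EuclideanSpace.single i 1)
  simpa [inner_single_one_left] using h

theorem HasGaussianMarginals.allLp (hZ : HasGaussianMarginals Z S μ) (i : Fin d) :
    AllLp (fun ω => Z ω i) μ :=
  AllLp.of_hasLaw (hZ.hasLaw_coord i)

theorem HasGaussianMarginals.integral_coord (hZ : HasGaussianMarginals Z S μ) (i : Fin d) :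
    ∫ ω, Z ω i ∂μ = 0 := by
  have := integral_pow_of_hasLaw (hZ.hasLaw_coord i) 1
  rw [integral_pow_one_gaussianReal] at this
  simpa using this

theorem HasGaussianMarginals.integral_inner_sq (hZ : HasGaussianMarginals Z S μ)
    (hS : S.PosSemidef) (u : EuclideanSpace ℝ (Fin d)) :
    ∫ ω, inner ℝ u (Z ω) ^ 2 ∂μ = u.ofLp ⬝ᵥ S *ᵥ u.ofLp := by
  rw [integral_pow_of_hasLaw (hZ u), integral_pow_two_gaussianReal,
    Real.coe_toNNReal _ (posSemidef_quadForm_nonneg hS _)]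

theorem HasGaussianMarginals.integral_inner_pow_four (hZ : HasGaussianMarginals Z S μ)
    (hS : S.PosSemidef) (u : EuclideanSpace ℝ (Fin d)) :
    ∫ ω, inner ℝ u (Z ω) ^ 4 ∂μ = 3 * (u.ofLp ⬝ᵥ S *ᵥ u.ofLp) ^ 2 := by
  rw [integral_pow_of_hasLaw (hZ u), integral_pow_four_gaussianReal,
    Real.coe_toNNReal _ (posSemidef_quadForm_nonneg hS _)]

/-- Polarization: only one-dimensional marginals are known, so the mixed moment comes from the
variances in the directions `e_i`, `e_j` and `e_i + e_j`. -/
theorem HasGaussianMarginals.integral_coord_mul_coord (hZ : HasGaussianMarginals Z S μ)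
    (hS : S.PosSemidef) (i j : Fin d) : ∫ ω, Z ω i * Z ω j ∂μ = S i j := by
  have hi := hZ.integral_inner_sq hS (EuclideanSpace.single i 1)
  have hj := hZ.integral_inner_sq hS (EuclideanSpace.single j 1)
  have hij := hZ.integral_inner_sq hS (EuclideanSpace.single i 1 + EuclideanSpace.single j 1)
  have hsymm : S j i = S i j := by simpa using hS.isHermitian.apply i j
  simp only [inner_add_left, inner_single_one_left] at hi hj hij
  simp only [WithLp.ofLp_add, PiLp.ofLp_single, Matrix.mulVec_add, add_dotProduct,
    dotProduct_add, Matrix.mulVec_single_one, single_one_dotProduct, Matrix.col_apply] at hi hj hij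
  have e : ∀ ω, (Z ω i + Z ω j) ^ 2 = (Z ω i ^ 2 + Z ω j ^ 2) + 2 * (Z ω i * Z ω j) :=
    fun ω => by ring
  simp_rw [e] at hij
  have i1 : Integrable (fun ω => Z ω i ^ 2) μ := integrable_pow_of_hasLaw (hZ.hasLaw_coord i) 2
  have i2 : Integrable (fun ω => Z ω j ^ 2) μ := integrable_pow_of_hasLaw (hZ.hasLaw_coord j) 2
  have i3 : Integrable (fun ω => Z ω i * Z ω j) μ := ((hZ.allLp i).mul (hZ.allLp j)).integrable
  have i12 : Integrable (fun ω => Z ω i ^ 2 + Z ω j ^ 2) μ := i1.add i2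
  rw [integral_add i12 (i3.const_mul 2), integral_add i1 i2, integral_const_mul, hi, hj,
    hsymm] at hij
  linarith

end Marginals

/-! ### The past of the state process and the propagation of its second moments. -/

/-- The two hypotheses make the law of the triple a threefold product measure, which may be
bracketed either way. -/
theorem indepFun_prodMk_left {Ω α β γ : Type*} [MeasurableSpace Ω]
    [MeasurableSpace α] [MeasurableSpace β] [MeasurableSpace γ] {μ : Measure Ω}
    [IsProbabilityMeasure μ] {X : Ω → α} {Y : Ω → β} {Z : Ω → γ} (hX : Measurable X)
    (hY : Measurable Y) (hZ : Measurable Z) (h : IndepFun X (fun ω => (Y ω, Z ω)) μ)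
    (h' : IndepFun Y Z μ) : IndepFun (fun ω => (X ω, Y ω)) Z μ := by
  have hpX : IsProbabilityMeasure (μ.map X) := Measure.isProbabilityMeasure_map hX.aemeasurable
  have hpY : IsProbabilityMeasure (μ.map Y) := Measure.isProbabilityMeasure_map hY.aemeasurable
  have hpZ : IsProbabilityMeasure (μ.map Z) := Measure.isProbabilityMeasure_map hZ.aemeasurable
  have hXY : IndepFun X Y μ := h.comp measurable_id measurable_fst
  rw [indepFun_iff_map_prod_eq_prod_map_map (by fun_prop) (by fun_prop)] at h h' hXY ⊢
  rw [hXY]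
  rw [h'] at h
  have e : (fun ω => ((X ω, Y ω), Z ω))
      = MeasurableEquiv.prodAssoc.symm ∘ (fun ω => (X ω, (Y ω, Z ω))) := by
    ext <;> rfl
  rw [e, ← Measure.map_map (by fun_prop) (by fun_prop), h]
  exact (MeasureTheory.measurePreserving_prodAssoc _ _ _).symm.map_eq

section Past

variable {d : ℕ} {Ω : Type*} {A Sw : Matrix (Fin d) (Fin d) ℝ}
  {β₀ : Ω → EuclideanSpace ℝ (Fin d)} {w : ℕ → Ω → EuclideanSpace ℝ (Fin d)}

/-- The information carried by the initial state and the process noise before time `t`. -/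
abbrev past (β₀ : Ω → EuclideanSpace ℝ (Fin d)) (w : ℕ → Ω → EuclideanSpace ℝ (Fin d)) (t : ℕ) :
    MeasurableSpace Ω :=
  MeasurableSpace.comap (fun ω => (β₀ ω, fun r : Finset.range t => w r ω)) inferInstance

theorem measurable_past_init (t : ℕ) : Measurable[past β₀ w t] β₀ := by
  have h : Measurable[past β₀ w t] (fun ω => (β₀ ω, fun r : Finset.range t => w r ω)) :=
    comap_measurable _
  exact measurable_fst.comp h

theorem measurable_past_noise {r t : ℕ} (hr : r < t) : Measurable[past β₀ w t] (w r) := by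
  have h : Measurable[past β₀ w t] (fun ω => (β₀ ω, fun r : Finset.range t => w r ω)) :=
    comap_measurable _
  exact ((measurable_pi_apply (⟨r, Finset.mem_range.2 hr⟩ : Finset.range t)).comp
    measurable_snd).comp h

theorem past_mono {s t : ℕ} (hst : s ≤ t) : past β₀ w s ≤ past β₀ w t := by
  have h : Measurable[past β₀ w t] (fun ω => (β₀ ω, fun r : Finset.range s => w r ω)) := by
    refine (measurable_past_init t).prodMk ?_
    let _ : MeasurableSpace Ω := past β₀ w t
    refine measurable_pi_iff.2 fun r => ?_
    exact measurable_past_noise ((Finset.mem_range.1 r.2).trans_le hst)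
  exact h.comap_le

theorem state_succ_apply (t : ℕ) (ω : Ω) (i : Fin d) :
    state A β₀ w (t + 1) ω i = ∑ a, A i a * state A β₀ w t ω a + w t ω i := by
  simp [state, Matrix.mulVec, dotProduct]

theorem measurable_past_state (t : ℕ) : Measurable[past β₀ w t] (state A β₀ w t) := by
  induction t with
  | zero => exact measurable_past_init 0
  | succ t ih =>
    have h1 : Measurable[past β₀ w (t + 1)] (state A β₀ w t) := ih.mono (past_mono t.le_succ) le_rfl
    have h2 : Measurable[past β₀ w (t + 1)] (w t) := measurable_past_noise t.lt_succ_self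
    have h3 : Measurable[past β₀ w (t + 1)] fun ω =>
      Matrix.toEuclideanCLM (n := Fin d) (𝕜 := ℝ) A (state A β₀ w t ω) :=
      (ContinuousLinearMap.measurable _).comp h1
    exact h3.add h2

theorem measurable_past_state_apply (t : ℕ) (i : Fin d) :
    Measurable[past β₀ w t] (fun ω => state A β₀ w t ω i) := by
  have h : Measurable fun z : EuclideanSpace ℝ (Fin d) => z i := by fun_prop
  exact h.comp (measurable_past_state t)

/-- The centred matrix `β_t β_tᵀ - Σ_∞`. -/
def stateDev (A Sw : Matrix (Fin d) (Fin d) ℝ) (β₀ : Ω → EuclideanSpace ℝ (Fin d))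
    (w : ℕ → Ω → EuclideanSpace ℝ (Fin d)) (t : ℕ) (ω : Ω) : Matrix (Fin d) (Fin d) ℝ :=
  Matrix.of fun i j => state A β₀ w t ω i * state A β₀ w t ω j - stationaryCov A Sw i j

theorem measurable_past_stateDev (t : ℕ) (i j : Fin d) :
    Measurable[past β₀ w t] fun ω => stateDev A Sw β₀ w t ω i j :=
  ((measurable_past_state_apply t i).mul (measurable_past_state_apply t j)).sub_const _

/-- The centred matrix `β_{t+1} β_tᵀ - A Σ_∞`. -/
def crossDev (A Sw : Matrix (Fin d) (Fin d) ℝ) (β₀ : Ω → EuclideanSpace ℝ (Fin d))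
    (w : ℕ → Ω → EuclideanSpace ℝ (Fin d)) (t : ℕ) (ω : Ω) : Matrix (Fin d) (Fin d) ℝ :=
  Matrix.of fun i j =>
    state A β₀ w (t + 1) ω i * state A β₀ w t ω j - (A * stationaryCov A Sw) i j

theorem measurable_past_crossDev (t : ℕ) (i j : Fin d) :
    Measurable[past β₀ w (t + 1)] fun ω => crossDev A Sw β₀ w t ω i j :=
  ((measurable_past_state_apply (t + 1) i).mul
    ((measurable_past_state_apply t j).mono (past_mono t.le_succ) le_rfl)).sub_const _

end Past

section Model

variable {d : ℕ} {Ω : Type*} [mΩ : MeasurableSpace Ω] {μ : Measure Ω}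
  {A Sw : Matrix (Fin d) (Fin d) ℝ} {σ : ℝ≥0}
  {β₀ : Ω → EuclideanSpace ℝ (Fin d)} {w x : ℕ → Ω → EuclideanSpace ℝ (Fin d)} {ε : ℕ → Ω → ℝ}

variable (h : IsGaussianModel μ A Sw σ β₀ w x ε)
include h

theorem IsGaussianModel.past_le (t : ℕ) : past β₀ w t ≤ mΩ :=
  Measurable.comap_le (h.measurable_β₀.prodMk (measurable_pi_lambda _ fun r => h.measurable_w r))

theorem IsGaussianModel.measurable_state (t : ℕ) : Measurable (state A β₀ w t) :=
  (measurable_past_state t).mono (h.past_le t) le_rfl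

theorem IsGaussianModel.indepFun_past [IsProbabilityMeasure μ] (t : ℕ) :
    IndepFun (fun ω => (β₀ ω, fun r : Finset.range t => w r ω)) (w t) μ := by
  have hw := h.measurable_w
  have h1 : IndepFun (fun ω (r : Finset.range t) => w r ω) (w t) μ := by
    have := h.indep_w.indepFun_finset (Finset.range t) {t} (by simp) h.measurable_w
    exact this.comp measurable_id (measurable_pi_apply (⟨t, by simp⟩ : ({t} : Finset ℕ)))
  have h2 : IndepFun β₀ (fun ω => ((fun r : Finset.range t => w r ω), w t ω)) μ :=
    h.indep_β₀_noise.comp (ψ := fun z : (ℕ → EuclideanSpace ℝ (Fin d)) × (ℕ → ℝ) =>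
      ((fun r : Finset.range t => z.1 r), z.1 t)) measurable_id (by fun_prop)
  exact indepFun_prodMk_left h.measurable_β₀ (measurable_pi_lambda _ fun r => hw r) (hw t) h2 h1

theorem IsGaussianModel.indepFun_of_measurable_past [IsProbabilityMeasure μ] {t : ℕ} {α γ : Type*}
    [MeasurableSpace α] [MeasurableSpace γ] {F : Ω → α} (hF : Measurable[past β₀ w t] F)
    {g : EuclideanSpace ℝ (Fin d) → γ} (hg : Measurable g) :
    IndepFun F (fun ω => g (w t ω)) μ := by
  have h1 := (IndepFun_iff_Indep _ _ _).1 (h.indepFun_past t)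
  have h2 : MeasurableSpace.comap F inferInstance ≤ past β₀ w t := hF.comap_le
  have h3 : IndepFun F (w t) μ := (IndepFun_iff_Indep _ _ _).2 (indep_of_indep_of_le_left h1 h2)
  exact h3.comp measurable_id hg

theorem IsGaussianModel.hasGaussianMarginals_w (hSw : Sw.PosSemidef) (t : ℕ) :
    HasGaussianMarginals (w t) Sw μ :=
  .of_hasLaw hSw (h.law_w t)

theorem IsGaussianModel.hasGaussianMarginals_x (t : ℕ) :
    HasGaussianMarginals (x t) 1 μ :=
  .of_hasLaw Matrix.PosSemidef.one (h.law_x t)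

/-- Stationarity. `⟨u, β_{t+1}⟩ = ⟨Aᵀu, β_t⟩ + ⟨u, w_t⟩` is a sum of independent centred Gaussians,
and the Lyapunov equation says that the variances add up to `uᵀ Σ_∞ u` again. -/
theorem IsGaussianModel.hasGaussianMarginals_state [IsProbabilityMeasure μ]
    (hSw : Sw.PosSemidef) (hA : rho A < 1) (t : ℕ) :
    HasGaussianMarginals (state A β₀ w t) (stationaryCov A Sw) μ := by
  obtain ⟨⟨hP, hEq⟩, -⟩ := stationaryCov_spec hA hSw
  set S := stationaryCov A Sw with hS
  induction t with
  | zero => exact .of_hasLaw hP h.law_β₀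
  | succ t ih =>
    intro u
    set u' : EuclideanSpace ℝ (Fin d) := WithLp.toLp 2 (Aᵀ *ᵥ u.ofLp) with hu'
    have e : ∀ ω, inner ℝ u (state A β₀ w (t + 1) ω)
        = inner ℝ u' (state A β₀ w t ω) + inner ℝ u (w t ω) := by
      intro ω
      rw [state, inner_add_right]
      congr 1
      simp only [EuclideanSpace.inner_eq_star_dotProduct, star_trivial, hu',
        Matrix.ofLp_toEuclideanCLM]
      rw [Matrix.mulVec_transpose, dotProduct_comm, Matrix.dotProduct_mulVec, dotProduct_comm]
    have hind : IndepFun (fun ω => inner ℝ u' (state A β₀ w t ω)) (fun ω => inner ℝ u (w t ω)) μ := by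
      refine h.indepFun_of_measurable_past (t := t) ?_ (g := fun z => inner ℝ u z) (by fun_prop)
      have hm : Measurable fun z : EuclideanSpace ℝ (Fin d) => inner ℝ u' z := by fun_prop
      exact hm.comp (measurable_past_state t)
    have hsum := gaussianReal_add_gaussianReal_of_indepFun hind (ih u').map_eq
      (h.hasGaussianMarginals_w hSw t u).map_eq
    have hq : u'.ofLp ⬝ᵥ S *ᵥ u'.ofLp + u.ofLp ⬝ᵥ Sw *ᵥ u.ofLp = u.ofLp ⬝ᵥ S *ᵥ u.ofLp := by
      conv_rhs => rw [hEq]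
      rw [Matrix.add_mulVec, dotProduct_add, ← Matrix.mulVec_mulVec, ← Matrix.mulVec_mulVec,
        Matrix.dotProduct_mulVec u.ofLp A, ← Matrix.mulVec_transpose]
    rw [← Real.toNNReal_add (posSemidef_quadForm_nonneg hP _)
      (posSemidef_quadForm_nonneg hSw _), hq, add_zero] at hsum
    have hm : Measurable (state A β₀ w (t + 1)) := h.measurable_state (t + 1)
    refine ⟨Measurable.aemeasurable (by fun_prop), ?_⟩
    rw [← hsum]
    congr 1
    ext ω
    exact e ω

/-- The centred second-order products of the state. -/
theorem IsGaussianModel.integral_past_mul_state_succ [IsProbabilityMeasure μ]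
    (hSw : Sw.PosSemidef) (hA : rho A < 1) {t : ℕ} {F : Ω → ℝ} (hF : Measurable[past β₀ w t] F)
    (hFp : AllLp F μ) (i j : Fin d) :
    ∫ ω, F ω * (state A β₀ w (t + 1) ω i * state A β₀ w (t + 1) ω j
        - stationaryCov A Sw i j) ∂μ
      = ∑ a, ∑ b, A i a * A j b * ∫ ω, F ω * (state A β₀ w t ω a * state A β₀ w t ω b
        - stationaryCov A Sw a b) ∂μ := by
  obtain ⟨⟨hP, hEq⟩, -⟩ := stationaryCov_spec hA hSw
  set S := stationaryCov A Sw with hS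
  have hβ : ∀ a, AllLp (fun ω => state A β₀ w t ω a) μ :=
    (h.hasGaussianMarginals_state hSw hA t).allLp
  have hw := (h.hasGaussianMarginals_w hSw t)
  have hwp := hw.allLp
  have hterm : ∀ a b, AllLp (fun ω => F ω * (state A β₀ w t ω a * state A β₀ w t ω b - S a b)) μ :=
    fun a b => hFp.mul (((hβ a).mul (hβ b)).sub (.const _))
  have hzero : ∀ a k, ∫ ω, (F ω * state A β₀ w t ω a) * w t ω k ∂μ = 0 := by
    intro a k
    have hi : IndepFun (fun ω => F ω * state A β₀ w t ω a) (fun ω => w t ω k) μ :=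
      h.indepFun_of_measurable_past (hF.mul (measurable_past_state_apply t a))
        (g := fun z => z k) (by fun_prop)
    rw [hi.integral_fun_mul_eq_mul_integral (hFp.mul (hβ a)).aestronglyMeasurable
      (hwp k).aestronglyMeasurable, hw.integral_coord, mul_zero]
  have hnoise : ∫ ω, F ω * (w t ω i * w t ω j - Sw i j) ∂μ = 0 := by
    have hi : IndepFun F (fun ω => w t ω i * w t ω j - Sw i j) μ :=
      h.indepFun_of_measurable_past hF (g := fun z => z i * z j - Sw i j) (by fun_prop)
    rw [hi.integral_fun_mul_eq_mul_integral hFp.aestronglyMeasurable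
      (((hwp i).mul (hwp j)).sub (.const _)).aestronglyMeasurable,
      integral_sub ((hwp i).mul (hwp j)).integrable (integrable_const _),
      hw.integral_coord_mul_coord hSw]
    simp
  have hSij : S i j = ∑ a, ∑ b, A i a * A j b * S a b + Sw i j := by
    conv_lhs => rw [hEq]
    simp only [Matrix.add_apply, Matrix.mul_apply, Matrix.transpose_apply, Finset.sum_mul]
    rw [Finset.sum_comm]
    congr 1
    exact Finset.sum_congr rfl fun a _ => Finset.sum_congr rfl fun b _ => by ring
  -- Expansion of `(Aβ + w)(Aβ + w)ᵀ - S` with `S = A S Aᵀ + Σ_w`. The mixed terms contain one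
  -- factor of the fresh centred noise, and `w wᵀ - Σ_w` is centred, so only the first double sum
  -- survives integration.
  have e : ∀ ω, F ω * (state A β₀ w (t + 1) ω i * state A β₀ w (t + 1) ω j - S i j)
      = (∑ a, ∑ b, A i a * A j b * (F ω * (state A β₀ w t ω a * state A β₀ w t ω b - S a b)))
        + ((∑ a, A i a * ((F ω * state A β₀ w t ω a) * w t ω j))
        + ((∑ b, A j b * ((F ω * state A β₀ w t ω b) * w t ω i))
        + F ω * (w t ω i * w t ω j - Sw i j))) := by
    intro ω
    have e1 : ∑ a, ∑ b, A i a * A j b * (F ω * (state A β₀ w t ω a * state A β₀ w t ω b - S a b))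
        = F ω * ((∑ a, A i a * state A β₀ w t ω a) * (∑ b, A j b * state A β₀ w t ω b)
          - ∑ a, ∑ b, A i a * A j b * S a b) := by
      rw [Finset.sum_mul_sum, ← Finset.sum_sub_distrib, Finset.mul_sum]
      refine Finset.sum_congr rfl fun a _ => ?_
      rw [← Finset.sum_sub_distrib, Finset.mul_sum]
      exact Finset.sum_congr rfl fun b _ => by ring
    have e2 : ∀ i k, ∑ a, A i a * ((F ω * state A β₀ w t ω a) * w t ω k)
        = F ω * ((∑ a, A i a * state A β₀ w t ω a) * w t ω k) := by
      intro i k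
      rw [Finset.sum_mul, Finset.mul_sum]
      exact Finset.sum_congr rfl fun a _ => by ring
    rw [e1, e2, e2, state_succ_apply, state_succ_apply, hSij]
    ring
  simp_rw [e]
  have p1 : AllLp (fun ω => ∑ a, ∑ b, A i a * A j b
      * (F ω * (state A β₀ w t ω a * state A β₀ w t ω b - S a b))) μ :=
    .sum fun a _ => .sum fun b _ => (hterm a b).const_mul _
  have p2 : ∀ i k, AllLp (fun ω => ∑ a, A i a * ((F ω * state A β₀ w t ω a) * w t ω k)) μ :=
    fun i k => .sum fun a _ => ((hFp.mul (hβ a)).mul (hwp k)).const_mul _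
  have p3 : AllLp (fun ω => F ω * (w t ω i * w t ω j - Sw i j)) μ :=
    hFp.mul (((hwp i).mul (hwp j)).sub (.const _))
  have z2 : ∀ i k, ∫ ω, ∑ a, A i a * ((F ω * state A β₀ w t ω a) * w t ω k) ∂μ = 0 := by
    intro i k
    rw [integral_finsetSum _ fun a _ => (((hFp.mul (hβ a)).mul (hwp k)).const_mul _).integrable]
    simp [integral_const_mul, hzero]
  rw [integral_add p1.integrable ((p2 i j).add ((p2 j i).add p3)).integrable,
    integral_add (p2 i j).integrable ((p2 j i).add p3).integrable,
    integral_add (p2 j i).integrable p3.integrable, z2, z2, hnoise, add_zero, add_zero, add_zero,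
    integral_finsetSum _ fun a _ => (AllLp.sum fun b _ => (hterm a b).const_mul _).integrable]
  refine Finset.sum_congr rfl fun a _ => ?_
  rw [integral_finsetSum _ fun b _ => ((hterm a b).const_mul _).integrable]
  exact Finset.sum_congr rfl fun b _ => integral_const_mul _ _

theorem IsGaussianModel.allLp_state [IsProbabilityMeasure μ]
    (hSw : Sw.PosSemidef) (hA : rho A < 1) (t : ℕ) (i : Fin d) :
    AllLp (fun ω => state A β₀ w t ω i) μ :=
  (h.hasGaussianMarginals_state hSw hA t).allLp i

theorem IsGaussianModel.allLp_stateDev [IsProbabilityMeasure μ]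
    (hSw : Sw.PosSemidef) (hA : rho A < 1) (t : ℕ) (i j : Fin d) :
    AllLp (fun ω => stateDev A Sw β₀ w t ω i j) μ :=
  ((h.allLp_state hSw hA t i).mul (h.allLp_state hSw hA t j)).sub (.const _)

/-- The correlation matrices `C_t = E[F D_t]` satisfy `C_{t+1} = A C_t Aᵀ` from time `s` on. Testing
against `F` expresses the conditional expectation of `D_{s+m}` given the past up to `s`. -/
theorem IsGaussianModel.integral_past_mul_stateDev [IsProbabilityMeasure μ]
    (hSw : Sw.PosSemidef) (hA : rho A < 1) {s : ℕ} {F : Ω → ℝ} (hF : Measurable[past β₀ w s] F)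
    (hFp : AllLp F μ) (m : ℕ) (i j : Fin d) :
    ∫ ω, F ω * stateDev A Sw β₀ w (s + m) ω i j ∂μ
      = ∫ ω, F ω * (A ^ m * stateDev A Sw β₀ w s ω * (A ^ m)ᵀ) i j ∂μ := by
  have hD : ∀ t a b, Integrable (fun ω => F ω * stateDev A Sw β₀ w t ω a b) μ := fun t a b =>
    (hFp.mul (h.allLp_stateDev hSw hA t a b)).integrable
  set C : ℕ → Matrix (Fin d) (Fin d) ℝ := fun t =>
    Matrix.of fun i j => ∫ ω, F ω * stateDev A Sw β₀ w t ω i j ∂μ with hC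
  have hstep : ∀ m, C (s + m) = A ^ m * C s * (A ^ m)ᵀ := by
    intro m
    induction m with
    | zero => simp
    | succ m ih =>
      have h1 : C (s + m + 1) = A * C (s + m) * Aᵀ := by
        ext i j
        have := h.integral_past_mul_state_succ hSw hA
          (hF.mono (past_mono (Nat.le_add_right s m)) le_rfl) hFp i j
        simp only [hC, stateDev, Matrix.of_apply, Matrix.mul_apply, Matrix.transpose_apply,
          Finset.sum_mul]
        rw [this, Finset.sum_comm]
        exact Finset.sum_congr rfl fun a _ => Finset.sum_congr rfl fun b _ => by ring
      rw [← add_assoc, h1, ih, pow_succ', Matrix.transpose_mul]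
      simp only [Matrix.mul_assoc]
  have h2 := congrFun (congrFun (hstep m) i) j
  have h3 : ∀ ω, F ω * (A ^ m * stateDev A Sw β₀ w s ω * (A ^ m)ᵀ) i j
      = ∑ b, ∑ a, (A ^ m) i a * (A ^ m) j b * (F ω * stateDev A Sw β₀ w s ω a b) := by
    intro ω
    simp only [Matrix.mul_apply, Matrix.transpose_apply, Finset.sum_mul, Finset.mul_sum]
    exact Finset.sum_congr rfl fun a _ => Finset.sum_congr rfl fun b _ => by ring
  simp_rw [h3]
  rw [integral_finsetSum _ fun b _ => integrable_finsetSum _ fun a _ => (hD s a b).const_mul _]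
  simp_rw [fun b : Fin d => integral_finsetSum (μ := μ) Finset.univ
    fun a (_ : a ∈ Finset.univ) => (hD s a b).const_mul ((A ^ m) i a * (A ^ m) j b),
    integral_const_mul]
  simp only [hC, Matrix.of_apply, Matrix.mul_apply, Matrix.transpose_apply, Finset.sum_mul] at h2
  rw [h2]
  exact Finset.sum_congr rfl fun a _ => Finset.sum_congr rfl fun b _ => by ring

theorem IsGaussianModel.allLp_crossDev [IsProbabilityMeasure μ]
    (hSw : Sw.PosSemidef) (hA : rho A < 1) (t : ℕ) (i j : Fin d) :
    AllLp (fun ω => crossDev A Sw β₀ w t ω i j) μ :=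
  ((h.allLp_state hSw hA (t + 1) i).mul (h.allLp_state hSw hA t j)).sub (.const _)

/-- The cross deviation is `A D_t + w_t β_tᵀ`, and the second term is orthogonal to the past; hence
one more factor `A` on the left than on the right. -/
theorem IsGaussianModel.integral_past_mul_crossDev [IsProbabilityMeasure μ]
    (hSw : Sw.PosSemidef) (hA : rho A < 1) {s : ℕ} {F : Ω → ℝ} (hF : Measurable[past β₀ w s] F)
    (hFp : AllLp F μ) (m : ℕ) (i j : Fin d) :
    ∫ ω, F ω * crossDev A Sw β₀ w (s + m) ω i j ∂μ
      = ∫ ω, F ω * (A ^ (m + 1) * stateDev A Sw β₀ w s ω * (A ^ m)ᵀ) i j ∂μ := by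
  have hF' : Measurable[past β₀ w (s + m)] F := hF.mono (past_mono (Nat.le_add_right s m)) le_rfl
  have hw := h.hasGaussianMarginals_w hSw (s + m)
  have hβ := h.allLp_state hSw hA (s + m)
  have e1 : ∀ ω, F ω * crossDev A Sw β₀ w (s + m) ω i j
      = (∑ a, A i a * (F ω * stateDev A Sw β₀ w (s + m) ω a j))
        + (F ω * state A β₀ w (s + m) ω j) * w (s + m) ω i := by
    intro ω
    simp only [crossDev, stateDev, Matrix.of_apply, Matrix.mul_apply, state_succ_apply]
    have : ∑ a, A i a * (F ω * (state A β₀ w (s + m) ω a * state A β₀ w (s + m) ω j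
        - stationaryCov A Sw a j))
        = F ω * ((∑ a, A i a * state A β₀ w (s + m) ω a) * state A β₀ w (s + m) ω j
          - ∑ a, A i a * stationaryCov A Sw a j) := by
      rw [Finset.sum_mul, ← Finset.sum_sub_distrib, Finset.mul_sum]
      exact Finset.sum_congr rfl fun a _ => by ring
    rw [this]; ring
  have hz : ∫ ω, (F ω * state A β₀ w (s + m) ω j) * w (s + m) ω i ∂μ = 0 := by
    have hi : IndepFun (fun ω => F ω * state A β₀ w (s + m) ω j) (fun ω => w (s + m) ω i) μ :=
      h.indepFun_of_measurable_past (hF'.mul (measurable_past_state_apply (s + m) j))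
        (g := fun z => z i) (by fun_prop)
    rw [hi.integral_fun_mul_eq_mul_integral (hFp.mul (hβ j)).aestronglyMeasurable
      (hw.allLp i).aestronglyMeasurable, hw.integral_coord, mul_zero]
  have q1 : ∀ a, AllLp (fun ω => A i a * (F ω * stateDev A Sw β₀ w (s + m) ω a j)) μ :=
    fun a => (hFp.mul (h.allLp_stateDev hSw hA _ a j)).const_mul _
  simp_rw [e1]
  rw [integral_add (AllLp.sum fun a _ => q1 a).integrable
    ((hFp.mul (hβ j)).mul (hw.allLp i)).integrable, hz, add_zero,
    integral_finsetSum _ fun a _ => (q1 a).integrable]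
  simp_rw [integral_const_mul, h.integral_past_mul_stateDev hSw hA hF hFp m]
  have q2 : ∀ a, AllLp (fun ω => F ω * (A ^ m * stateDev A Sw β₀ w s ω * (A ^ m)ᵀ) a j) μ := by
    intro a
    simp only [Matrix.mul_apply]
    exact hFp.mul (.sum fun b _ => (AllLp.sum fun c _ =>
      (h.allLp_stateDev hSw hA s c b).const_mul _).mul (.const _))
  have e2 : ∀ ω, F ω * (A ^ (m + 1) * stateDev A Sw β₀ w s ω * (A ^ m)ᵀ) i j
      = ∑ a, A i a * (F ω * (A ^ m * stateDev A Sw β₀ w s ω * (A ^ m)ᵀ) a j) := by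
    intro ω
    have : A ^ (m + 1) * stateDev A Sw β₀ w s ω * (A ^ m)ᵀ
        = A * (A ^ m * stateDev A Sw β₀ w s ω * (A ^ m)ᵀ) := by
      rw [pow_succ']; simp only [Matrix.mul_assoc]
    rw [this, Matrix.mul_apply, Finset.mul_sum]
    exact Finset.sum_congr rfl fun a _ => by ring
  simp_rw [e2]
  rw [integral_finsetSum _ fun a _ => ((q2 a).const_mul _).integrable]
  simp_rw [integral_const_mul]

end Model

/-! ### Operator and Frobenius norms; finiteness of `τ`. -/

section Norms

variable {d : ℕ}

theorem opNorm_nonneg (M : Matrix (Fin d) (Fin d) ℝ) : 0 ≤ opNorm M := norm_nonneg _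

theorem frobNorm_nonneg (M : Matrix (Fin d) (Fin d) ℝ) : 0 ≤ frobNorm M := Real.sqrt_nonneg _

theorem frobNorm_sq (M : Matrix (Fin d) (Fin d) ℝ) : frobNorm M ^ 2 = ∑ i, ∑ j, M i j ^ 2 := by
  rw [← sum_frob_sq, Fintype.sum_prod_type]

theorem norm_toLp_mulVec_le (M : Matrix (Fin d) (Fin d) ℝ) (v : Fin d → ℝ) :
    ‖WithLp.toLp 2 (M *ᵥ v)‖ ≤ opNorm M * ‖WithLp.toLp 2 v‖ := by
  have h := (Matrix.toEuclideanCLM (n := Fin d) (𝕜 := ℝ) M).le_opNorm (WithLp.toLp 2 v)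
  rwa [Matrix.toEuclideanCLM_toLp] at h

theorem sum_sq_mulVec_le (M : Matrix (Fin d) (Fin d) ℝ) (v : Fin d → ℝ) :
    ∑ i, (M *ᵥ v) i ^ 2 ≤ opNorm M ^ 2 * ∑ i, v i ^ 2 := by
  have h := pow_le_pow_left₀ (norm_nonneg _) (norm_toLp_mulVec_le M v) 2
  rwa [mul_pow, EuclideanSpace.real_norm_sq_eq, EuclideanSpace.real_norm_sq_eq] at h

theorem abs_dotProduct_mulVec_le (M : Matrix (Fin d) (Fin d) ℝ)
    (u v : EuclideanSpace ℝ (Fin d)) : |u.ofLp ⬝ᵥ M *ᵥ v.ofLp| ≤ opNorm M * (‖u‖ * ‖v‖) := by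
  have h := abs_real_inner_le_norm u (WithLp.toLp 2 (M *ᵥ v.ofLp))
  have h2 : inner ℝ u (WithLp.toLp 2 (M *ᵥ v.ofLp)) = u.ofLp ⬝ᵥ M *ᵥ v.ofLp := by
    rw [EuclideanSpace.inner_eq_star_dotProduct, star_trivial, dotProduct_comm]
  rw [h2] at h
  refine h.trans ?_
  have := mul_le_mul_of_nonneg_left (norm_toLp_mulVec_le M v.ofLp) (norm_nonneg u)
  refine this.trans (le_of_eq ?_)
  rw [WithLp.toLp_ofLp]; ring

theorem opNorm_mul_le (M N : Matrix (Fin d) (Fin d) ℝ) :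
    opNorm (M * N) ≤ opNorm M * opNorm N := by
  simp only [opNorm, map_mul]
  exact norm_mul_le _ _

theorem opNorm_transpose (M : Matrix (Fin d) (Fin d) ℝ) : opNorm Mᵀ = opNorm M := by
  have h : Mᵀ = star M := by ext; simp [Matrix.star_apply]
  rw [opNorm, h, map_star, ContinuousLinearMap.star_eq_adjoint, LinearIsometryEquiv.norm_map, opNorm]

theorem opNorm_one (hd : 0 < d) : opNorm (1 : Matrix (Fin d) (Fin d) ℝ) = 1 := by
  have : Nonempty (Fin d) := ⟨⟨0, hd⟩⟩
  have : Nontrivial (EuclideanSpace ℝ (Fin d)) := inferInstance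
  rw [opNorm, map_one, norm_one]

theorem frobNorm_transpose (M : Matrix (Fin d) (Fin d) ℝ) : frobNorm Mᵀ = frobNorm M := by
  rw [frobNorm, frobNorm, Finset.sum_comm]
  rfl

/-- The squared Frobenius norm is the sum of the squared lengths of the columns, and `M` acts on
each column of `N`. -/
theorem frobNorm_mul_le_opNorm_mul (M N : Matrix (Fin d) (Fin d) ℝ) :
    frobNorm (M * N) ≤ opNorm M * frobNorm N := by
  refine (pow_le_pow_iff_left₀ (frobNorm_nonneg _)
    (mul_nonneg (opNorm_nonneg _) (frobNorm_nonneg _)) two_ne_zero).1 ?_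
  rw [mul_pow, frobNorm_sq, frobNorm_sq, Finset.sum_comm,
    Finset.sum_comm (f := fun i j => N i j ^ 2), Finset.mul_sum]
  exact Finset.sum_le_sum fun j _ => sum_sq_mulVec_le M (fun i => N i j)

theorem frobNorm_mul_le_mul_opNorm (M N : Matrix (Fin d) (Fin d) ℝ) :
    frobNorm (M * N) ≤ frobNorm M * opNorm N := by
  rw [← frobNorm_transpose, Matrix.transpose_mul, mul_comm, ← opNorm_transpose N,
    ← frobNorm_transpose M]
  exact frobNorm_mul_le_opNorm_mul _ _

theorem abs_apply_le_opNorm (M : Matrix (Fin d) (Fin d) ℝ) (i j : Fin d) :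
    |M i j| ≤ opNorm M := by
  have h := abs_dotProduct_mulVec_le M (EuclideanSpace.single i 1) (EuclideanSpace.single j 1)
  simpa using h

theorem opNorm_le_frobNorm (M : Matrix (Fin d) (Fin d) ℝ) : opNorm M ≤ frobNorm M := by
  refine ContinuousLinearMap.opNorm_le_bound _ (frobNorm_nonneg _) fun v => ?_
  refine (pow_le_pow_iff_left₀ (norm_nonneg _)
    (mul_nonneg (frobNorm_nonneg _) (norm_nonneg _)) two_ne_zero).1 ?_
  rw [mul_pow, frobNorm_sq, EuclideanSpace.real_norm_sq_eq, EuclideanSpace.real_norm_sq_eq,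
    Finset.sum_mul, Matrix.ofLp_toEuclideanCLM]
  refine Finset.sum_le_sum fun i _ => ?_
  exact Finset.sum_mul_sq_le_sq_mul_sq Finset.univ (fun j => M i j) v.ofLp

theorem abs_sum_mul_le_frobNorm (M N : Matrix (Fin d) (Fin d) ℝ) :
    |∑ i, ∑ j, M i j * N i j| ≤ frobNorm M * frobNorm N := by
  refine abs_le_of_sq_le_sq ?_ (mul_nonneg (frobNorm_nonneg _) (frobNorm_nonneg _))
  rw [mul_pow, ← sum_frob_sq, ← sum_frob_sq, ← Fintype.sum_prod_type'
    (f := fun i j => M i j * N i j)]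
  exact Finset.sum_mul_sq_le_sq_mul_sq _ _ _

theorem sq_trace_le (M : Matrix (Fin d) (Fin d) ℝ) : (∑ i, M i i) ^ 2 ≤ d * frobNorm M ^ 2 := by
  refine (sq_sum_le_card_mul_sum_sq (s := Finset.univ) (f := fun i => M i i)).trans ?_
  rw [Finset.card_univ, Fintype.card_fin, frobNorm_sq]
  refine mul_le_mul_of_nonneg_left (Finset.sum_le_sum fun i _ => ?_) (Nat.cast_nonneg _)
  exact Finset.single_le_sum (f := fun j => M i j ^ 2) (fun j _ => sq_nonneg _) (Finset.mem_univ i)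

section Tau

open scoped Matrix.Norms.L2Operator

theorem abs_apply_le_norm_map (M : Matrix (Fin d) (Fin d) ℝ) (i j : Fin d) :
    |M i j| ≤ ‖M.map Complex.ofReal‖ := by
  have h := Matrix.l2_opNorm_mulVec (M.map Complex.ofReal) (EuclideanSpace.single j 1)
  have h1 := PiLp.norm_apply_le (WithLp.toLp 2
    ((M.map Complex.ofReal) *ᵥ (EuclideanSpace.single j (1 : ℂ)).ofLp)) i
  have h2 := h1.trans h
  simpa using h2

/-- Gelfand's formula bounds the complex operator norm of `A^k` by `γ^k` for large `k`. Passing to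
the real norm through the entries loses a factor `d`, harmless because only boundedness is needed.
-/
theorem eventually_opNorm_pow_le {A : Matrix (Fin d) (Fin d) ℝ} {γ : ℝ}
    (hγ : rho A < ENNReal.ofReal γ) :
    ∀ᶠ k : ℕ in Filter.atTop, opNorm (A ^ k) / γ ^ k ≤ d := by
  set B : Matrix (Fin d) (Fin d) ℂ := A.map Complex.ofReal with hB
  have hγ0 : 0 < γ := ENNReal.ofReal_pos.1 (bot_le.trans_lt hγ)
  have hG := spectrum.pow_nnnorm_pow_one_div_tendsto_nhds_spectralRadius B
  filter_upwards [hG.eventually (gt_mem_nhds hγ), Filter.eventually_gt_atTop 0] with k hk hk0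
  have hk' : ((‖B ^ k‖₊ : ℝ≥0∞) ^ (1 / k : ℝ)) ^ (k : ℝ) ≤ (ENNReal.ofReal γ) ^ (k : ℝ) :=
    ENNReal.rpow_le_rpow hk.le (by positivity)
  rw [← ENNReal.rpow_mul, one_div, inv_mul_cancel₀ (by positivity), ENNReal.rpow_one,
    ENNReal.rpow_natCast, ← ENNReal.ofReal_pow hγ0.le] at hk'
  have hn : ‖B ^ k‖ ≤ γ ^ k := by
    rw [← ENNReal.ofReal_le_ofReal_iff (by positivity), ofReal_norm]
    exact hk'
  have h1 : B ^ k = (A ^ k).map Complex.ofReal := (Matrix.map_pow A Complex.ofRealHom k).symm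
  rw [div_le_iff₀ (by positivity)]
  refine (opNorm_le_frobNorm _).trans ?_
  refine (pow_le_pow_iff_left₀ (frobNorm_nonneg _) (by positivity) two_ne_zero).1 ?_
  rw [frobNorm_sq]
  calc ∑ i, ∑ j, (A ^ k) i j ^ 2 ≤ ∑ i : Fin d, ∑ j : Fin d, (γ ^ k) ^ 2 := by
        refine Finset.sum_le_sum fun i _ => Finset.sum_le_sum fun j _ => ?_
        rw [← sq_abs]
        refine pow_le_pow_left₀ (abs_nonneg _) ((abs_apply_le_norm_map (A ^ k) i j).trans ?_) 2
        rw [← h1]; exact hn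
    _ = (d * γ ^ k) ^ 2 := by simp; ring

end Tau

theorem opNorm_pow_le_tau {A : Matrix (Fin d) (Fin d) ℝ} {γ : ℝ}
    (hγ : rho A < ENNReal.ofReal γ) (k : ℕ) : opNorm (A ^ k) ≤ tau A γ * γ ^ k := by
  have hγ0 : 0 < γ := ENNReal.ofReal_pos.1 (bot_le.trans_lt hγ)
  -- Without boundedness the real supremum would take the default value 0 and bound nothing.
  have hb : BddAbove (Set.range fun k : ℕ => opNorm (A ^ k) / γ ^ k) :=
    (Filter.isBoundedUnder_of_eventually_le (eventually_opNorm_pow_le hγ)).bddAbove_range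
  rw [← div_le_iff₀ (by positivity)]
  exact le_ciSup hb k

/-- The term `k = 0`; in dimension zero the identity has norm 0. -/
theorem one_le_tau (hd : 0 < d) {A : Matrix (Fin d) (Fin d) ℝ} {γ : ℝ}
    (hγ : rho A < ENNReal.ofReal γ) : 1 ≤ tau A γ := by
  have := opNorm_pow_le_tau hγ 0
  simpa [opNorm_one hd] using this

end Norms

/-! ### Moment bounds for observations and residuals. -/

theorem inner_eq_sum_coord {d : ℕ} (u v : EuclideanSpace ℝ (Fin d)) :
    inner ℝ u v = ∑ i, u i * v i := by
  rw [PiLp.inner_apply]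
  exact Finset.sum_congr rfl fun i _ => by simp [mul_comm]

theorem norm_pow_four_le {d : ℕ} (v : EuclideanSpace ℝ (Fin d)) :
    ‖v‖ ^ 4 ≤ d * ∑ i, v i ^ 4 := by
  have h := sq_sum_le_card_mul_sum_sq (s := Finset.univ) (f := fun i => v i ^ 2)
  rw [show ‖v‖ ^ 4 = (‖v‖ ^ 2) ^ 2 by ring, EuclideanSpace.real_norm_sq_eq]
  simpa [← pow_mul] using h

theorem norm_pow_eight_le {d : ℕ} (v : EuclideanSpace ℝ (Fin d)) :
    ‖v‖ ^ 8 ≤ d ^ 3 * ∑ i, v i ^ 8 := by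
  have h := sq_sum_le_card_mul_sum_sq (s := Finset.univ) (f := fun i => v i ^ 4)
  have h4 := pow_le_pow_left₀ (by positivity) (norm_pow_four_le v) 2
  simp only [← pow_mul, Finset.card_univ, Fintype.card_fin] at h h4
  calc ‖v‖ ^ 8 = ‖v‖ ^ (4 * 2) := rfl
    _ ≤ (d * ∑ i, v i ^ 4) ^ 2 := h4
    _ = d ^ 2 * (∑ i, v i ^ 4) ^ 2 := by ring
    _ ≤ d ^ 2 * (d * ∑ i, v i ^ (4 * 2)) := by gcongr
    _ = d ^ 3 * ∑ i, v i ^ 8 := by ring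

section Marginals

variable {d : ℕ} {Ω : Type*} [MeasurableSpace Ω] {μ : Measure Ω} [IsProbabilityMeasure μ]
  {Z : Ω → EuclideanSpace ℝ (Fin d)} {S : Matrix (Fin d) (Fin d) ℝ}

theorem HasGaussianMarginals.allLp_norm_sq (hZ : HasGaussianMarginals Z S μ) :
    AllLp (fun ω => ‖Z ω‖ ^ 2) μ := by
  simp_rw [EuclideanSpace.real_norm_sq_eq]
  exact .sum fun i _ => (hZ.allLp i).pow 2

theorem HasGaussianMarginals.allLp_norm_pow_four (hZ : HasGaussianMarginals Z S μ) :
    AllLp (fun ω => ‖Z ω‖ ^ 4) μ := by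
  simpa [← pow_mul] using hZ.allLp_norm_sq.pow 2

theorem HasGaussianMarginals.allLp_norm_pow_eight (hZ : HasGaussianMarginals Z S μ) :
    AllLp (fun ω => ‖Z ω‖ ^ 8) μ := by
  simpa [← pow_mul] using hZ.allLp_norm_sq.pow 4

theorem HasGaussianMarginals.integral_norm_pow_four_le (hZ : HasGaussianMarginals Z S μ)
    (hS : S.PosSemidef) : ∫ ω, ‖Z ω‖ ^ 4 ∂μ ≤ 3 * d ^ 2 * opNorm S ^ 2 := by
  have hi : ∀ i, Integrable (fun ω => Z ω i ^ 4) μ := fun i => ((hZ.allLp i).pow 4).integrable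
  calc ∫ ω, ‖Z ω‖ ^ 4 ∂μ ≤ ∫ ω, d * ∑ i, Z ω i ^ 4 ∂μ :=
        integral_mono hZ.allLp_norm_pow_four.integrable
          ((integrable_finsetSum _ fun i _ => hi i).const_mul _) fun ω => norm_pow_four_le _
    _ = d * ∑ i, 3 * S i i ^ 2 := by
        rw [integral_const_mul, integral_finsetSum _ fun i _ => hi i]
        congr 1
        refine Finset.sum_congr rfl fun i _ => ?_
        rw [integral_pow_of_hasLaw (hZ.hasLaw_coord i), integral_pow_four_gaussianReal,
          Real.coe_toNNReal _ hS.diag_nonneg]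
    _ ≤ d * ∑ i : Fin d, 3 * opNorm S ^ 2 := by
        gcongr with i
        · exact hS.diag_nonneg
        · exact (le_abs_self _).trans (abs_apply_le_opNorm S i i)
    _ = 3 * d ^ 2 * opNorm S ^ 2 := by simp; ring

theorem HasGaussianMarginals.integral_norm_pow_eight_le (hZ : HasGaussianMarginals Z 1 μ) :
    ∫ ω, ‖Z ω‖ ^ 8 ∂μ ≤ 105 * d ^ 4 := by
  have hi : ∀ i, Integrable (fun ω => Z ω i ^ 8) μ := fun i => ((hZ.allLp i).pow 8).integrable
  calc ∫ ω, ‖Z ω‖ ^ 8 ∂μ ≤ ∫ ω, d ^ 3 * ∑ i, Z ω i ^ 8 ∂μ :=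
        integral_mono hZ.allLp_norm_pow_eight.integrable
          ((integrable_finsetSum _ fun i _ => hi i).const_mul _) fun ω => norm_pow_eight_le _
    _ = d ^ 3 * ∑ i : Fin d, 105 := by
        rw [integral_const_mul, integral_finsetSum _ fun i _ => hi i]
        congr 1
        refine Finset.sum_congr rfl fun i _ => ?_
        rw [integral_pow_of_hasLaw (hZ.hasLaw_coord i), integral_pow_eight_gaussianReal]
        simp
    _ = 105 * d ^ 4 := by simp; ring

/-- By Fubini, fix `X = u`: then `⟨u, Z⟩` is Gaussian with variance at most `‖S‖ |u|²`, so its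
fourth moment is at most `3 ‖S‖² |u|⁴`. What remains is `3 ‖S‖² E|X|⁸`. -/
theorem integral_inner_pow_four_mul_norm_pow_four_le (hS : S.PosSemidef)
    {X : Ω → EuclideanSpace ℝ (Fin d)} (hX : Measurable X) (hZm : Measurable Z)
    (hXg : HasGaussianMarginals X 1 μ) (hZ : HasGaussianMarginals Z S μ) (hXZ : IndepFun X Z μ) :
    ∫ ω, inner ℝ (X ω) (Z ω) ^ 4 * ‖X ω‖ ^ 4 ∂μ ≤ 315 * d ^ 4 * opNorm S ^ 2 := by
  set f : EuclideanSpace ℝ (Fin d) × EuclideanSpace ℝ (Fin d) → ℝ :=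
    fun p => inner ℝ p.1 p.2 ^ 4 * ‖p.1‖ ^ 4 with hf
  have hfm : Measurable f := by fun_prop
  have hpX : IsProbabilityMeasure (μ.map X) := Measure.isProbabilityMeasure_map hX.aemeasurable
  have hpZ : IsProbabilityMeasure (μ.map Z) := Measure.isProbabilityMeasure_map hZm.aemeasurable
  have hint : Integrable (fun ω => f (X ω, Z ω)) μ := by
    have hin : AllLp (fun ω => inner ℝ (X ω) (Z ω)) μ := by
      simp_rw [inner_eq_sum_coord]
      exact .sum fun i _ => (hXg.allLp i).mul (hZ.allLp i)
    exact ((hin.pow 4).mul hXg.allLp_norm_pow_four).integrable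
  have hprod := (indepFun_iff_map_prod_eq_prod_map_map hX.aemeasurable hZm.aemeasurable).1 hXZ
  have hint' : Integrable f ((μ.map X).prod (μ.map Z)) := by
    rw [← hprod, integrable_map_measure hfm.aestronglyMeasurable (by fun_prop)]
    exact hint
  have h8 : Integrable (fun u : EuclideanSpace ℝ (Fin d) => ‖u‖ ^ 8) (μ.map X) := by
    rw [integrable_map_measure (by fun_prop) (by fun_prop)]
    exact hXg.allLp_norm_pow_eight.integrable
  calc ∫ ω, inner ℝ (X ω) (Z ω) ^ 4 * ‖X ω‖ ^ 4 ∂μ = ∫ ω, f (X ω, Z ω) ∂μ := rfl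
    _ = ∫ p, f p ∂((μ.map X).prod (μ.map Z)) := by
        rw [← hprod, integral_map (by fun_prop) hfm.aestronglyMeasurable]
    _ = ∫ u, ∫ z, f (u, z) ∂(μ.map Z) ∂(μ.map X) := integral_prod _ hint'
    _ ≤ ∫ u, 3 * opNorm S ^ 2 * ‖u‖ ^ 8 ∂(μ.map X) := by
        refine integral_mono hint'.integral_prod_left (h8.const_mul _) fun u => ?_
        have h1 : ∫ z, f (u, z) ∂(μ.map Z) = ‖u‖ ^ 4 * (3 * (u.ofLp ⬝ᵥ S *ᵥ u.ofLp) ^ 2) := by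
          rw [integral_map (by fun_prop) (by fun_prop)]
          simp only [hf]
          rw [integral_mul_const, hZ.integral_inner_pow_four hS, mul_comm]
        have h2 : (u.ofLp ⬝ᵥ S *ᵥ u.ofLp) ^ 2 ≤ (opNorm S * (‖u‖ * ‖u‖)) ^ 2 := by
          rw [← sq_abs]
          exact pow_le_pow_left₀ (abs_nonneg _) (abs_dotProduct_mulVec_le S u u) 2
        calc ∫ z, f (u, z) ∂(μ.map Z) = ‖u‖ ^ 4 * (3 * (u.ofLp ⬝ᵥ S *ᵥ u.ofLp) ^ 2) := h1
          _ ≤ ‖u‖ ^ 4 * (3 * (opNorm S * (‖u‖ * ‖u‖)) ^ 2) := by gcongr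
          _ = 3 * opNorm S ^ 2 * ‖u‖ ^ 8 := by ring
    _ = 3 * opNorm S ^ 2 * ∫ ω, ‖X ω‖ ^ 8 ∂μ := by
        rw [integral_const_mul, integral_map (by fun_prop) (by fun_prop)]
    _ ≤ 3 * opNorm S ^ 2 * (105 * d ^ 4) := by
        gcongr; exact hXg.integral_norm_pow_eight_le
    _ = 315 * d ^ 4 * opNorm S ^ 2 := by ring

end Marginals

section Model

variable {d : ℕ} {Ω : Type*} [mΩ : MeasurableSpace Ω] {μ : Measure Ω} [IsProbabilityMeasure μ]
  {A Sw : Matrix (Fin d) (Fin d) ℝ} {σ : ℝ≥0}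
  {β₀ : Ω → EuclideanSpace ℝ (Fin d)} {w x : ℕ → Ω → EuclideanSpace ℝ (Fin d)} {ε : ℕ → Ω → ℝ}

/-- The information carried by everything except the covariates. -/
abbrev hidden (β₀ : Ω → EuclideanSpace ℝ (Fin d)) (w : ℕ → Ω → EuclideanSpace ℝ (Fin d))
    (ε : ℕ → Ω → ℝ) : MeasurableSpace Ω :=
  MeasurableSpace.comap (fun ω => (β₀ ω, (fun t => w t ω), fun t => ε t ω)) inferInstance

omit mΩ in
theorem measurable_hidden {α : Type*} [MeasurableSpace α]
    {f : EuclideanSpace ℝ (Fin d) × (ℕ → EuclideanSpace ℝ (Fin d)) × (ℕ → ℝ) → α}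
    (hf : Measurable f) :
    Measurable[hidden β₀ w ε] fun ω => f (β₀ ω, (fun t => w t ω), fun t => ε t ω) :=
  hf.comp (comap_measurable _)

omit mΩ in
theorem past_le_hidden (t : ℕ) : past β₀ w t ≤ hidden β₀ w ε := by
  have h : Measurable[hidden β₀ w ε] (fun ω => (β₀ ω, fun r : Finset.range t => w r ω)) :=
    measurable_hidden (f := fun z => (z.1, fun r : Finset.range t => z.2.1 r)) (by fun_prop)
  exact h.comap_le

omit mΩ in
theorem measurable_hidden_noise (t : ℕ) : Measurable[hidden β₀ w ε] (ε t) :=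
  measurable_hidden (f := fun z => z.2.2 t) (by fun_prop)

omit mΩ in
theorem measurable_hidden_state_apply (t : ℕ) (i : Fin d) :
    Measurable[hidden β₀ w ε] fun ω => state A β₀ w t ω i :=
  (measurable_past_state_apply t i).mono (past_le_hidden t) le_rfl

variable (h : IsGaussianModel μ A Sw σ β₀ w x ε)
include h

omit [IsProbabilityMeasure μ] in
theorem IsGaussianModel.indepFun_covariates {α γ : Type*} [MeasurableSpace α] [MeasurableSpace γ]
    {g : (ℕ → EuclideanSpace ℝ (Fin d)) → γ} (hg : Measurable g) {F : Ω → α}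
    (hF : Measurable[hidden β₀ w ε] F) :
    IndepFun (fun ω => g (fun t => x t ω)) F μ := by
  have h1 := (IndepFun_iff_Indep _ _ _).1 h.indep_x_rest
  have h3 : IndepFun (fun ω t => x t ω) F μ :=
    (IndepFun_iff_Indep _ _ _).2 (indep_of_indep_of_le_right h1 hF.comap_le)
  exact h3.comp hg measurable_id

omit [IsProbabilityMeasure μ] in
theorem IsGaussianModel.allLp_noise (t : ℕ) : AllLp (ε t) μ := .of_hasLaw (h.law_ε t)

theorem IsGaussianModel.allLp_obs (hSw : Sw.PosSemidef) (hA : rho A < 1) (t : ℕ) :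
    AllLp (obs A β₀ w x ε t) μ := by
  have : obs A β₀ w x ε t = fun ω => (∑ i, x t ω i * state A β₀ w t ω i) + ε t ω := by
    ext ω; rw [obs, inner_eq_sum_coord]
  rw [this]
  exact (AllLp.sum fun i _ => ((h.hasGaussianMarginals_x t).allLp i).mul
    (h.allLp_state hSw hA t i)).add (h.allLp_noise t)

theorem IsGaussianModel.integral_norm_x_pow_four_le (hd : 0 < d) (t : ℕ) :
    ∫ ω, ‖x t ω‖ ^ 4 ∂μ ≤ 3 * d ^ 2 := by
  have := (h.hasGaussianMarginals_x t).integral_norm_pow_four_le Matrix.PosSemidef.one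
  rwa [opNorm_one hd, one_pow, mul_one] at this

/-- Signal and noise are separated by `(a + b)⁴ ≤ 8(a⁴ + b⁴)`; the covariate is independent of the
state and of the noise at the same time. -/
theorem IsGaussianModel.integral_obs_pow_four_mul_le (hd : 0 < d) (hSw : Sw.PosSemidef)
    (hA : rho A < 1) (t : ℕ) :
    ∫ ω, obs A β₀ w x ε t ω ^ 4 * ‖x t ω‖ ^ 4 ∂μ
      ≤ 2520 * d ^ 2 * (σ ^ 4 + d ^ 2 * opNorm (stationaryCov A Sw) ^ 2) := by
  have hS := (stationaryCov_spec hA hSw).1.1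
  have hxg := h.hasGaussianMarginals_x t
  have hst := h.hasGaussianMarginals_state hSw hA t
  have hind : IndepFun (x t) (state A β₀ w t) μ :=
    h.indepFun_covariates (g := fun z => z t) (by fun_prop)
      ((measurable_past_state t).mono (past_le_hidden t) le_rfl)
  have h1 := integral_inner_pow_four_mul_norm_pow_four_le hS (h.measurable_x t)
    (h.measurable_state t) hxg hst hind
  have h2 : ∫ ω, ε t ω ^ 4 * ‖x t ω‖ ^ 4 ∂μ ≤ 9 * d ^ 2 * σ ^ 4 := by
    have hi : IndepFun (fun ω => ‖x t ω‖ ^ 4) (fun ω => ε t ω ^ 4) μ :=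
      h.indepFun_covariates (g := fun z => ‖z t‖ ^ 4) (by fun_prop)
        ((measurable_hidden_noise t).pow_const 4)
    have he : ∫ ω, ε t ω ^ 4 ∂μ = 3 * (σ : ℝ) ^ 4 := by
      rw [integral_pow_of_hasLaw (h.law_ε t), integral_pow_four_gaussianReal]
      push_cast; ring
    simp_rw [mul_comm (ε t _ ^ 4)]
    rw [hi.integral_fun_mul_eq_mul_integral hxg.allLp_norm_pow_four.aestronglyMeasurable
      ((h.allLp_noise t).pow 4).aestronglyMeasurable, he]
    calc _ ≤ (3 * (d : ℝ) ^ 2) * (3 * (σ : ℝ) ^ 4) := by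
          gcongr; exact h.integral_norm_x_pow_four_le hd t
      _ = _ := by ring
  have p1 : AllLp (fun ω => inner ℝ (x t ω) (state A β₀ w t ω) ^ 4 * ‖x t ω‖ ^ 4) μ := by
    simp_rw [inner_eq_sum_coord]
    exact ((AllLp.sum fun i _ => (hxg.allLp i).mul (hst.allLp i)).pow 4).mul
      hxg.allLp_norm_pow_four
  have p2 : AllLp (fun ω => ε t ω ^ 4 * ‖x t ω‖ ^ 4) μ :=
    ((h.allLp_noise t).pow 4).mul hxg.allLp_norm_pow_four
  calc ∫ ω, obs A β₀ w x ε t ω ^ 4 * ‖x t ω‖ ^ 4 ∂μ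
      ≤ ∫ ω, 8 * (inner ℝ (x t ω) (state A β₀ w t ω) ^ 4 * ‖x t ω‖ ^ 4
        + ε t ω ^ 4 * ‖x t ω‖ ^ 4) ∂μ := by
        refine integral_mono (((h.allLp_obs hSw hA t).pow 4).mul
          hxg.allLp_norm_pow_four).integrable ((p1.add p2).const_mul 8).integrable fun ω => ?_
        have h4 : 0 ≤ ‖x t ω‖ ^ 4 := by positivity
        simp only [obs]
        generalize inner ℝ (x t ω) (state A β₀ w t ω) = a
        generalize ε t ω = b
        have : (a + b) ^ 4 ≤ 8 * (a ^ 4 + b ^ 4) := by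
          nlinarith [sq_nonneg (a - b), sq_nonneg (a ^ 2 - b ^ 2), sq_nonneg (a + b),
            mul_nonneg (sq_nonneg (a - b)) (sq_nonneg (a + b)),
            mul_nonneg (sq_nonneg (a - b)) (sq_nonneg (a - b)), mul_nonneg (sq_nonneg (a - b))
            (add_nonneg (sq_nonneg a) (sq_nonneg b))]
        calc (a + b) ^ 4 * ‖x t ω‖ ^ 4 ≤ 8 * (a ^ 4 + b ^ 4) * ‖x t ω‖ ^ 4 := by gcongr
          _ = _ := by ring
    _ = 8 * (∫ ω, inner ℝ (x t ω) (state A β₀ w t ω) ^ 4 * ‖x t ω‖ ^ 4 ∂μ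
        + ∫ ω, ε t ω ^ 4 * ‖x t ω‖ ^ 4 ∂μ) := by
        rw [integral_const_mul, integral_add p1.integrable p2.integrable]
    _ ≤ 8 * (315 * d ^ 4 * opNorm (stationaryCov A Sw) ^ 2 + 9 * d ^ 2 * σ ^ 4) := by gcongr
    _ ≤ _ := by
        have : 0 ≤ (d : ℝ) ^ 2 * (σ : ℝ) ^ 4 := by positivity
        nlinarith

theorem IsGaussianModel.integral_state_norm_pow_four_le (hSw : Sw.PosSemidef) (hA : rho A < 1)
    (t : ℕ) : ∫ ω, ‖state A β₀ w t ω‖ ^ 4 ∂μ ≤ 3 * d ^ 2 * opNorm (stationaryCov A Sw) ^ 2 :=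
  (h.hasGaussianMarginals_state hSw hA t).integral_norm_pow_four_le
    (stationaryCov_spec hA hSw).1.1

/-- The residual of the covariance regression at the true parameter. -/
def covResid (A Sw : Matrix (Fin d) (Fin d) ℝ) (σ : ℝ≥0) (β₀ : Ω → EuclideanSpace ℝ (Fin d))
    (w x : ℕ → Ω → EuclideanSpace ℝ (Fin d)) (ε : ℕ → Ω → ℝ) (t : ℕ) (ω : Ω) : ℝ :=
  obs A β₀ w x ε t ω ^ 2 - (x t ω).ofLp ⬝ᵥ stationaryCov A Sw *ᵥ (x t ω).ofLp - (σ : ℝ) ^ 2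

/-- The residual of the cross-covariance regression at the true parameter. -/
def crossResid (A Sw : Matrix (Fin d) (Fin d) ℝ) (β₀ : Ω → EuclideanSpace ℝ (Fin d))
    (w x : ℕ → Ω → EuclideanSpace ℝ (Fin d)) (ε : ℕ → Ω → ℝ) (t : ℕ) (ω : Ω) : ℝ :=
  obs A β₀ w x ε t ω * obs A β₀ w x ε (t + 1) ω
    - (x (t + 1) ω).ofLp ⬝ᵥ (A * stationaryCov A Sw) *ᵥ (x t ω).ofLp

omit [IsProbabilityMeasure μ] in
theorem IsGaussianModel.allLp_bilin (M : Matrix (Fin d) (Fin d) ℝ) (s t : ℕ) :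
    AllLp (fun ω => (x s ω).ofLp ⬝ᵥ M *ᵥ (x t ω).ofLp) μ := by
  simp_rw [dotProduct_mulVec_eq_sum]
  exact .sum fun p _ => (((h.hasGaussianMarginals_x s).allLp _).mul
    ((h.hasGaussianMarginals_x t).allLp _)).const_mul _

theorem IsGaussianModel.allLp_covResid (hSw : Sw.PosSemidef) (hA : rho A < 1) (t : ℕ) :
    AllLp (covResid A Sw σ β₀ w x ε t) μ :=
  (((h.allLp_obs hSw hA t).pow 2).sub (h.allLp_bilin _ t t)).sub (.const _)

theorem IsGaussianModel.allLp_crossResid (hSw : Sw.PosSemidef) (hA : rho A < 1) (t : ℕ) :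
    AllLp (crossResid A Sw β₀ w x ε t) μ :=
  ((h.allLp_obs hSw hA t).mul (h.allLp_obs hSw hA (t + 1))).sub (h.allLp_bilin _ (t + 1) t)

theorem IsGaussianModel.integral_covResid_sq_mul_le (hd : 0 < d) (hSw : Sw.PosSemidef)
    (hA : rho A < 1) (t : ℕ) :
    ∫ ω, covResid A Sw σ β₀ w x ε t ω ^ 2 * ‖x t ω‖ ^ 4 ∂μ
      ≤ 7884 * d ^ 2 * (σ ^ 4 + d ^ 2 * opNorm (stationaryCov A Sw) ^ 2) := by
  set S := stationaryCov A Sw with hS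
  have hxg := h.hasGaussianMarginals_x t
  have p1 : AllLp (fun ω => obs A β₀ w x ε t ω ^ 4 * ‖x t ω‖ ^ 4) μ :=
    ((h.allLp_obs hSw hA t).pow 4).mul hxg.allLp_norm_pow_four
  have p2 : AllLp (fun ω => opNorm S ^ 2 * ‖x t ω‖ ^ 8) μ :=
    hxg.allLp_norm_pow_eight.const_mul _
  have p3 : AllLp (fun ω => (σ : ℝ) ^ 4 * ‖x t ω‖ ^ 4) μ := hxg.allLp_norm_pow_four.const_mul _
  calc ∫ ω, covResid A Sw σ β₀ w x ε t ω ^ 2 * ‖x t ω‖ ^ 4 ∂μ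
      ≤ ∫ ω, 3 * (obs A β₀ w x ε t ω ^ 4 * ‖x t ω‖ ^ 4 + (opNorm S ^ 2 * ‖x t ω‖ ^ 8
        + (σ : ℝ) ^ 4 * ‖x t ω‖ ^ 4)) ∂μ := by
        refine integral_mono (((h.allLp_covResid hSw hA t).pow 2).mul
          hxg.allLp_norm_pow_four).integrable ((p1.add (p2.add p3)).const_mul 3).integrable
          fun ω => ?_
        have h2 : ((x t ω).ofLp ⬝ᵥ S *ᵥ (x t ω).ofLp) ^ 2 ≤ (opNorm S * (‖x t ω‖ * ‖x t ω‖)) ^ 2 := by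
          rw [← sq_abs]
          exact pow_le_pow_left₀ (abs_nonneg _) (abs_dotProduct_mulVec_le S _ _) 2
        have h4 : 0 ≤ ‖x t ω‖ ^ 4 := by positivity
        simp only [covResid, ← hS]
        generalize (x t ω).ofLp ⬝ᵥ S *ᵥ (x t ω).ofLp = b at h2 ⊢
        generalize obs A β₀ w x ε t ω = y
        have h5 : (y ^ 2 - b - (σ : ℝ) ^ 2) ^ 2 ≤ 3 * (y ^ 4 + (b ^ 2 + (σ : ℝ) ^ 4)) := by
          nlinarith [sq_nonneg (y ^ 2 + b), sq_nonneg (y ^ 2 + (σ : ℝ) ^ 2),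
            sq_nonneg (b - (σ : ℝ) ^ 2)]
        calc (y ^ 2 - b - (σ : ℝ) ^ 2) ^ 2 * ‖x t ω‖ ^ 4
            ≤ 3 * (y ^ 4 + ((opNorm S * (‖x t ω‖ * ‖x t ω‖)) ^ 2 + (σ : ℝ) ^ 4)) * ‖x t ω‖ ^ 4 := by
              gcongr; linarith
          _ = _ := by ring
    _ = 3 * (∫ ω, obs A β₀ w x ε t ω ^ 4 * ‖x t ω‖ ^ 4 ∂μ + (opNorm S ^ 2 * ∫ ω, ‖x t ω‖ ^ 8 ∂μ
        + (σ : ℝ) ^ 4 * ∫ ω, ‖x t ω‖ ^ 4 ∂μ)) := by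
        rw [integral_const_mul, integral_add p1.integrable (p2.add p3).integrable,
          integral_add p2.integrable p3.integrable, integral_const_mul, integral_const_mul]
    _ ≤ 3 * (2520 * d ^ 2 * (σ ^ 4 + d ^ 2 * opNorm S ^ 2) + (opNorm S ^ 2 * (105 * d ^ 4)
        + (σ : ℝ) ^ 4 * (3 * d ^ 2))) := by
        gcongr
        · exact h.integral_obs_pow_four_mul_le hd hSw hA t
        · exact hxg.integral_norm_pow_eight_le
        · exact h.integral_norm_x_pow_four_le hd t
    _ ≤ _ := by
        have h1 : 0 ≤ (d : ℝ) ^ 2 * (σ : ℝ) ^ 4 := by positivity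
        have h2 : 0 ≤ (d : ℝ) ^ 4 * opNorm S ^ 2 := by positivity
        nlinarith

/-- AM–GM is applied after grouping each observation with the covariate of its own time, so only
single-time moments occur although `y_t` and `y_{t+1}` are dependent. -/
theorem IsGaussianModel.integral_crossResid_sq_mul_le (hd : 0 < d) (hSw : Sw.PosSemidef)
    (hA : rho A < 1) (t : ℕ) :
    ∫ ω, crossResid A Sw β₀ w x ε t ω ^ 2 * (‖x t ω‖ ^ 2 * ‖x (t + 1) ω‖ ^ 2) ∂μ
      ≤ 5040 * d ^ 2 * (σ ^ 4 + d ^ 2 * opNorm (stationaryCov A Sw) ^ 2)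
        + 210 * d ^ 4 * opNorm (A * stationaryCov A Sw) ^ 2 := by
  set S := stationaryCov A Sw with hS
  have hx := fun t => h.hasGaussianMarginals_x t
  have p1 : ∀ t, AllLp (fun ω => obs A β₀ w x ε t ω ^ 4 * ‖x t ω‖ ^ 4) μ := fun t =>
    ((h.allLp_obs hSw hA t).pow 4).mul (hx t).allLp_norm_pow_four
  have p2 : ∀ t, AllLp (fun ω => opNorm (A * S) ^ 2 * ‖x t ω‖ ^ 8) μ := fun t =>
    (hx t).allLp_norm_pow_eight.const_mul _
  calc ∫ ω, crossResid A Sw β₀ w x ε t ω ^ 2 * (‖x t ω‖ ^ 2 * ‖x (t + 1) ω‖ ^ 2) ∂μ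
      ≤ ∫ ω, ((obs A β₀ w x ε t ω ^ 4 * ‖x t ω‖ ^ 4
          + obs A β₀ w x ε (t + 1) ω ^ 4 * ‖x (t + 1) ω‖ ^ 4)
          + (opNorm (A * S) ^ 2 * ‖x t ω‖ ^ 8 + opNorm (A * S) ^ 2 * ‖x (t + 1) ω‖ ^ 8)) ∂μ := by
        refine integral_mono (((h.allLp_crossResid hSw hA t).pow 2).mul
          ((hx t).allLp_norm_sq.mul (hx (t + 1)).allLp_norm_sq)).integrable
          (((p1 t).add (p1 (t + 1))).add ((p2 t).add (p2 (t + 1)))).integrable fun ω => ?_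
        have h2 : ((x (t + 1) ω).ofLp ⬝ᵥ (A * S) *ᵥ (x t ω).ofLp) ^ 2
            ≤ (opNorm (A * S) * (‖x (t + 1) ω‖ * ‖x t ω‖)) ^ 2 := by
          rw [← sq_abs]
          exact pow_le_pow_left₀ (abs_nonneg _) (abs_dotProduct_mulVec_le (A * S) _ _) 2
        simp only [crossResid, ← hS]
        generalize (x (t + 1) ω).ofLp ⬝ᵥ (A * S) *ᵥ (x t ω).ofLp = b at h2 ⊢
        generalize obs A β₀ w x ε t ω = y
        generalize obs A β₀ w x ε (t + 1) ω = y'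
        generalize ‖x t ω‖ = r at h2 ⊢
        generalize ‖x (t + 1) ω‖ = r' at h2 ⊢
        generalize opNorm (A * S) = q at h2 ⊢
        have h3 : (y * y' - b) ^ 2 ≤ 2 * (y * y') ^ 2 + 2 * (q * (r' * r)) ^ 2 := by
          nlinarith [sq_nonneg (y * y' + b)]
        calc (y * y' - b) ^ 2 * (r ^ 2 * r' ^ 2)
            ≤ (2 * (y * y') ^ 2 + 2 * (q * (r' * r)) ^ 2) * (r ^ 2 * r' ^ 2) := by gcongr
          _ = 2 * (y ^ 2 * r ^ 2) * (y' ^ 2 * r' ^ 2) + q ^ 2 * (2 * (r ^ 4 * r' ^ 4)) := by ring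
          _ ≤ ((y ^ 2 * r ^ 2) ^ 2 + (y' ^ 2 * r' ^ 2) ^ 2) + q ^ 2 * ((r ^ 4) ^ 2 + (r' ^ 4) ^ 2) := by
              have e1 := two_mul_le_add_sq (y ^ 2 * r ^ 2) (y' ^ 2 * r' ^ 2)
              have e2 := mul_le_mul_of_nonneg_left (two_mul_le_add_sq (r ^ 4) (r' ^ 4)) (sq_nonneg q)
              linarith
          _ = _ := by ring
    _ = (∫ ω, obs A β₀ w x ε t ω ^ 4 * ‖x t ω‖ ^ 4 ∂μ
          + ∫ ω, obs A β₀ w x ε (t + 1) ω ^ 4 * ‖x (t + 1) ω‖ ^ 4 ∂μ)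
          + (opNorm (A * S) ^ 2 * ∫ ω, ‖x t ω‖ ^ 8 ∂μ
            + opNorm (A * S) ^ 2 * ∫ ω, ‖x (t + 1) ω‖ ^ 8 ∂μ) := by
        rw [integral_add ((p1 t).add (p1 (t + 1))).integrable ((p2 t).add (p2 (t + 1))).integrable,
          integral_add (p1 t).integrable (p1 (t + 1)).integrable,
          integral_add (p2 t).integrable (p2 (t + 1)).integrable, integral_const_mul,
          integral_const_mul]
    _ ≤ (2520 * d ^ 2 * (σ ^ 4 + d ^ 2 * opNorm S ^ 2)
          + 2520 * d ^ 2 * (σ ^ 4 + d ^ 2 * opNorm S ^ 2))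
          + (opNorm (A * S) ^ 2 * (105 * d ^ 4) + opNorm (A * S) ^ 2 * (105 * d ^ 4)) := by
        gcongr
        · exact h.integral_obs_pow_four_mul_le hd hSw hA t
        · exact h.integral_obs_pow_four_mul_le hd hSw hA (t + 1)
        · exact (hx t).integral_norm_pow_eight_le
        · exact (hx (t + 1)).integral_norm_pow_eight_le
    _ = _ := by ring

end Model

/-! ### Averaging the scores over the covariates. -/

/-- Two linear combinations with random coefficients `H`, `H'` of variables `f`, `f'` that are
independent of each other and of the coefficients: the `f`s may be replaced by their means. -/
theorem integral_mul_decouple {Ω ι κ : Type*} [MeasurableSpace Ω] {μ : Measure Ω} [Fintype ι]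
    [Fintype κ] {H f : ι → Ω → ℝ} {H' f' : κ → Ω → ℝ} (hH : ∀ a, AllLp (H a) μ)
    (hf : ∀ a, AllLp (f a) μ) (hH' : ∀ b, AllLp (H' b) μ) (hf' : ∀ b, AllLp (f' b) μ)
    (hff : ∀ a b, IndepFun (f a) (f' b) μ)
    (hfH : ∀ a b, IndepFun (fun ω => f a ω * f' b ω) (fun ω => H a ω * H' b ω) μ) :
    ∫ ω, (∑ a, H a ω * f a ω) * (∑ b, H' b ω * f' b ω) ∂μ
      = ∫ ω, (∑ a, H a ω * ∫ ω', f a ω' ∂μ) * (∑ b, H' b ω * ∫ ω', f' b ω' ∂μ) ∂μ := by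
  have e1 : ∀ ω, (∑ a, H a ω * f a ω) * (∑ b, H' b ω * f' b ω)
      = ∑ a, ∑ b, (f a ω * f' b ω) * (H a ω * H' b ω) := by
    intro ω
    rw [Finset.sum_mul_sum]
    exact Finset.sum_congr rfl fun a _ => Finset.sum_congr rfl fun b _ => by ring
  have e2 : ∀ ω, (∑ a, H a ω * ∫ ω', f a ω' ∂μ) * (∑ b, H' b ω * ∫ ω', f' b ω' ∂μ)
      = ∑ a, ∑ b, ((∫ ω', f a ω' ∂μ) * ∫ ω', f' b ω' ∂μ) * (H a ω * H' b ω) := by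
    intro ω
    rw [Finset.sum_mul_sum]
    exact Finset.sum_congr rfl fun a _ => Finset.sum_congr rfl fun b _ => by ring
  have p1 : ∀ a b, Integrable (fun ω => (f a ω * f' b ω) * (H a ω * H' b ω)) μ := fun a b =>
    (((hf a).mul (hf' b)).mul ((hH a).mul (hH' b))).integrable
  have p2 : ∀ a b, Integrable (fun ω => ((∫ ω', f a ω' ∂μ) * ∫ ω', f' b ω' ∂μ)
      * (H a ω * H' b ω)) μ := fun a b => (((hH a).mul (hH' b)).const_mul _).integrable
  simp_rw [e1, e2]
  rw [integral_finsetSum _ fun a _ => integrable_finsetSum _ fun b _ => p1 a b,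
    integral_finsetSum _ fun a _ => integrable_finsetSum _ fun b _ => p2 a b]
  refine Finset.sum_congr rfl fun a _ => ?_
  rw [integral_finsetSum _ fun b _ => p1 a b, integral_finsetSum _ fun b _ => p2 a b]
  refine Finset.sum_congr rfl fun b _ => ?_
  rw [(hfH a b).integral_fun_mul_eq_mul_integral ((hf a).mul (hf' b)).aestronglyMeasurable
    ((hH a).mul (hH' b)).aestronglyMeasurable, integral_const_mul,
    (hff a b).integral_fun_mul_eq_mul_integral (hf a).aestronglyMeasurable
      (hf' b).aestronglyMeasurable]

section Standard

variable {d : ℕ} {Ω : Type*} [MeasurableSpace Ω] {μ : Measure Ω}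
  {X : Ω → EuclideanSpace ℝ (Fin d)}

/-- Lets the weighted moment formulas at `s = 1` supply the unweighted ones. -/
theorem gaussWeight_one (v : EuclideanSpace ℝ (Fin d)) : gaussWeight 1 v = 1 := by
  simp [gaussWeight]

theorem integral_std_two (hX : HasLaw X (multivariateGaussian 0 1) μ) (i j : Fin d) :
    ∫ ω, X ω i * X ω j ∂μ = if i = j then 1 else 0 := by
  rw [multivariateGaussian_zero_one] at hX
  have h := integral_gaussWeight_two (d := d) (one_ne_zero (α := ℝ≥0)) i j
  simp only [gaussWeight_one, one_mul, NNReal.coe_one, Real.sqrt_one, one_pow] at h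
  rw [← h]
  exact integral_comp_of_hasLaw hX (f := fun z => z i * z j) (by fun_prop)

theorem integral_std_three (hX : HasLaw X (multivariateGaussian 0 1) μ) (i j k : Fin d) :
    ∫ ω, X ω i * X ω j * X ω k ∂μ = 0 := by
  rw [multivariateGaussian_zero_one] at hX
  have h := integral_gaussWeight_three (d := d) (one_ne_zero (α := ℝ≥0)) i j k
  simp only [gaussWeight_one, one_mul] at h
  rw [← h]
  exact integral_comp_of_hasLaw hX (f := fun z => z i * z j * z k) (by fun_prop)

theorem integral_std_four (hX : HasLaw X (multivariateGaussian 0 1) μ) (i j k l : Fin d) :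
    ∫ ω, X ω i * X ω j * X ω k * X ω l ∂μ
      = (if i = j then 1 else 0) * (if k = l then 1 else 0)
        + (if i = k then 1 else 0) * (if j = l then 1 else 0)
        + (if i = l then 1 else 0) * (if j = k then 1 else 0) := by
  rw [multivariateGaussian_zero_one] at hX
  have h := integral_gaussWeight_four (d := d) (one_ne_zero (α := ℝ≥0)) i j k l
  simp only [gaussWeight_one, one_mul, NNReal.coe_one, Real.sqrt_one, one_pow] at h
  rw [← h]
  exact integral_comp_of_hasLaw hX (f := fun z => z i * z j * z k * z l) (by fun_prop)

end Standard

/-- Adjoin the coordinate `c` to the vector `v`. -/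
def adjoin {d : ℕ} (v : EuclideanSpace ℝ (Fin d)) (c : ℝ) : Option (Fin d) → ℝ
  | none => c
  | some i => v i

/-- The block matrix `diag(S, c)`. -/
def adjoinBlock {d : ℕ} (S : Matrix (Fin d) (Fin d) ℝ) (c : ℝ) :
    Option (Fin d) → Option (Fin d) → ℝ
  | none, none => c
  | some i, some j => S i j
  | _, _ => 0

section Model

variable {d : ℕ} {Ω : Type*} [mΩ : MeasurableSpace Ω] {μ : Measure Ω} [IsProbabilityMeasure μ]
  {A Sw : Matrix (Fin d) (Fin d) ℝ} {σ : ℝ≥0}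
  {β₀ : Ω → EuclideanSpace ℝ (Fin d)} {w x : ℕ → Ω → EuclideanSpace ℝ (Fin d)} {ε : ℕ → Ω → ℝ}

/-- The hidden coefficients of the two residuals as bilinear forms in the covariates. -/
def hiddenDev (M : Matrix (Fin d) (Fin d) ℝ) (c : ℝ) (A : Matrix (Fin d) (Fin d) ℝ)
    (β₀ : Ω → EuclideanSpace ℝ (Fin d)) (w : ℕ → Ω → EuclideanSpace ℝ (Fin d)) (ε : ℕ → Ω → ℝ)
    (s t : ℕ) (p : Option (Fin d) × Option (Fin d)) (ω : Ω) : ℝ :=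
  adjoin (state A β₀ w s ω) (ε s ω) p.1 * adjoin (state A β₀ w t ω) (ε t ω) p.2
    - adjoinBlock M c p.1 p.2

omit mΩ in
theorem obs_eq_sum (t : ℕ) (ω : Ω) : obs A β₀ w x ε t ω
    = ∑ k, adjoin (state A β₀ w t ω) (ε t ω) k * adjoin (x t ω) 1 k := by
  rw [obs, inner_eq_sum_coord, Fintype.sum_option]
  simp only [adjoin, mul_one]
  rw [add_comm]
  congr 1
  exact Finset.sum_congr rfl fun i _ => mul_comm _ _

theorem sum_adjoinBlock (M : Matrix (Fin d) (Fin d) ℝ) (c : ℝ) (u v : EuclideanSpace ℝ (Fin d)) :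
    ∑ p : Option (Fin d) × Option (Fin d), adjoinBlock M c p.1 p.2 * (adjoin u 1 p.1 * adjoin v 1 p.2)
      = u.ofLp ⬝ᵥ M *ᵥ v.ofLp + c := by
  rw [Fintype.sum_prod_type, dotProduct_mulVec_eq_sum, Fintype.sum_prod_type]
  simp [Fintype.sum_option, adjoinBlock, adjoin, add_comm]

-- Regarding the observation noise as the coefficient of an additional covariate equal to 1 turns
-- each residual into a bilinear form in the extended covariates. Its coefficients are functions of
-- states and noise only, which is the shape `integral_mul_decouple` requires.
omit mΩ in
theorem sum_hiddenDev (M : Matrix (Fin d) (Fin d) ℝ) (c : ℝ) (s t : ℕ) (ω : Ω) :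
    ∑ p, hiddenDev M c A β₀ w ε s t p ω * (adjoin (x s ω) 1 p.1 * adjoin (x t ω) 1 p.2)
      = obs A β₀ w x ε s ω * obs A β₀ w x ε t ω
        - (x s ω).ofLp ⬝ᵥ M *ᵥ (x t ω).ofLp - c := by
  rw [sub_sub, ← sum_adjoinBlock, obs_eq_sum, obs_eq_sum, Finset.sum_mul_sum,
    ← Fintype.sum_prod_type' (f := fun k l =>
      adjoin (state A β₀ w s ω) (ε s ω) k * adjoin (x s ω) 1 k
        * (adjoin (state A β₀ w t ω) (ε t ω) l * adjoin (x t ω) 1 l)), ← Finset.sum_sub_distrib]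
  exact Finset.sum_congr rfl fun p _ => by rw [hiddenDev]; ring

theorem measurable_adjoin (c : ℝ) (k : Option (Fin d)) :
    Measurable fun v : EuclideanSpace ℝ (Fin d) => adjoin v c k := by
  cases k with
  | none => exact measurable_const
  | some i => exact (by fun_prop : Measurable fun v : EuclideanSpace ℝ (Fin d) => v i)

omit mΩ in
theorem measurable_hidden_hiddenDev (M : Matrix (Fin d) (Fin d) ℝ) (c : ℝ) (s t : ℕ)
    (p : Option (Fin d) × Option (Fin d)) :
    Measurable[hidden β₀ w ε] (hiddenDev M c A β₀ w ε s t p) := by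
  have h1 : ∀ t k, Measurable[hidden β₀ w ε] fun ω => adjoin (state A β₀ w t ω) (ε t ω) k := by
    intro t k
    cases k with
    | none => exact measurable_hidden_noise t
    | some i => exact measurable_hidden_state_apply t i
  exact ((h1 s p.1).mul (h1 t p.2)).sub_const _

variable (h : IsGaussianModel μ A Sw σ β₀ w x ε)
include h

theorem IsGaussianModel.allLp_adjoin_x (t : ℕ) (k : Option (Fin d)) :
    AllLp (fun ω => adjoin (x t ω) 1 k) μ := by
  cases k with
  | none => exact .const 1
  | some i => exact (h.hasGaussianMarginals_x t).allLp i

theorem IsGaussianModel.allLp_hiddenDev (hSw : Sw.PosSemidef) (hA : rho A < 1)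
    (M : Matrix (Fin d) (Fin d) ℝ) (c : ℝ) (s t : ℕ) (p : Option (Fin d) × Option (Fin d)) :
    AllLp (hiddenDev M c A β₀ w ε s t p) μ := by
  have h1 : ∀ t k, AllLp (fun ω => adjoin (state A β₀ w t ω) (ε t ω) k) μ := by
    intro t k
    cases k with
    | none => exact h.allLp_noise t
    | some i => exact h.allLp_state hSw hA t i
  exact ((h1 s p.1).mul (h1 t p.2)).sub (.const _)

omit [IsProbabilityMeasure μ] in
theorem IsGaussianModel.integral_adjoin_four (t : ℕ) (k l : Option (Fin d)) (i j : Fin d) :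
    ∫ ω, adjoin (x t ω) 1 k * adjoin (x t ω) 1 l * x t ω i * x t ω j ∂μ
      = match k, l with
        | none, none => if i = j then 1 else 0
        | some a, some b => (if a = b then 1 else 0) * (if i = j then 1 else 0)
          + (if a = i then 1 else 0) * (if b = j then 1 else 0)
          + (if a = j then 1 else 0) * (if b = i then 1 else 0)
        | _, _ => 0 := by
  cases k with
  | none =>
    cases l with
    | none => simpa [adjoin] using integral_std_two (h.law_x t) i j
    | some b => simpa [adjoin] using integral_std_three (h.law_x t) b i j
  | some a =>
    cases l with
    | none => simpa [adjoin] using integral_std_three (h.law_x t) a i j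
    | some b => simpa [adjoin] using integral_std_four (h.law_x t) a b i j

omit [IsProbabilityMeasure μ] in
theorem IsGaussianModel.integral_adjoin_two (t : ℕ) (k : Option (Fin d)) (i : Fin d) :
    ∫ ω, adjoin (x t ω) 1 k * x t ω i ∂μ
      = match k with
        | none => 0
        | some a => if a = i then 1 else 0 := by
  cases k with
  | none => simpa [adjoin] using (h.hasGaussianMarginals_x t).integral_coord i
  | some a => simpa [adjoin] using integral_std_two (h.law_x t) a i

/-- The mean of the covariance score over the covariates. -/
def covMean (A Sw : Matrix (Fin d) (Fin d) ℝ) (σ : ℝ≥0) (β₀ : Ω → EuclideanSpace ℝ (Fin d))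
    (w : ℕ → Ω → EuclideanSpace ℝ (Fin d)) (ε : ℕ → Ω → ℝ) (t : ℕ) (i j : Fin d) (ω : Ω) : ℝ :=
  (stateDev A Sw β₀ w t ω i j + stateDev A Sw β₀ w t ω j i
    + (∑ a, stateDev A Sw β₀ w t ω a a) * (if i = j then 1 else 0))
    + (ε t ω ^ 2 - (σ : ℝ) ^ 2) * (if i = j then 1 else 0)

/-- Given the hidden variables, scores at different times are independent, so each may be replaced
by its mean over its covariate. Terms linear in the noise carry an odd moment of `x` and drop out.
-/
theorem IsGaussianModel.integral_cov_decouple (hSw : Sw.PosSemidef) (hA : rho A < 1) {s t : ℕ}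
    (hst : s ≠ t) (i j : Fin d) :
    ∫ ω, (covResid A Sw σ β₀ w x ε s ω * (x s ω i * x s ω j))
        * (covResid A Sw σ β₀ w x ε t ω * (x t ω i * x t ω j)) ∂μ
      = ∫ ω, covMean A Sw σ β₀ w ε s i j ω * covMean A Sw σ β₀ w ε t i j ω ∂μ := by
  set S := stationaryCov A Sw with hS
  let H : ℕ → Option (Fin d) × Option (Fin d) → Ω → ℝ := fun t p =>
    hiddenDev S ((σ : ℝ) ^ 2) A β₀ w ε t t p
  let f : ℕ → Option (Fin d) × Option (Fin d) → Ω → ℝ := fun t p ω =>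
    adjoin (x t ω) 1 p.1 * adjoin (x t ω) 1 p.2 * x t ω i * x t ω j
  let g : Option (Fin d) × Option (Fin d) → EuclideanSpace ℝ (Fin d) → ℝ := fun p v =>
    adjoin v 1 p.1 * adjoin v 1 p.2 * v i * v j
  have hg : ∀ p, Measurable (g p) := fun p =>
    (((measurable_adjoin 1 p.1).mul (measurable_adjoin 1 p.2)).mul
      (by fun_prop : Measurable fun v : EuclideanSpace ℝ (Fin d) => v i)).mul
      (by fun_prop : Measurable fun v : EuclideanSpace ℝ (Fin d) => v j)
  have hxp := fun t => (h.hasGaussianMarginals_x t).allLp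
  have hf : ∀ t p, AllLp (f t p) μ := fun t p =>
    (((h.allLp_adjoin_x t p.1).mul (h.allLp_adjoin_x t p.2)).mul (hxp t i)).mul (hxp t j)
  have e1 : ∀ t ω, covResid A Sw σ β₀ w x ε t ω * (x t ω i * x t ω j) = ∑ p, H t p ω * f t p ω := by
    intro t ω
    rw [covResid, ← hS, sq (obs A β₀ w x ε t ω), ← sum_hiddenDev, Finset.sum_mul]
    exact Finset.sum_congr rfl fun p _ => by simp only [H, f]; ring
  have e2 : ∀ t ω, ∑ p, H t p ω * ∫ ω', f t p ω' ∂μ = covMean A Sw σ β₀ w ε t i j ω := by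
    intro t ω
    simp only [H, f, h.integral_adjoin_four, Fintype.sum_prod_type, Fintype.sum_option, mul_zero,
      Finset.sum_const_zero, add_zero, zero_add, mul_add, Finset.sum_add_distrib]
    simp only [covMean, stateDev, hiddenDev, adjoin, adjoinBlock, Matrix.of_apply, ← hS,
      mul_ite, mul_one, mul_zero, Finset.sum_ite_eq', Finset.mem_univ, if_true]
    split_ifs with hij
    · simp; ring
    · simp
  simp_rw [e1]
  refine (integral_mul_decouple (H := H s) (H' := H t)
    (fun p => h.allLp_hiddenDev hSw hA _ _ _ _ p) (hf s)
    (fun p => h.allLp_hiddenDev hSw hA _ _ _ _ p) (hf t) ?_ ?_).trans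
    (integral_congr_ae (ae_of_all _ fun ω => congrArg₂ (· * ·) (e2 s ω) (e2 t ω)))
  · intro a b
    exact (h.indep_x.indepFun hst).comp (hg a) (hg b)
  · intro a b
    exact h.indepFun_covariates (g := fun z => g a (z s) * g b (z t))
      (((hg a).comp (measurable_pi_apply s)).mul ((hg b).comp (measurable_pi_apply t)))
      ((measurable_hidden_hiddenDev _ _ _ _ a).mul (measurable_hidden_hiddenDev _ _ _ _ b))

/-- A gap of at least 2 makes `x_s, x_{s+1}, x_t, x_{t+1}` four different covariates; at gap 1 the
two scores would share one. -/
theorem IsGaussianModel.integral_cross_decouple (hSw : Sw.PosSemidef) (hA : rho A < 1) {s t : ℕ}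
    (hst : s + 2 ≤ t) (i j : Fin d) :
    ∫ ω, (crossResid A Sw β₀ w x ε s ω * (x (s + 1) ω i * x s ω j))
        * (crossResid A Sw β₀ w x ε t ω * (x (t + 1) ω i * x t ω j)) ∂μ
      = ∫ ω, crossDev A Sw β₀ w s ω i j * crossDev A Sw β₀ w t ω i j ∂μ := by
  set S := A * stationaryCov A Sw with hS
  let H : ℕ → Option (Fin d) × Option (Fin d) → Ω → ℝ := fun t p =>
    hiddenDev S 0 A β₀ w ε (t + 1) t p
  let g : Option (Fin d) × Option (Fin d) → EuclideanSpace ℝ (Fin d) × EuclideanSpace ℝ (Fin d) → ℝ :=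
    fun p v => (adjoin v.1 1 p.1 * v.1 i) * (adjoin v.2 1 p.2 * v.2 j)
  let f : ℕ → Option (Fin d) × Option (Fin d) → Ω → ℝ := fun t p ω =>
    (adjoin (x (t + 1) ω) 1 p.1 * x (t + 1) ω i) * (adjoin (x t ω) 1 p.2 * x t ω j)
  have hg1 : ∀ k i, Measurable fun v : EuclideanSpace ℝ (Fin d) => adjoin v 1 k * v i := fun k i =>
    (measurable_adjoin 1 k).mul (by fun_prop : Measurable fun v : EuclideanSpace ℝ (Fin d) => v i)
  have hg : ∀ p, Measurable (g p) := fun p =>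
    ((hg1 p.1 i).comp measurable_fst).mul ((hg1 p.2 j).comp measurable_snd)
  have hxp := fun t => (h.hasGaussianMarginals_x t).allLp
  have hf1 : ∀ t k i, AllLp (fun ω => adjoin (x t ω) 1 k * x t ω i) μ := fun t k i =>
    (h.allLp_adjoin_x t k).mul (hxp t i)
  have hf : ∀ t p, AllLp (f t p) μ := fun t p => (hf1 _ _ _).mul (hf1 _ _ _)
  have hEf : ∀ t p, ∫ ω, f t p ω ∂μ = (∫ ω, adjoin (x (t + 1) ω) 1 p.1 * x (t + 1) ω i ∂μ)
      * ∫ ω, adjoin (x t ω) 1 p.2 * x t ω j ∂μ := fun t p =>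
    ((h.indep_x.indepFun (by omega : t + 1 ≠ t)).comp (hg1 p.1 i)
      (hg1 p.2 j)).integral_fun_mul_eq_mul_integral (hf1 _ _ _).aestronglyMeasurable
        (hf1 _ _ _).aestronglyMeasurable
  have e1 : ∀ t ω, crossResid A Sw β₀ w x ε t ω * (x (t + 1) ω i * x t ω j)
      = ∑ p, H t p ω * f t p ω := by
    intro t ω
    have h0 := sum_hiddenDev (A := A) (β₀ := β₀) (w := w) (x := x) (ε := ε) S 0 (t + 1) t ω
    rw [crossResid, ← hS, mul_comm (obs A β₀ w x ε t ω), ← sub_zero (_ - _), ← h0, Finset.sum_mul]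
    exact Finset.sum_congr rfl fun p _ => by simp only [H, f]; ring
  have e2 : ∀ t ω, ∑ p, H t p ω * ∫ ω', f t p ω' ∂μ = crossDev A Sw β₀ w t ω i j := by
    intro t ω
    simp only [hEf, h.integral_adjoin_two, Fintype.sum_prod_type, Fintype.sum_option, mul_zero,
      zero_mul, Finset.sum_const_zero, zero_add]
    simp [H, crossDev, hiddenDev, adjoin, adjoinBlock, ← hS]
  simp_rw [e1]
  refine (integral_mul_decouple (H := H s) (H' := H t)
    (fun p => h.allLp_hiddenDev hSw hA _ _ _ _ p) (hf s)
    (fun p => h.allLp_hiddenDev hSw hA _ _ _ _ p) (hf t) ?_ ?_).trans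
    (integral_congr_ae (ae_of_all _ fun ω => congrArg₂ (· * ·) (e2 s ω) (e2 t ω)))
  · intro a b
    exact (h.indep_x.indepFun_prodMk_prodMk h.measurable_x (s + 1) s (t + 1) t (by omega)
      (by omega) (by omega) (by omega)).comp (hg a) (hg b)
  · intro a b
    exact h.indepFun_covariates
      (g := fun z => g a (z (s + 1), z s) * g b (z (t + 1), z t))
      (((hg a).comp (by fun_prop : Measurable fun z : ℕ → EuclideanSpace ℝ (Fin d) =>
        (z (s + 1), z s))).mul ((hg b).comp (by fun_prop :
        Measurable fun z : ℕ → EuclideanSpace ℝ (Fin d) => (z (t + 1), z t))))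
      ((measurable_hidden_hiddenDev _ _ _ _ a).mul (measurable_hidden_hiddenDev _ _ _ _ b))

end Model

/-! ### Decay of correlations between scores. -/

theorem integral_sub_sq_le {Ω : Type*} [MeasurableSpace Ω] {μ : Measure Ω}
    [IsProbabilityMeasure μ] {Z : Ω → ℝ} (hZ : AllLp Z μ) {c : ℝ} (hc : ∫ ω, Z ω ∂μ = c) :
    ∫ ω, (Z ω - c) ^ 2 ∂μ ≤ ∫ ω, Z ω ^ 2 ∂μ := by
  have e : ∀ ω, (Z ω - c) ^ 2 = Z ω ^ 2 - (2 * c * Z ω - c ^ 2) := fun ω => by ring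
  have i1 : Integrable (fun ω => 2 * c * Z ω) μ := (hZ.const_mul _).integrable
  have i2 : Integrable (fun ω => 2 * c * Z ω - c ^ 2) μ := i1.sub (integrable_const _)
  simp_rw [e]
  rw [integral_sub (hZ.pow 2).integrable i2,
    integral_sub i1 (integrable_const _), integral_const_mul, hc]
  simp only [integral_const, probReal_univ, one_smul]
  nlinarith [sq_nonneg c]

/-- The second moment of a sum of vectors whose correlations decay geometrically. -/
theorem integral_sq_sum_le {Ω ι : Type*} [MeasurableSpace Ω] [Fintype ι] {μ : Measure Ω}
    [IsProbabilityMeasure μ] {U : ℕ → ι → Ω → ℝ} (hU : ∀ t i, AllLp (U t i) μ) {B₀ B₁ r : ℝ}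
    (hB₁ : 0 ≤ B₁) (hr0 : 0 ≤ r) (hr1 : r < 1)
    (hdiag : ∀ t, ∫ ω, ∑ i, U t i ω ^ 2 ∂μ ≤ B₀)
    (hoff : ∀ s m, ∫ ω, ∑ i, U s i ω * U (s + 2 + m) i ω ∂μ ≤ B₁ * r ^ m) (T : ℕ) :
    ∫ ω, ∑ i, (∑ t ∈ Finset.range T, U t i ω) ^ 2 ∂μ ≤ T * (3 * B₀ + 2 * (B₁ / (1 - r))) := by
  have hB₀ : 0 ≤ B₀ := (integral_nonneg fun ω => by positivity).trans (hdiag 0)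
  have hBr : 0 ≤ B₁ / (1 - r) := div_nonneg hB₁ (by linarith)
  have hprod : ∀ s t, Integrable (fun ω => ∑ i, U s i ω * U t i ω) μ := fun s t =>
    (AllLp.sum fun i _ => (hU s i).mul (hU t i)).integrable
  have hsq : ∀ t, Integrable (fun ω => ∑ i, U t i ω ^ 2) μ := fun t =>
    (AllLp.sum fun i _ => (hU t i).pow 2).integrable
  -- No decay is available for neighbours; AM–GM bounds them by the diagonal. Counted twice, they
  -- turn `B₀` into `3 * B₀`.
  have hadj : ∀ s, ∫ ω, ∑ i, U s i ω * U (s + 1) i ω ∂μ ≤ B₀ := by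
    intro s
    calc ∫ ω, ∑ i, U s i ω * U (s + 1) i ω ∂μ
        ≤ ∫ ω, 1 / 2 * (∑ i, U s i ω ^ 2 + ∑ i, U (s + 1) i ω ^ 2) ∂μ := by
          refine integral_mono (hprod _ _) (((hsq s).add (hsq (s + 1))).const_mul _) fun ω => ?_
          simp only
          rw [← Finset.sum_add_distrib, Finset.mul_sum]
          exact Finset.sum_le_sum fun i _ => by nlinarith [sq_nonneg (U s i ω - U (s + 1) i ω)]
      _ ≤ B₀ := by
          rw [integral_const_mul, integral_add (hsq s) (hsq (s + 1))]
          linarith [hdiag s, hdiag (s + 1)]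
  -- The correlation of one vector with all its predecessors: one neighbour plus a geometric series.
  -- The induction on `T` then adds one such row at a time.
  have hrow : ∀ T, ∑ s ∈ Finset.range T, ∫ ω, ∑ i, U s i ω * U T i ω ∂μ ≤ B₀ + B₁ / (1 - r) := by
    intro T
    cases T with
    | zero => simpa using add_nonneg hB₀ hBr
    | succ k =>
      rw [Finset.sum_range_succ, add_comm B₀]
      refine add_le_add ?_ (hadj k)
      calc ∑ s ∈ Finset.range k, ∫ ω, ∑ i, U s i ω * U (k + 1) i ω ∂μ
          ≤ ∑ s ∈ Finset.range k, B₁ * r ^ (k - 1 - s) := by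
            refine Finset.sum_le_sum fun s hs => ?_
            have hs' := Finset.mem_range.1 hs
            have := hoff s (k - 1 - s)
            rwa [show s + 2 + (k - 1 - s) = k + 1 by omega] at this
        _ = B₁ * ∑ m ∈ Finset.range k, r ^ m := by
            rw [← Finset.mul_sum, Finset.sum_range_reflect (fun m => r ^ m) k]
        _ ≤ B₁ * (1 / (1 - r)) := by
            refine mul_le_mul_of_nonneg_left ?_ hB₁
            rw [one_div, ← tsum_geometric_of_lt_one hr0 hr1]
            exact (summable_geometric_of_lt_one hr0 hr1).sum_le_tsum _
              fun m _ => pow_nonneg hr0 m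
        _ = B₁ / (1 - r) := by ring
  induction T with
  | zero => simp
  | succ T ih =>
    have e : ∀ ω, ∑ i, (∑ t ∈ Finset.range (T + 1), U t i ω) ^ 2
        = ∑ i, (∑ t ∈ Finset.range T, U t i ω) ^ 2
          + (2 * (∑ s ∈ Finset.range T, ∑ i, U s i ω * U T i ω) + ∑ i, U T i ω ^ 2) := by
      intro ω
      rw [Finset.sum_comm, Finset.mul_sum, ← Finset.sum_add_distrib, ← Finset.sum_add_distrib]
      refine Finset.sum_congr rfl fun i _ => ?_
      rw [Finset.sum_range_succ, ← Finset.sum_mul]; ring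
    have i1 : Integrable (fun ω => ∑ i, (∑ t ∈ Finset.range T, U t i ω) ^ 2) μ :=
      (AllLp.sum fun i _ => (AllLp.sum fun t _ => hU t i).pow 2).integrable
    have i2 : Integrable (fun ω => 2 * (∑ s ∈ Finset.range T, ∑ i, U s i ω * U T i ω)) μ :=
      (integrable_finsetSum _ fun s _ => hprod s T).const_mul 2
    have i3 : Integrable (fun ω => 2 * (∑ s ∈ Finset.range T, ∑ i, U s i ω * U T i ω)
        + ∑ i, U T i ω ^ 2) μ := i2.add (hsq T)
    simp_rw [e]
    rw [integral_add i1 i3, integral_add i2 (hsq T), integral_const_mul,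
      integral_finsetSum _ fun s _ => hprod s T]
    push_cast
    linarith [hrow T, hdiag T]

section Model

variable {d : ℕ} {Ω : Type*} [mΩ : MeasurableSpace Ω] {μ : Measure Ω} [IsProbabilityMeasure μ]
  {A Sw : Matrix (Fin d) (Fin d) ℝ} {σ : ℝ≥0}
  {β₀ : Ω → EuclideanSpace ℝ (Fin d)} {w x : ℕ → Ω → EuclideanSpace ℝ (Fin d)} {ε : ℕ → Ω → ℝ}

/-- The operator `M ↦ M + Mᵀ + tr(M) I`. -/
def momentOp (M : Matrix (Fin d) (Fin d) ℝ) : Matrix (Fin d) (Fin d) ℝ :=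
  Matrix.of fun i j => M i j + M j i + (∑ a, M a a) * (if i = j then 1 else 0)

/-- The trace term dominates: `‖tr(M) I‖_F² = d (tr M)² ≤ d² ‖M‖_F²`. -/
theorem frobNorm_momentOp_le (hd : 0 < d) (M : Matrix (Fin d) (Fin d) ℝ) :
    frobNorm (momentOp M) ≤ 3 * d * frobNorm M := by
  have hd' : (1 : ℝ) ≤ d := by exact_mod_cast hd
  refine (pow_le_pow_iff_left₀ (frobNorm_nonneg _)
    (mul_nonneg (by positivity) (frobNorm_nonneg _)) two_ne_zero).1 ?_
  have h1 : frobNorm (momentOp M) ^ 2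
      ≤ 3 * (∑ i, ∑ j, M i j ^ 2 + ∑ i, ∑ j, M j i ^ 2
        + ∑ i : Fin d, ∑ j : Fin d, (∑ a, M a a) ^ 2 * (if i = j then 1 else 0)) := by
    rw [frobNorm_sq, ← Finset.sum_add_distrib, ← Finset.sum_add_distrib, Finset.mul_sum]
    refine Finset.sum_le_sum fun i _ => ?_
    rw [← Finset.sum_add_distrib, ← Finset.sum_add_distrib, Finset.mul_sum]
    refine Finset.sum_le_sum fun j _ => ?_
    simp only [momentOp, Matrix.of_apply]
    generalize ∑ a, M a a = c
    split_ifs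
    · nlinarith [sq_nonneg (M i j - M j i), sq_nonneg (M i j - c), sq_nonneg (M j i - c)]
    · nlinarith [sq_nonneg (M i j - M j i), sq_nonneg (M i j + M j i)]
  have h2 : ∑ i, ∑ j, M j i ^ 2 = frobNorm M ^ 2 := by rw [frobNorm_sq, Finset.sum_comm]
  have h3 : ∑ i : Fin d, ∑ j : Fin d, (∑ a, M a a) ^ 2 * (if i = j then (1 : ℝ) else 0)
      = d * (∑ a, M a a) ^ 2 := by simp
  rw [← frobNorm_sq, h2, h3] at h1
  have h4 := mul_le_mul_of_nonneg_left (sq_trace_le M) (Nat.cast_nonneg (α := ℝ) d)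
  have h5 : 0 ≤ frobNorm M ^ 2 := sq_nonneg _
  have h6 : frobNorm M ^ 2 ≤ (d : ℝ) ^ 2 * frobNorm M ^ 2 :=
    le_mul_of_one_le_left h5 (one_le_pow₀ hd')
  nlinarith

variable (h : IsGaussianModel μ A Sw σ β₀ w x ε)
include h

theorem IsGaussianModel.indepFun_past_noise {F : Ω → ℝ} {t : ℕ} (hF : Measurable[past β₀ w t] F)
    {g : (ℕ → ℝ) → ℝ} (hg : Measurable g) : IndepFun F (fun ω => g fun t => ε t ω) μ := by
  have hw := h.measurable_w
  have hε := h.measurable_ε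
  have h0 : IndepFun (fun ω => (β₀ ω, fun t => w t ω)) (fun ω t => ε t ω) μ :=
    indepFun_prodMk_left h.measurable_β₀ (measurable_pi_lambda _ hw) (measurable_pi_lambda _ hε)
      h.indep_β₀_noise h.indep_w_ε
  have h1 : IndepFun (fun ω => (β₀ ω, fun r : Finset.range t => w r ω)) (fun ω t => ε t ω) μ :=
    h0.comp (φ := fun z : EuclideanSpace ℝ (Fin d) × (ℕ → EuclideanSpace ℝ (Fin d)) =>
      (z.1, fun r : Finset.range t => z.2 r)) (by fun_prop) measurable_id
  have h2 : IndepFun F (fun ω t => ε t ω) μ := (IndepFun_iff_Indep _ _ _).2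
    (indep_of_indep_of_le_left ((IndepFun_iff_Indep _ _ _).1 h1) hF.comap_le)
  exact h2.comp measurable_id hg

omit [IsProbabilityMeasure μ] in
theorem IsGaussianModel.integral_noise_sq_sub [IsProbabilityMeasure μ] (t : ℕ) :
    ∫ ω, (ε t ω ^ 2 - (σ : ℝ) ^ 2) ∂μ = 0 := by
  rw [integral_sub ((h.allLp_noise t).pow 2).integrable (integrable_const _),
    integral_pow_of_hasLaw (h.law_ε t), integral_pow_two_gaussianReal]
  simp

theorem IsGaussianModel.allLp_momentOp_stateDev (hSw : Sw.PosSemidef) (hA : rho A < 1) (t : ℕ)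
    (i j : Fin d) : AllLp (fun ω => momentOp (stateDev A Sw β₀ w t ω) i j) μ :=
  ((h.allLp_stateDev hSw hA t i j).add (h.allLp_stateDev hSw hA t j i)).add
    ((AllLp.sum fun a _ => h.allLp_stateDev hSw hA t a a).mul (.const _))

omit h [IsProbabilityMeasure μ] mΩ in
theorem measurable_past_momentOp_stateDev (t : ℕ) (i j : Fin d) :
    Measurable[past β₀ w t] fun ω => momentOp (stateDev A Sw β₀ w t ω) i j :=
  ((measurable_past_stateDev t i j).add (measurable_past_stateDev t j i)).add
    ((Finset.measurable_sum _ fun a _ => measurable_past_stateDev t a a).mul_const _)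

/-- The centred noise `ε² - σ²` is independent of the states and across times, so every product
containing it integrates to zero. -/
theorem IsGaussianModel.integral_covMean_mul (hSw : Sw.PosSemidef) (hA : rho A < 1) {s t : ℕ}
    (hst : s < t) (i j : Fin d) :
    ∫ ω, covMean A Sw σ β₀ w ε s i j ω * covMean A Sw σ β₀ w ε t i j ω ∂μ
      = ∫ ω, momentOp (stateDev A Sw β₀ w s ω) i j * momentOp (stateDev A Sw β₀ w t ω) i j ∂μ := by
  set F : ℕ → Ω → ℝ := fun t ω => momentOp (stateDev A Sw β₀ w t ω) i j with hF
  set e : ℕ → Ω → ℝ := fun t ω => ε t ω ^ 2 - (σ : ℝ) ^ 2 with he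
  set δ : ℝ := if i = j then 1 else 0 with hδ
  have hFp : ∀ t, AllLp (F t) μ := fun t => h.allLp_momentOp_stateDev hSw hA t i j
  have hep : ∀ t, AllLp (e t) μ := fun t => ((h.allLp_noise t).pow 2).sub (.const _)
  have hz : ∀ s t, ∫ ω, F s ω * e t ω ∂μ = 0 := by
    intro s t
    have hi : IndepFun (F s) (e t) μ :=
      h.indepFun_past_noise (measurable_past_momentOp_stateDev s i j)
        (g := fun z => z t ^ 2 - (σ : ℝ) ^ 2) (by fun_prop)
    rw [hi.integral_fun_mul_eq_mul_integral (hFp s).aestronglyMeasurable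
      (hep t).aestronglyMeasurable, h.integral_noise_sq_sub, mul_zero]
  have hz2 : ∫ ω, e s ω * e t ω ∂μ = 0 := by
    have hi : IndepFun (e s) (e t) μ := (h.indep_ε.indepFun hst.ne).comp
      (φ := fun z => z ^ 2 - (σ : ℝ) ^ 2) (ψ := fun z => z ^ 2 - (σ : ℝ) ^ 2)
      (by fun_prop) (by fun_prop)
    rw [hi.integral_fun_mul_eq_mul_integral (hep s).aestronglyMeasurable
      (hep t).aestronglyMeasurable, h.integral_noise_sq_sub t, mul_zero]
  have hexp : ∀ ω, covMean A Sw σ β₀ w ε s i j ω * covMean A Sw σ β₀ w ε t i j ω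
      = F s ω * F t ω + (δ * (F s ω * e t ω) + (δ * (F t ω * e s ω) + δ ^ 2 * (e s ω * e t ω))) := by
    intro ω
    simp only [covMean, hF, he, momentOp, Matrix.of_apply, ← hδ]
    ring
  simp_rw [hexp]
  have q1 := (hFp s).mul (hFp t)
  have q2 := ((hFp s).mul (hep t)).const_mul δ
  have q3 := ((hFp t).mul (hep s)).const_mul δ
  have q4 := ((hep s).mul (hep t)).const_mul (δ ^ 2)
  rw [integral_add q1.integrable (q2.add (q3.add q4)).integrable,
    integral_add q2.integrable (q3.add q4).integrable, integral_add q3.integrable q4.integrable,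
    integral_const_mul, integral_const_mul, integral_const_mul, hz, hz, hz2]
  simp only [mul_zero, add_zero, hF]

theorem IsGaussianModel.allLp_propagate (hSw : Sw.PosSemidef) (hA : rho A < 1) (t : ℕ)
    (M N : Matrix (Fin d) (Fin d) ℝ) (i j : Fin d) :
    AllLp (fun ω => (M * stateDev A Sw β₀ w t ω * N) i j) μ := by
  simp only [Matrix.mul_apply]
  exact .sum fun b _ => (AllLp.sum fun c _ =>
    (h.allLp_stateDev hSw hA t c b).const_mul _).mul (.const _)

theorem IsGaussianModel.integral_past_mul_momentOp (hSw : Sw.PosSemidef) (hA : rho A < 1) {s : ℕ}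
    {F : Ω → ℝ} (hF : Measurable[past β₀ w s] F) (hFp : AllLp F μ) (m : ℕ) (i j : Fin d) :
    ∫ ω, F ω * momentOp (stateDev A Sw β₀ w (s + m) ω) i j ∂μ
      = ∫ ω, F ω * momentOp (A ^ m * stateDev A Sw β₀ w s ω * (A ^ m)ᵀ) i j ∂μ := by
  have key : ∀ (G : Ω → Matrix (Fin d) (Fin d) ℝ), (∀ i j, AllLp (fun ω => G ω i j) μ) →
      ∫ ω, F ω * momentOp (G ω) i j ∂μ = ∫ ω, F ω * G ω i j ∂μ + ∫ ω, F ω * G ω j i ∂μ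
        + (∑ a, ∫ ω, F ω * G ω a a ∂μ) * (if i = j then 1 else 0) := by
    intro G hG
    have e : ∀ ω, F ω * momentOp (G ω) i j = (F ω * G ω i j + F ω * G ω j i)
        + (∑ a, F ω * G ω a a) * (if i = j then 1 else 0) := by
      intro ω
      simp only [momentOp, Matrix.of_apply, ← Finset.mul_sum]
      ring
    simp_rw [e]
    have q : ∀ i j, AllLp (fun ω => F ω * G ω i j) μ := fun i j => hFp.mul (hG i j)
    rw [integral_add ((q i j).add (q j i)).integrable
      ((AllLp.sum fun a _ => q a a).mul (.const _)).integrable,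
      integral_add (q i j).integrable (q j i).integrable, integral_mul_const,
      integral_finsetSum _ fun a _ => (q a a).integrable]
  rw [key _ (h.allLp_stateDev hSw hA _), key _ (h.allLp_propagate hSw hA s _ _)]
  simp only [h.integral_past_mul_stateDev hSw hA hF hFp m]

omit [IsProbabilityMeasure μ] h mΩ in
theorem sum_sq_mul_coord (u v : EuclideanSpace ℝ (Fin d)) (c : ℝ) :
    ∑ p : Fin d × Fin d, (c * (u p.1 * v p.2)) ^ 2 = c ^ 2 * (‖u‖ ^ 2 * ‖v‖ ^ 2) := by
  rw [EuclideanSpace.real_norm_sq_eq, EuclideanSpace.real_norm_sq_eq, Finset.sum_mul_sum,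
    ← Fintype.sum_prod_type' (f := fun i j => u i ^ 2 * v j ^ 2), Finset.mul_sum]
  exact Finset.sum_congr rfl fun p _ => by ring

/-- Each entry of `β βᵀ` is centred at its mean, which can only lower the second moment, and `‖β
βᵀ‖_F² = |β|⁴`. -/
theorem IsGaussianModel.integral_frobNorm_stateDev_sq_le (hSw : Sw.PosSemidef) (hA : rho A < 1)
    (t : ℕ) : ∫ ω, frobNorm (stateDev A Sw β₀ w t ω) ^ 2 ∂μ
      ≤ 3 * d ^ 2 * opNorm (stationaryCov A Sw) ^ 2 := by
  have hg := h.hasGaussianMarginals_state hSw hA t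
  have hS := (stationaryCov_spec hA hSw).1.1
  refine le_trans ?_ (h.integral_state_norm_pow_four_le hSw hA t)
  have e1 : ∀ ω, ‖state A β₀ w t ω‖ ^ 4
      = ∑ p : Fin d × Fin d, (state A β₀ w t ω p.1 * state A β₀ w t ω p.2) ^ 2 := by
    intro ω
    have := sum_sq_mul_coord (state A β₀ w t ω) (state A β₀ w t ω) 1
    simp only [one_mul, one_pow] at this
    rw [this]; ring
  simp_rw [e1, ← sum_frob_sq]
  have q := fun p : Fin d × Fin d => (hg.allLp p.1).mul (hg.allLp p.2)
  rw [integral_finsetSum _ fun p _ => ((h.allLp_stateDev hSw hA t p.1 p.2).pow 2).integrable,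
    integral_finsetSum _ fun p _ => ((q p).pow 2).integrable]
  exact Finset.sum_le_sum fun p _ => integral_sub_sq_le (q p)
    (hg.integral_coord_mul_coord hS p.1 p.2)

theorem IsGaussianModel.integral_state_succ_mul_state (hSw : Sw.PosSemidef) (hA : rho A < 1)
    (t : ℕ) (i j : Fin d) :
    ∫ ω, state A β₀ w (t + 1) ω i * state A β₀ w t ω j ∂μ = (A * stationaryCov A Sw) i j := by
  have hg := h.hasGaussianMarginals_state hSw hA
  have hS := (stationaryCov_spec hA hSw).1.1
  have h0 := h.integral_past_mul_crossDev hSw hA (s := t) (F := fun _ => 1) measurable_const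
    (.const 1) 0 i j
  simp only [one_mul, add_zero, zero_add, pow_one, pow_zero, Matrix.transpose_one,
    Matrix.mul_one] at h0
  have hz : ∫ ω, (A * stateDev A Sw β₀ w t ω) i j ∂μ = 0 := by
    simp only [Matrix.mul_apply]
    rw [integral_finsetSum _ fun a _ => ((h.allLp_stateDev hSw hA t a j).const_mul _).integrable]
    refine Finset.sum_eq_zero fun a _ => ?_
    rw [integral_const_mul]
    simp only [stateDev, Matrix.of_apply]
    rw [integral_sub (((hg t).allLp a).mul ((hg t).allLp j)).integrable (integrable_const _),
      (hg t).integral_coord_mul_coord hS]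
    simp
  rw [hz] at h0
  simp only [crossDev, Matrix.of_apply] at h0
  rw [integral_sub (((hg (t + 1)).allLp i).mul ((hg t).allLp j)).integrable
    (integrable_const _)] at h0
  simp only [integral_const, probReal_univ, one_smul] at h0
  linarith

theorem IsGaussianModel.integral_frobNorm_crossDev_sq_le (hSw : Sw.PosSemidef) (hA : rho A < 1)
    (t : ℕ) : ∫ ω, frobNorm (crossDev A Sw β₀ w t ω) ^ 2 ∂μ
      ≤ 3 * d ^ 2 * opNorm (stationaryCov A Sw) ^ 2 := by
  have hg := h.hasGaussianMarginals_state hSw hA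
  have q := fun p : Fin d × Fin d => ((hg (t + 1)).allLp p.1).mul ((hg t).allLp p.2)
  have h1 : ∫ ω, frobNorm (crossDev A Sw β₀ w t ω) ^ 2 ∂μ
      ≤ ∫ ω, ‖state A β₀ w (t + 1) ω‖ ^ 2 * ‖state A β₀ w t ω‖ ^ 2 ∂μ := by
    have e1 : ∀ ω, ‖state A β₀ w (t + 1) ω‖ ^ 2 * ‖state A β₀ w t ω‖ ^ 2
        = ∑ p : Fin d × Fin d, (state A β₀ w (t + 1) ω p.1 * state A β₀ w t ω p.2) ^ 2 := by
      intro ω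
      have := sum_sq_mul_coord (state A β₀ w (t + 1) ω) (state A β₀ w t ω) 1
      simp only [one_mul, one_pow] at this
      exact this.symm
    simp_rw [e1, ← sum_frob_sq]
    rw [integral_finsetSum _ fun p _ => ((h.allLp_crossDev hSw hA t p.1 p.2).pow 2).integrable,
      integral_finsetSum _ fun p _ => ((q p).pow 2).integrable]
    exact Finset.sum_le_sum fun p _ => integral_sub_sq_le (q p)
      (h.integral_state_succ_mul_state hSw hA t p.1 p.2)
  refine h1.trans ?_
  have i4 := fun t => (hg t).allLp_norm_pow_four
  calc ∫ ω, ‖state A β₀ w (t + 1) ω‖ ^ 2 * ‖state A β₀ w t ω‖ ^ 2 ∂μ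
      ≤ ∫ ω, 1 / 2 * (‖state A β₀ w (t + 1) ω‖ ^ 4 + ‖state A β₀ w t ω‖ ^ 4) ∂μ := by
        refine integral_mono ((hg (t + 1)).allLp_norm_sq.mul (hg t).allLp_norm_sq).integrable
          (((i4 (t + 1)).add (i4 t)).const_mul _).integrable fun ω => ?_
        simp only
        nlinarith [sq_nonneg (‖state A β₀ w (t + 1) ω‖ ^ 2 - ‖state A β₀ w t ω‖ ^ 2)]
    _ ≤ _ := by
        rw [integral_const_mul, integral_add (i4 (t + 1)).integrable (i4 t).integrable]
        linarith [h.integral_state_norm_pow_four_le hSw hA t,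
          h.integral_state_norm_pow_four_le hSw hA (t + 1)]

omit [IsProbabilityMeasure μ] h mΩ in
theorem frobNorm_propagate_le {γ : ℝ} (hγ : rho A < ENNReal.ofReal γ) (k m : ℕ)
    (M : Matrix (Fin d) (Fin d) ℝ) :
    frobNorm (A ^ k * M * (A ^ m)ᵀ) ≤ tau A γ ^ 2 * γ ^ (k + m) * frobNorm M := by
  have hγ0 : 0 < γ := ENNReal.ofReal_pos.1 (bot_le.trans_lt hγ)
  have hk := opNorm_pow_le_tau hγ k
  have hm := opNorm_pow_le_tau hγ m
  have h0 := opNorm_nonneg (A ^ k)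
  have h1 := opNorm_nonneg (A ^ m)
  calc frobNorm (A ^ k * M * (A ^ m)ᵀ) ≤ opNorm (A ^ k) * frobNorm M * opNorm (A ^ m) := by
        refine (frobNorm_mul_le_mul_opNorm _ _).trans ?_
        rw [opNorm_transpose]
        exact mul_le_mul_of_nonneg_right (frobNorm_mul_le_opNorm_mul _ _) h1
    _ ≤ (tau A γ * γ ^ k) * frobNorm M * (tau A γ * γ ^ m) := by
        have := frobNorm_nonneg M
        have := h0.trans hk
        gcongr
    _ = _ := by rw [pow_add]; ring

/-- Both averaged scores become functions of the same `D_s`, the later one through `A^(2+m)`. Two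
uses of the bound `3d` for `momentOp` and the moment `3d² ‖Σ_∞‖²` give the factor `27 d⁴`. -/
theorem IsGaussianModel.integral_cov_score_mul_le (hd : 0 < d) (hSw : Sw.PosSemidef)
    (hA : rho A < 1) {γ : ℝ} (hγ : rho A < ENNReal.ofReal γ) (hγ1 : γ < 1) (s m : ℕ) :
    ∫ ω, ∑ p : Fin d × Fin d, (covResid A Sw σ β₀ w x ε s ω * (x s ω p.1 * x s ω p.2))
        * (covResid A Sw σ β₀ w x ε (s + 2 + m) ω
          * (x (s + 2 + m) ω p.1 * x (s + 2 + m) ω p.2)) ∂μ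
      ≤ 27 * d ^ 4 * tau A γ ^ 2 * opNorm (stationaryCov A Sw) ^ 2 * (γ ^ 2) ^ m := by
  have hγ0 : 0 < γ := ENNReal.ofReal_pos.1 (bot_le.trans_lt hγ)
  have hx := fun t => (h.hasGaussianMarginals_x t).allLp
  have hU : ∀ t (p : Fin d × Fin d), AllLp (fun ω => covResid A Sw σ β₀ w x ε t ω
      * (x t ω p.1 * x t ω p.2)) μ := fun t p =>
    (h.allLp_covResid hSw hA t).mul ((hx t p.1).mul (hx t p.2))
  set Q : Ω → Matrix (Fin d) (Fin d) ℝ := fun ω =>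
    A ^ (2 + m) * stateDev A Sw β₀ w s ω * (A ^ (2 + m))ᵀ with hQ
  have hL := h.allLp_momentOp_stateDev hSw hA s
  have hQp : ∀ i j, AllLp (fun ω => momentOp (Q ω) i j) μ := fun i j =>
    ((h.allLp_propagate hSw hA s _ _ i j).add (h.allLp_propagate hSw hA s _ _ j i)).add
      ((AllLp.sum fun a _ => h.allLp_propagate hSw hA s _ _ a a).mul (.const _))
  have hD : AllLp (fun ω => frobNorm (stateDev A Sw β₀ w s ω) ^ 2) μ := by
    simp_rw [frobNorm_sq]
    exact .sum fun i _ => .sum fun j _ => (h.allLp_stateDev hSw hA s i j).pow 2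
  have e1 : ∀ p : Fin d × Fin d, ∫ ω, (covResid A Sw σ β₀ w x ε s ω * (x s ω p.1 * x s ω p.2))
        * (covResid A Sw σ β₀ w x ε (s + 2 + m) ω
          * (x (s + 2 + m) ω p.1 * x (s + 2 + m) ω p.2)) ∂μ
      = ∫ ω, momentOp (stateDev A Sw β₀ w s ω) p.1 p.2 * momentOp (Q ω) p.1 p.2 ∂μ := by
    intro p
    rw [h.integral_cov_decouple hSw hA (by omega), h.integral_covMean_mul hSw hA (by omega),
      add_assoc s, h.integral_past_mul_momentOp hSw hA
        (measurable_past_momentOp_stateDev s p.1 p.2) (hL p.1 p.2)]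
  rw [integral_finsetSum _ fun p _ => ((hU s p).mul (hU _ p)).integrable]
  simp_rw [e1]
  rw [← integral_finsetSum _ fun p _ => ((hL p.1 p.2).mul (hQp p.1 p.2)).integrable]
  calc ∫ ω, ∑ p : Fin d × Fin d, momentOp (stateDev A Sw β₀ w s ω) p.1 p.2
        * momentOp (Q ω) p.1 p.2 ∂μ
      ≤ ∫ ω, (9 * d ^ 2 * tau A γ ^ 2 * (γ ^ 2) ^ m) * frobNorm (stateDev A Sw β₀ w s ω) ^ 2 ∂μ := by
        refine integral_mono (AllLp.sum fun p _ => (hL p.1 p.2).mul (hQp p.1 p.2)).integrable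
          (hD.const_mul _).integrable fun ω => ?_
        simp only
        rw [Fintype.sum_prod_type]
        refine (le_abs_self _).trans ((abs_sum_mul_le_frobNorm _ _).trans ?_)
        have h1 := frobNorm_momentOp_le hd (stateDev A Sw β₀ w s ω)
        have h2 := frobNorm_momentOp_le hd (Q ω)
        have h3 := frobNorm_propagate_le hγ (2 + m) (2 + m) (stateDev A Sw β₀ w s ω)
        -- The surplus factor `γ⁴` from the gap of two is discarded.
        have h4 : γ ^ (2 + m + (2 + m)) ≤ (γ ^ 2) ^ m := by
          rw [← pow_mul]; exact pow_le_pow_of_le_one hγ0.le hγ1.le (by omega)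
        have h5 := frobNorm_nonneg (stateDev A Sw β₀ w s ω)
        have h6 := frobNorm_nonneg (Q ω)
        have h7 := frobNorm_nonneg (momentOp (Q ω))
        calc frobNorm (momentOp (stateDev A Sw β₀ w s ω)) * frobNorm (momentOp (Q ω))
            ≤ (3 * d * frobNorm (stateDev A Sw β₀ w s ω)) * (3 * d * frobNorm (Q ω)) := by gcongr
          _ ≤ (3 * d * frobNorm (stateDev A Sw β₀ w s ω)) * (3 * d * (tau A γ ^ 2
              * (γ ^ 2) ^ m * frobNorm (stateDev A Sw β₀ w s ω))) := by
              gcongr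
              refine h3.trans ?_
              gcongr
          _ = _ := by ring
    _ ≤ (9 * d ^ 2 * tau A γ ^ 2 * (γ ^ 2) ^ m)
        * (3 * d ^ 2 * opNorm (stationaryCov A Sw) ^ 2) := by
        rw [integral_const_mul]
        gcongr
        exact h.integral_frobNorm_stateDev_sq_le hSw hA s
    _ = _ := by ring

theorem IsGaussianModel.integral_cross_score_mul_le (hSw : Sw.PosSemidef)
    (hA : rho A < 1) {γ : ℝ} (hγ : rho A < ENNReal.ofReal γ) (hγ1 : γ < 1) (s m : ℕ) :
    ∫ ω, ∑ p : Fin d × Fin d, (crossResid A Sw β₀ w x ε s ω * (x (s + 1) ω p.1 * x s ω p.2))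
        * (crossResid A Sw β₀ w x ε (s + 2 + m) ω
          * (x (s + 2 + m + 1) ω p.1 * x (s + 2 + m) ω p.2)) ∂μ
      ≤ 3 * d ^ 2 * tau A γ ^ 2 * opNorm (stationaryCov A Sw) ^ 2 * (γ ^ 2) ^ m := by
  have hγ0 : 0 < γ := ENNReal.ofReal_pos.1 (bot_le.trans_lt hγ)
  have hx := fun t => (h.hasGaussianMarginals_x t).allLp
  have hU : ∀ t (p : Fin d × Fin d), AllLp (fun ω => crossResid A Sw β₀ w x ε t ω
      * (x (t + 1) ω p.1 * x t ω p.2)) μ := fun t p =>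
    (h.allLp_crossResid hSw hA t).mul ((hx (t + 1) p.1).mul (hx t p.2))
  -- The cross deviation at `s` already involves `β_{s+1}`, so propagation starts at `s + 1` and
  -- covers `1 + m` steps to reach `s + 2 + m`.
  set Q : Ω → Matrix (Fin d) (Fin d) ℝ := fun ω =>
    A ^ (1 + m + 1) * stateDev A Sw β₀ w (s + 1) ω * (A ^ (1 + m))ᵀ with hQ
  have hL := h.allLp_crossDev hSw hA s
  have hQp : ∀ i j, AllLp (fun ω => Q ω i j) μ := h.allLp_propagate hSw hA (s + 1) _ _
  have hD : AllLp (fun ω => frobNorm (stateDev A Sw β₀ w (s + 1) ω) ^ 2) μ := by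
    simp_rw [frobNorm_sq]
    exact .sum fun i _ => .sum fun j _ => (h.allLp_stateDev hSw hA (s + 1) i j).pow 2
  have hX : AllLp (fun ω => frobNorm (crossDev A Sw β₀ w s ω) ^ 2) μ := by
    simp_rw [frobNorm_sq]
    exact .sum fun i _ => .sum fun j _ => (h.allLp_crossDev hSw hA s i j).pow 2
  have e1 : ∀ p : Fin d × Fin d,
      ∫ ω, (crossResid A Sw β₀ w x ε s ω * (x (s + 1) ω p.1 * x s ω p.2))
        * (crossResid A Sw β₀ w x ε (s + 2 + m) ω
          * (x (s + 2 + m + 1) ω p.1 * x (s + 2 + m) ω p.2)) ∂μ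
      = ∫ ω, crossDev A Sw β₀ w s ω p.1 p.2 * Q ω p.1 p.2 ∂μ := by
    intro p
    rw [h.integral_cross_decouple hSw hA (by omega),
      show s + 2 + m = (s + 1) + (1 + m) by omega, h.integral_past_mul_crossDev hSw hA
        (measurable_past_crossDev s p.1 p.2) (hL p.1 p.2)]
  rw [integral_finsetSum _ fun p _ => ((hU s p).mul (hU _ p)).integrable]
  simp_rw [e1]
  rw [← integral_finsetSum _ fun p _ => ((hL p.1 p.2).mul (hQp p.1 p.2)).integrable]
  calc ∫ ω, ∑ p : Fin d × Fin d, crossDev A Sw β₀ w s ω p.1 p.2 * Q ω p.1 p.2 ∂μ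
      ≤ ∫ ω, (tau A γ ^ 2 * (γ ^ 2) ^ m / 2) * (frobNorm (crossDev A Sw β₀ w s ω) ^ 2
        + frobNorm (stateDev A Sw β₀ w (s + 1) ω) ^ 2) ∂μ := by
        refine integral_mono (AllLp.sum fun p _ => (hL p.1 p.2).mul (hQp p.1 p.2)).integrable
          ((hX.add hD).const_mul _).integrable fun ω => ?_
        simp only
        rw [Fintype.sum_prod_type]
        refine (le_abs_self _).trans ((abs_sum_mul_le_frobNorm _ _).trans ?_)
        have h3 := frobNorm_propagate_le hγ (1 + m + 1) (1 + m) (stateDev A Sw β₀ w (s + 1) ω)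
        have h4 : γ ^ (1 + m + 1 + (1 + m)) ≤ (γ ^ 2) ^ m := by
          rw [← pow_mul]; exact pow_le_pow_of_le_one hγ0.le hγ1.le (by omega)
        have h5 := frobNorm_nonneg (stateDev A Sw β₀ w (s + 1) ω)
        have h6 := frobNorm_nonneg (crossDev A Sw β₀ w s ω)
        have h7 : 0 ≤ tau A γ ^ 2 * (γ ^ 2) ^ m := by positivity
        calc frobNorm (crossDev A Sw β₀ w s ω) * frobNorm (Q ω)
            ≤ frobNorm (crossDev A Sw β₀ w s ω) * (tau A γ ^ 2 * (γ ^ 2) ^ m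
              * frobNorm (stateDev A Sw β₀ w (s + 1) ω)) := by
              gcongr
              refine h3.trans ?_
              gcongr
          _ = (tau A γ ^ 2 * (γ ^ 2) ^ m) * (frobNorm (crossDev A Sw β₀ w s ω)
              * frobNorm (stateDev A Sw β₀ w (s + 1) ω)) := by ring
          _ ≤ (tau A γ ^ 2 * (γ ^ 2) ^ m) * ((frobNorm (crossDev A Sw β₀ w s ω) ^ 2
              + frobNorm (stateDev A Sw β₀ w (s + 1) ω) ^ 2) / 2) := by
              refine mul_le_mul_of_nonneg_left ?_ h7
              linarith [two_mul_le_add_sq (frobNorm (crossDev A Sw β₀ w s ω))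
                (frobNorm (stateDev A Sw β₀ w (s + 1) ω))]
          _ = _ := by ring
    _ ≤ (tau A γ ^ 2 * (γ ^ 2) ^ m / 2) * (3 * d ^ 2 * opNorm (stationaryCov A Sw) ^ 2
        + 3 * d ^ 2 * opNorm (stationaryCov A Sw) ^ 2) := by
        rw [integral_const_mul, integral_add hX.integrable hD.integrable]
        gcongr
        · exact h.integral_frobNorm_crossDev_sq_le hSw hA s
        · exact h.integral_frobNorm_stateDev_sq_le hSw hA (s + 1)
    _ = _ := by ring

end Model

/-! ### Markov's inequality and deterministic least squares. -/

/-- Markov's inequality, with a measurable event on which the bound holds. -/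
theorem exists_measurableSet_le_div {Ω : Type*} [MeasurableSpace Ω] {μ : Measure Ω}
    [IsProbabilityMeasure μ] {Y : Ω → ℝ} (hY : Integrable Y μ) (h0 : ∀ ω, 0 ≤ Y ω) {B η : ℝ}
    (hB : ∫ ω, Y ω ∂μ ≤ B) (hη : 0 < η) :
    ∃ G : Set Ω, MeasurableSet G ∧ μ.real Gᶜ ≤ η ∧ ∀ ω ∈ G, Y ω ≤ B / η := by
  refine ⟨(toMeasurable μ {ω | B / η < Y ω})ᶜ, (measurableSet_toMeasurable _ _).compl, ?_,
    fun ω hω => ?_⟩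
  · rw [compl_compl, measureReal_def, measure_toMeasurable, ← measureReal_def]
    -- For `B = 0` Markov at level `B / η` says nothing; then `Y` vanishes almost everywhere and the
    -- strict exceedance set is null.
    rcases ((integral_nonneg h0).trans hB).eq_or_lt with hB0 | hB0
    · have h1 : ∫ ω, Y ω ∂μ = 0 := le_antisymm (hB0 ▸ hB) (integral_nonneg h0)
      have h2 := (integral_eq_zero_iff_of_nonneg h0 hY).1 h1
      have h3 : μ {ω | B / η < Y ω} = 0 := by
        refine measure_mono_null (fun ω hω => ?_) (ae_iff.1 h2)
        simp only [← hB0, zero_div, Set.mem_ofPred_eq] at hω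
        exact hω.ne'
      rw [measureReal_def, h3]
      exact hη.le
    · have h1 := mul_meas_ge_le_integral_of_nonneg (ae_of_all _ h0) hY (B / η)
      have h2 : μ.real {ω | B / η < Y ω} ≤ μ.real {ω | B / η ≤ Y ω} :=
        measureReal_mono fun ω hω => by
          simp only [Set.mem_ofPred_eq] at hω ⊢
          exact hω.le
      have h3 : B / η * μ.real {ω | B / η ≤ Y ω} ≤ B / η * η := by
        rw [div_mul_cancel₀ _ hη.ne']; exact h1.trans hB
      exact h2.trans (le_of_mul_le_mul_left h3 (by positivity))
  · by_contra hlt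
    exact hω (subset_toMeasurable _ _ (not_le.1 hlt))

/-- A least-squares minimizer exists over any subspace. -/
theorem exists_leastSquares {E : Type*} [AddCommGroup E] [Module ℝ E] (W : Submodule ℝ E) (T : ℕ)
    (b : ℕ → ℝ) (f : ℕ → E →ₗ[ℝ] ℝ) :
    ∃ v ∈ W, ∀ u ∈ W, ∑ t ∈ Finset.range T, (b t - f t v) ^ 2
      ≤ ∑ t ∈ Finset.range T, (b t - f t u) ^ 2 := by
  let F : E →ₗ[ℝ] EuclideanSpace ℝ (Fin T) :=
    (WithLp.linearEquiv 2 ℝ (Fin T → ℝ)).symm.toLinearMap ∘ₗ LinearMap.pi fun t => f t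
  let y : EuclideanSpace ℝ (Fin T) := WithLp.toLp 2 fun t => b t
  have hF : ∀ v, ∑ t ∈ Finset.range T, (b t - f t v) ^ 2 = dist y (F v) ^ 2 := by
    intro v
    rw [dist_eq_norm, EuclideanSpace.real_norm_sq_eq,
      ← Fin.sum_univ_eq_sum_range (fun t => (b t - f t v) ^ 2) T]
    rfl
  -- The loss depends on `v` only through its `T` predictions, which range over a subspace of `ℝ^T`.
  -- This subspace is closed, so it contains a point nearest to the data, without any rank condition
  -- on the design.
  obtain ⟨z, hz, hd⟩ := (Submodule.closed_of_finiteDimensional (W.map F)).exists_infDist_eq_dist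
    ⟨0, zero_mem _⟩ y
  obtain ⟨v, hv, rfl⟩ := hz
  refine ⟨v, hv, fun u hu => ?_⟩
  rw [hF, hF, ← hd]
  exact pow_le_pow_left₀ Metric.infDist_nonneg
    (Metric.infDist_le_dist_of_mem (Submodule.mem_map_of_mem hu)) 2

/-- The basic inequality of least squares: if the design is bounded below and the score at the truth
is small, then any parameter with a smaller loss is close to the truth. -/
theorem sq_mul_sum_sq_le_of_loss_le {ι : Type*} [Fintype ι] (T : ℕ) {φ : ℕ → ι → ℝ} {r : ℕ → ℝ}
    {v : ι → ℝ} {c B : ℝ} (hc : 0 ≤ c)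
    (hdesign : c * ∑ i, v i ^ 2 ≤ ∑ t ∈ Finset.range T, (∑ i, v i * φ t i) ^ 2)
    (hloss : ∑ t ∈ Finset.range T, (r t - ∑ i, v i * φ t i) ^ 2 ≤ ∑ t ∈ Finset.range T, r t ^ 2)
    (hscore : ∑ i, (∑ t ∈ Finset.range T, r t * φ t i) ^ 2 ≤ B) :
    c ^ 2 * ∑ i, v i ^ 2 ≤ 4 * B := by
  set D := ∑ i, v i ^ 2 with hD
  set S := ∑ i, v i * ∑ t ∈ Finset.range T, r t * φ t i with hS
  have hD0 : 0 ≤ D := Finset.sum_nonneg fun i _ => sq_nonneg _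
  have hB0 : 0 ≤ B := le_trans (Finset.sum_nonneg fun i _ => sq_nonneg _) hscore
  have e : ∑ t ∈ Finset.range T, (r t - ∑ i, v i * φ t i) ^ 2
      = ∑ t ∈ Finset.range T, r t ^ 2 - 2 * S
        + ∑ t ∈ Finset.range T, (∑ i, v i * φ t i) ^ 2 := by
    have e1 : S = ∑ t ∈ Finset.range T, r t * ∑ i, v i * φ t i := by
      simp only [hS, Finset.mul_sum]
      rw [Finset.sum_comm]
      exact Finset.sum_congr rfl fun t _ => Finset.sum_congr rfl fun i _ => by ring
    rw [e1, Finset.mul_sum, ← Finset.sum_sub_distrib, ← Finset.sum_add_distrib]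
    exact Finset.sum_congr rfl fun t _ => by ring
  have h1 : c * D ≤ 2 * S := by linarith
  -- Cauchy–Schwarz against the score. Squaring `c D ≤ 2S` gives `c² D² ≤ 4 D B`, and one factor `D`
  -- cancels unless it is zero.
  have h2 : S ^ 2 ≤ D * B :=
    (Finset.sum_mul_sq_le_sq_mul_sq _ _ _).trans (mul_le_mul_of_nonneg_left hscore hD0)
  rcases hD0.eq_or_lt with h0 | h0
  · rw [← h0]; linarith
  · have h3 : (c * D) ^ 2 ≤ (2 * S) ^ 2 := pow_le_pow_left₀ (by positivity) h1 2
    refine le_of_mul_le_mul_right ?_ h0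
    linarith

/-- The linear functional `M ↦ uᵀ M v`. -/
def bilinForm {d : ℕ} (u v : Fin d → ℝ) : Matrix (Fin d) (Fin d) ℝ →ₗ[ℝ] ℝ where
  toFun M := u ⬝ᵥ M *ᵥ v
  map_add' M N := by rw [Matrix.add_mulVec, dotProduct_add]
  map_smul' a M := by rw [Matrix.smul_mulVec, dotProduct_smul]; rfl

theorem exists_isCovEstimate {d : ℕ} (T : ℕ) (σ : ℝ≥0) (x : ℕ → EuclideanSpace ℝ (Fin d))
    (y : ℕ → ℝ) : ∃ S, IsCovEstimate T σ x y S := by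
  let W : Submodule ℝ (Matrix (Fin d) (Fin d) ℝ) :=
    { carrier := {M | M.IsSymm}
      add_mem' := fun hM hN => hM.add hN
      zero_mem' := Matrix.isSymm_zero
      smul_mem' := fun c _ hM => hM.smul c }
  obtain ⟨S, hS, hmin⟩ := exists_leastSquares W T (fun t => y t ^ 2 - (σ : ℝ) ^ 2)
    fun t => bilinForm (x t).ofLp (x t).ofLp
  refine ⟨S, hS, fun M hM => ?_⟩
  have e : ∀ M, covLoss T σ x y M = ∑ t ∈ Finset.range T,
      (y t ^ 2 - (σ : ℝ) ^ 2 - bilinForm (x t).ofLp (x t).ofLp M) ^ 2 := fun M =>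
    Finset.sum_congr rfl fun t _ => by rw [sub_right_comm]; rfl
  rw [e, e]
  exact hmin M hM

theorem exists_isCrossEstimate {d : ℕ} (T : ℕ) (x : ℕ → EuclideanSpace ℝ (Fin d))
    (y : ℕ → ℝ) : ∃ N, IsCrossEstimate T x y N := by
  obtain ⟨S, -, hmin⟩ := exists_leastSquares ⊤ T (fun t => y t * y (t + 1))
    fun t => bilinForm (x (t + 1)).ofLp (x t).ofLp
  exact ⟨S, fun M => hmin M Submodule.mem_top⟩

section Model

variable {d : ℕ} {Ω : Type*}
  {A Sw : Matrix (Fin d) (Fin d) ℝ} {σ : ℝ≥0}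
  {β₀ : Ω → EuclideanSpace ℝ (Fin d)} {w x : ℕ → Ω → EuclideanSpace ℝ (Fin d)} {ε : ℕ → Ω → ℝ}

theorem frobNorm_sq_le_of_isCovEstimate {T : ℕ} {ω : Ω} {c B : ℝ} (hc : 0 ≤ c)
    (hsymm : (stationaryCov A Sw).IsSymm)
    (hdesign : ∀ M : Matrix (Fin d) (Fin d) ℝ, M.IsSymm → c * frobNorm M ^ 2
      ≤ ∑ t ∈ Finset.range T, ((x t ω).ofLp ⬝ᵥ M *ᵥ (x t ω).ofLp) ^ 2)
    (hscore : ∑ p : Fin d × Fin d, (∑ t ∈ Finset.range T,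
      covResid A Sw σ β₀ w x ε t ω * (x t ω p.1 * x t ω p.2)) ^ 2 ≤ B)
    {S : Matrix (Fin d) (Fin d) ℝ}
    (hS : IsCovEstimate T σ (fun t => x t ω) (fun t => obs A β₀ w x ε t ω) S) :
    c ^ 2 * frobNorm (S - stationaryCov A Sw) ^ 2 ≤ 4 * B := by
  rw [← sum_frob_sq]
  refine sq_mul_sum_sq_le_of_loss_le T (ι := Fin d × Fin d) (φ := fun t p => x t ω p.1 * x t ω p.2)
    (r := fun t => covResid A Sw σ β₀ w x ε t ω)
    (v := fun p => (S - stationaryCov A Sw) p.1 p.2) hc ?_ ?_ hscore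
  · have h := hdesign _ (hS.1.sub hsymm)
    rw [← sum_frob_sq] at h
    simpa only [dotProduct_mulVec_eq_sum] using h
  · have h := hS.2 _ hsymm
    simp only [← dotProduct_mulVec_eq_sum (S - stationaryCov A Sw)]
    refine le_trans (le_of_eq ?_) h
    refine Finset.sum_congr rfl fun t _ => ?_
    rw [covResid, Matrix.sub_mulVec, dotProduct_sub]
    ring

theorem frobNorm_sq_le_of_isCrossEstimate {T : ℕ} {ω : Ω} {c B : ℝ} (hc : 0 ≤ c)
    (hdesign : ∀ M : Matrix (Fin d) (Fin d) ℝ, c * frobNorm M ^ 2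
      ≤ ∑ t ∈ Finset.range T, ((x (t + 1) ω).ofLp ⬝ᵥ M *ᵥ (x t ω).ofLp) ^ 2)
    (hscore : ∑ p : Fin d × Fin d, (∑ t ∈ Finset.range T,
      crossResid A Sw β₀ w x ε t ω * (x (t + 1) ω p.1 * x t ω p.2)) ^ 2 ≤ B)
    {N : Matrix (Fin d) (Fin d) ℝ}
    (hN : IsCrossEstimate T (fun t => x t ω) (fun t => obs A β₀ w x ε t ω) N) :
    c ^ 2 * frobNorm (N - A * stationaryCov A Sw) ^ 2 ≤ 4 * B := by
  rw [← sum_frob_sq]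
  refine sq_mul_sum_sq_le_of_loss_le T (ι := Fin d × Fin d) (φ := fun t p => x (t + 1) ω p.1 * x t ω p.2)
    (r := fun t => crossResid A Sw β₀ w x ε t ω)
    (v := fun p => (N - A * stationaryCov A Sw) p.1 p.2) hc ?_ ?_ hscore
  · have h := hdesign (N - A * stationaryCov A Sw)
    rw [← sum_frob_sq] at h
    simpa only [dotProduct_mulVec_eq_sum] using h
  · have h := hN (A * stationaryCov A Sw)
    simp only [← dotProduct_mulVec_eq_sum (N - A * stationaryCov A Sw)]
    refine le_trans (le_of_eq ?_) h
    refine Finset.sum_congr rfl fun t _ => ?_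
    rw [crossResid, Matrix.sub_mulVec, dotProduct_sub]
    ring

variable [MeasurableSpace Ω] {μ : Measure Ω} [IsProbabilityMeasure μ]
  (h : IsGaussianModel μ A Sw σ β₀ w x ε)
include h

/-! ### Second moments of the summed scores. -/

/-- The geometric sum with ratio `γ²` creates `q = τ²/(1-γ²)`; since `q ≥ 1`, the diagonal part is
absorbed as well, and `3·7884 + 2·27 ≤ 24000`. -/
theorem IsGaussianModel.integral_sq_sum_cov_score_le (hd : 0 < d) (hSw : Sw.PosSemidef)
    (hA : rho A < 1) {γ : ℝ} (hγ : rho A < ENNReal.ofReal γ) (hγ1 : γ < 1) (T : ℕ) :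
    ∫ ω, ∑ p : Fin d × Fin d, (∑ t ∈ Finset.range T,
        covResid A Sw σ β₀ w x ε t ω * (x t ω p.1 * x t ω p.2)) ^ 2 ∂μ
      ≤ T * (24000 * d ^ 2 * (σ ^ 4
        + tau A γ ^ 2 / (1 - γ ^ 2) * opNorm (stationaryCov A Sw) ^ 2 * d ^ 2)) := by
  have hγ0 : 0 < γ := ENNReal.ofReal_pos.1 (bot_le.trans_lt hγ)
  have hγ2 : γ ^ 2 < 1 := pow_lt_one₀ hγ0.le hγ1 two_ne_zero
  have hτ := one_le_tau hd hγ
  have hx := fun t => (h.hasGaussianMarginals_x t).allLp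
  refine (integral_sq_sum_le
    (U := fun t (p : Fin d × Fin d) ω => covResid A Sw σ β₀ w x ε t ω * (x t ω p.1 * x t ω p.2))
    (fun t p => (h.allLp_covResid hSw hA t).mul ((hx t p.1).mul (hx t p.2)))
    (B₀ := 7884 * d ^ 2 * (σ ^ 4 + d ^ 2 * opNorm (stationaryCov A Sw) ^ 2))
    (B₁ := 27 * d ^ 4 * tau A γ ^ 2 * opNorm (stationaryCov A Sw) ^ 2) (by positivity)
    (sq_nonneg γ) hγ2 ?_ (h.integral_cov_score_mul_le hd hSw hA hγ hγ1) T).trans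
    (mul_le_mul_of_nonneg_left ?_ (Nat.cast_nonneg T))
  · refine fun t => le_trans (le_of_eq ?_) (h.integral_covResid_sq_mul_le hd hSw hA t)
    simp only [sum_sq_mul_coord]
    exact integral_congr_ae (ae_of_all _ fun ω => by simp only; ring)
  · set q := tau A γ ^ 2 / (1 - γ ^ 2) with hq
    have hq1 : 1 ≤ q := by
      rw [hq, le_div_iff₀ (by linarith)]
      nlinarith [sq_nonneg γ]
    set s := opNorm (stationaryCov A Sw)
    have e : 27 * (d : ℝ) ^ 4 * tau A γ ^ 2 * s ^ 2 / (1 - γ ^ 2) = 27 * d ^ 4 * q * s ^ 2 := by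
      rw [hq]; ring
    rw [e]
    have h1 : (d : ℝ) ^ 4 * s ^ 2 ≤ d ^ 4 * s ^ 2 * q := le_mul_of_one_le_right (by positivity) hq1
    have h2 : 0 ≤ (d : ℝ) ^ 2 * (σ : ℝ) ^ 4 := by positivity
    have h3 : 0 ≤ (d : ℝ) ^ 4 * s ^ 2 := by positivity
    linarith

/-- The additional diagonal term is handled by `‖A Σ_∞‖ ≤ τ γ ‖Σ_∞‖` and `τ² ≤ q`, so the second
power of `τ` suffices here too. -/
theorem IsGaussianModel.integral_sq_sum_cross_score_le (hd : 0 < d) (hSw : Sw.PosSemidef)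
    (hA : rho A < 1) {γ : ℝ} (hγ : rho A < ENNReal.ofReal γ) (hγ1 : γ < 1) (T : ℕ) :
    ∫ ω, ∑ p : Fin d × Fin d, (∑ t ∈ Finset.range T,
        crossResid A Sw β₀ w x ε t ω * (x (t + 1) ω p.1 * x t ω p.2)) ^ 2 ∂μ
      ≤ T * (24000 * d ^ 2 * (σ ^ 4
        + tau A γ ^ 2 / (1 - γ ^ 2) * opNorm (stationaryCov A Sw) ^ 2 * d ^ 2)) := by
  have hγ0 : 0 < γ := ENNReal.ofReal_pos.1 (bot_le.trans_lt hγ)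
  have hγ2 : γ ^ 2 < 1 := pow_lt_one₀ hγ0.le hγ1 two_ne_zero
  have hτ := one_le_tau hd hγ
  have hd1 : (1 : ℝ) ≤ d := by exact_mod_cast hd
  have hx := fun t => (h.hasGaussianMarginals_x t).allLp
  refine (integral_sq_sum_le
    (U := fun t (p : Fin d × Fin d) ω =>
      crossResid A Sw β₀ w x ε t ω * (x (t + 1) ω p.1 * x t ω p.2))
    (fun t p => (h.allLp_crossResid hSw hA t).mul ((hx (t + 1) p.1).mul (hx t p.2)))
    (B₀ := 5040 * d ^ 2 * (σ ^ 4 + d ^ 2 * opNorm (stationaryCov A Sw) ^ 2)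
      + 210 * d ^ 4 * opNorm (A * stationaryCov A Sw) ^ 2)
    (B₁ := 3 * d ^ 2 * tau A γ ^ 2 * opNorm (stationaryCov A Sw) ^ 2) (by positivity)
    (sq_nonneg γ) hγ2 ?_ (h.integral_cross_score_mul_le hSw hA hγ hγ1) T).trans
    (mul_le_mul_of_nonneg_left ?_ (Nat.cast_nonneg T))
  · refine fun t => le_trans (le_of_eq ?_) (h.integral_crossResid_sq_mul_le hd hSw hA t)
    simp only [sum_sq_mul_coord]
    exact integral_congr_ae (ae_of_all _ fun ω => by simp only; ring)
  · have hAS : opNorm (A * stationaryCov A Sw) ≤ tau A γ * opNorm (stationaryCov A Sw) := by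
      refine (opNorm_mul_le _ _).trans (mul_le_mul_of_nonneg_right ?_ (opNorm_nonneg _))
      have := opNorm_pow_le_tau hγ 1
      rw [pow_one, pow_one] at this
      exact this.trans (mul_le_of_le_one_right (by linarith) hγ1.le)
    have hAS2 := pow_le_pow_left₀ (opNorm_nonneg _) hAS 2
    rw [mul_pow] at hAS2
    set q := tau A γ ^ 2 / (1 - γ ^ 2) with hq
    have hτq : tau A γ ^ 2 ≤ q := by
      rw [hq, le_div_iff₀ (by linarith)]
      exact mul_le_of_le_one_right (by positivity) (by nlinarith)
    have hq1 : 1 ≤ q := (one_le_pow₀ hτ).trans hτq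
    set s := opNorm (stationaryCov A Sw)
    have e : 3 * (d : ℝ) ^ 2 * tau A γ ^ 2 * s ^ 2 / (1 - γ ^ 2) = 3 * d ^ 2 * q * s ^ 2 := by
      rw [hq]; ring
    rw [e]
    have h0 := hAS2.trans (mul_le_mul_of_nonneg_right hτq (sq_nonneg s))
    have h1 : (d : ℝ) ^ 4 * s ^ 2 ≤ d ^ 4 * s ^ 2 * q := le_mul_of_one_le_right (by positivity) hq1
    have h2 : 0 ≤ (d : ℝ) ^ 2 * (σ : ℝ) ^ 4 := by positivity
    have h3 : 0 ≤ (d : ℝ) ^ 4 * s ^ 2 := by positivity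
    have h4 : (d : ℝ) ^ 4 * opNorm (A * stationaryCov A Sw) ^ 2 ≤ d ^ 4 * (q * s ^ 2) :=
      mul_le_mul_of_nonneg_left h0 (by positivity)
    have h5 : (d : ℝ) ^ 2 * (q * s ^ 2) ≤ d ^ 4 * (q * s ^ 2) :=
      mul_le_mul_of_nonneg_right (pow_le_pow_right₀ hd1 (by norm_num)) (by positivity)
    linarith

end Model

/-! ### Choice of constants and conclusion. -/

theorem one_le_log_sampleSize {d : ℕ} (hd : 0 < d) {δ : ℝ} (hδ0 : 0 < δ) (hδ1 : δ < 1) :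
    1 ≤ Real.log (10 ^ 10 * (d : ℝ) ^ 2 / δ) := by
  have hd1 : (1 : ℝ) ≤ (d : ℝ) ^ 2 := one_le_pow₀ (by exact_mod_cast hd)
  rw [Real.le_log_iff_exp_le (by positivity), le_div_iff₀ hδ0]
  nlinarith [Real.exp_one_lt_d9, Real.exp_pos 1]

/-- The required exponent is `log(8d⁴/δ)`. As `8d⁴/δ ≤ (10¹⁰d²/δ)²`, it is at most twice the
logarithm in the sample size, and `10¹⁰/(3·430080)` exceeds 2. -/
theorem designFailure_le {d N T : ℕ} (hd : 0 < d) {δ : ℝ} (hδ0 : 0 < δ) (hδ1 : δ < 1)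
    (hT : 10 ^ 10 * (d : ℝ) ^ 4 * Real.log (10 ^ 10 * (d : ℝ) ^ 2 / δ) ≤ T)
    (hN : (T : ℝ) / 3 ≤ N) :
    2 * (d : ℝ) ^ 4 * Real.exp (-(N / (430080 * d ^ 4))) ≤ δ / 4 := by
  have hd0 : (0 : ℝ) < d := by exact_mod_cast hd
  have hd1 : (1 : ℝ) ≤ (d : ℝ) ^ 4 := one_le_pow₀ (by exact_mod_cast hd)
  have hL := one_le_log_sampleSize hd hδ0 hδ1
  set L := Real.log (10 ^ 10 * (d : ℝ) ^ 2 / δ) with hLdef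
  have h1 : Real.log (8 * d ^ 4 / δ) ≤ 2 * L := by
    rw [hLdef, ← Real.log_rpow (by positivity)]
    refine Real.log_le_log (by positivity) ?_
    rw [Real.rpow_two, div_pow, div_le_div_iff₀ hδ0 (by positivity)]
    have : 8 * (d : ℝ) ^ 4 * δ * δ ≤ (10 ^ 10) ^ 2 * d ^ 4 * 1 * δ := by gcongr; norm_num
    linarith
  have h2 : 2 * L ≤ N / (430080 * d ^ 4) := by
    rw [le_div_iff₀ (by positivity)]
    have : 0 ≤ (d : ℝ) ^ 4 * L := by positivity
    linarith
  have h3 : Real.exp (-(N / (430080 * d ^ 4))) ≤ Real.exp (-Real.log (8 * d ^ 4 / δ)) :=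
    Real.exp_le_exp.2 (neg_le_neg (h1.trans h2))
  rw [Real.exp_neg (Real.log _), Real.exp_log (by positivity)] at h3
  calc 2 * (d : ℝ) ^ 4 * Real.exp (-(N / (430080 * d ^ 4)))
      ≤ 2 * (d : ℝ) ^ 4 * (8 * d ^ 4 / δ)⁻¹ := by gcongr
    _ = δ / 4 := by field_simp; norm_num

theorem sum_range_two_mul_add_one_le {f : ℕ → ℝ} (hf : ∀ t, 0 ≤ f t) (T : ℕ) :
    ∑ n ∈ Finset.range (T / 2), f (2 * n) ≤ ∑ t ∈ Finset.range T, f t := by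
  rw [← Finset.sum_image (g := fun n => 2 * n) (f := f) fun a _ b _ hab => by
    simpa using hab]
  refine Finset.sum_le_sum_of_subset_of_nonneg (fun t ht => ?_) fun t _ _ => hf t
  obtain ⟨n, hn, rfl⟩ := Finset.mem_image.1 ht
  rw [Finset.mem_range] at hn ⊢
  omega

/-- Solving for `e²` gives the constant `16·96²·24000 = 3538944000 < 10¹⁰`. The slack in the power
of `τ` and in the logarithm is given away here. -/
theorem le_errorBound {d : ℕ} {A Sw : Matrix (Fin d) (Fin d) ℝ} {σ : ℝ≥0} {γ δ : ℝ} {T p : ℕ}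
    (hτ : 1 ≤ tau A γ) (hγ : γ ^ 2 < 1) (hδ : 0 < δ) (hT : 0 < T) (hp : 2 ≤ p) {e : ℝ}
    (he : (T / 96 : ℝ) ^ 2 * e ^ 2 ≤ 4 * (T * (24000 * d ^ 2 * (σ ^ 4
      + tau A γ ^ 2 / (1 - γ ^ 2) * opNorm (stationaryCov A Sw) ^ 2 * d ^ 2)) / (δ / 4))) :
    e ≤ errorBound (10 ^ 10) p A Sw σ γ δ T := by
  refine Real.le_sqrt_of_sq_le ?_
  have hT' : (0 : ℝ) < T := by exact_mod_cast hT
  have h1γ : 0 < 1 - γ ^ 2 := by linarith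
  set s := opNorm (stationaryCov A Sw)
  set K := (σ : ℝ) ^ 4 + tau A γ ^ 2 / (1 - γ ^ 2) * s ^ 2 * d ^ 2 with hK
  have hK0 : 0 ≤ K := by positivity
  have h1 : e ^ 2 ≤ 3538944000 * (d : ℝ) ^ 2 / (T * δ) * K := by
    have h2 : (T / 96 : ℝ) ^ 2 * (3538944000 * (d : ℝ) ^ 2 / (T * δ) * K)
        = 4 * (T * (24000 * d ^ 2 * K) / (δ / 4)) := by
      field_simp; ring
    rw [← h2] at he
    exact le_of_mul_le_mul_left he (by positivity)
  refine h1.trans ?_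
  have h3 : tau A γ ^ 2 / (1 - γ ^ 2) ≤ tau A γ ^ p / (1 - γ ^ 2) :=
    div_le_div_of_nonneg_right (pow_le_pow_right₀ hτ hp) h1γ.le
  have h4 : K ≤ (σ : ℝ) ^ 4 + tau A γ ^ p / (1 - γ ^ 2) * s ^ 2
      * ((d : ℝ) ^ 2 + Real.log (2 * T / δ) ^ 2) := by
    rw [hK]
    gcongr
    linarith [sq_nonneg (Real.log (2 * T / δ))]
  gcongr
  norm_num

theorem measureReal_inter_four_ge {Ω : Type*} [MeasurableSpace Ω] {μ : Measure Ω}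
    [IsProbabilityMeasure μ] {G₁ G₂ G₃ G₄ : Set Ω} (h₁ : MeasurableSet G₁) (h₂ : MeasurableSet G₂)
    (h₃ : MeasurableSet G₃) (h₄ : MeasurableSet G₄) {δ : ℝ} (p₁ : μ.real G₁ᶜ ≤ δ / 4)
    (p₂ : μ.real G₂ᶜ ≤ δ / 4) (p₃ : μ.real G₃ᶜ ≤ δ / 4) (p₄ : μ.real G₄ᶜ ≤ δ / 4) :
    1 - δ ≤ μ.real (G₁ ∩ G₂ ∩ (G₃ ∩ G₄)) := by
  have h := measureReal_compl (μ := μ) ((h₁.inter h₂).inter (h₃.inter h₄))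
  rw [Set.compl_inter, Set.compl_inter, Set.compl_inter, probReal_univ] at h
  have u := measureReal_union_le (μ := μ) (G₁ᶜ ∪ G₂ᶜ) (G₃ᶜ ∪ G₄ᶜ)
  have u₁ := measureReal_union_le (μ := μ) G₁ᶜ G₂ᶜ
  have u₂ := measureReal_union_le (μ := μ) G₃ᶜ G₄ᶜ
  linarith

/-- Four events, each failing with probability at most `δ/4`: the two design bounds and Markov's
inequality for the two scores. -/
theorem IsGaussianModel.exists_event {d : ℕ} {Ω : Type*} [MeasurableSpace Ω] {μ : Measure Ω}
    [IsProbabilityMeasure μ] {A Sw : Matrix (Fin d) (Fin d) ℝ} {σ : ℝ≥0}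
    {β₀ : Ω → EuclideanSpace ℝ (Fin d)} {w x : ℕ → Ω → EuclideanSpace ℝ (Fin d)} {ε : ℕ → Ω → ℝ}
    (h : IsGaussianModel μ A Sw σ β₀ w x ε) (hSw : Sw.PosSemidef) (hA : rho A < 1) {γ : ℝ}
    (hγ : rho A < ENNReal.ofReal γ) (hγ1 : γ < 1) {δ : ℝ} {T : ℕ} (hδ0 : 0 < δ) (hδ1 : δ < 1)
    (hT : 10 ^ 10 * (d : ℝ) ^ 4 * Real.log (10 ^ 10 * (d : ℝ) ^ 2 / δ) ≤ T) :
    ∃ G : Set Ω, MeasurableSet G ∧ 1 - δ ≤ μ.real G ∧ ∀ ω ∈ G,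
      (∀ S, IsCovEstimate T σ (fun t => x t ω) (fun t => obs A β₀ w x ε t ω) S →
        frobNorm (S - stationaryCov A Sw) ≤ errorBound (10 ^ 10) 2 A Sw σ γ δ T) ∧
      (∀ N, IsCrossEstimate T (fun t => x t ω) (fun t => obs A β₀ w x ε t ω) N →
        frobNorm (N - A * stationaryCov A Sw) ≤ errorBound (10 ^ 10) 3 A Sw σ γ δ T) := by
  rcases Nat.eq_zero_or_pos d with rfl | hd
  -- In dimension zero the sample-size condition reads `0 ≤ T` and `1 ≤ τ` fails, but all errors
  -- vanish.
  · have h0 : ∀ M : Matrix (Fin 0) (Fin 0) ℝ, frobNorm M = 0 := fun M => by simp [frobNorm]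
    refine ⟨Set.univ, .univ, by simpa using hδ0.le, fun ω _ => ⟨fun S _ => ?_, fun N _ => ?_⟩⟩ <;>
    · rw [h0]; exact Real.sqrt_nonneg _
  have hγ0 : 0 < γ := ENNReal.ofReal_pos.1 (bot_le.trans_lt hγ)
  have hγ2 : γ ^ 2 < 1 := pow_lt_one₀ hγ0.le hγ1 two_ne_zero
  have hτ := one_le_tau hd hγ
  have hT1 : (6 : ℝ) ≤ T := by
    have h1 := one_le_log_sampleSize hd hδ0 hδ1
    have h2 : (1 : ℝ) ≤ (d : ℝ) ^ 4 := one_le_pow₀ (by exact_mod_cast hd)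
    nlinarith
  have hT6 : 6 ≤ T := by exact_mod_cast hT1
  -- Natural division counts the disjoint pairs. Together with the factor `1/32` this gives the
  -- curvature `T/96`, used for both designs.
  have hhalf : (T : ℝ) / 3 ≤ (T / 2 : ℕ) := by
    have : T ≤ 3 * (T / 2) := by omega
    have : (T : ℝ) ≤ 3 * (T / 2 : ℕ) := by exact_mod_cast this
    linarith
  have hl : ∀ t, HasLaw (x t) (stdGaussian (EuclideanSpace ℝ (Fin d))) μ := fun t => by
    rw [← multivariateGaussian_zero_one]; exact h.law_x t
  have hx := fun t => (h.hasGaussianMarginals_x t).allLp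
  obtain ⟨G₁, m₁, p₁, b₁⟩ := exists_cov_design_lower_bound hd h.indep_x h.measurable_x hl T
  obtain ⟨G₂, m₂, p₂, b₂⟩ := exists_cross_design_lower_bound hd h.indep_x h.measurable_x hl (T / 2)
  obtain ⟨G₃, m₃, p₃, b₃⟩ := exists_measurableSet_le_div
    (AllLp.sum (s := Finset.univ) fun p _ => (AllLp.sum (s := Finset.range T) fun t _ =>
      (h.allLp_covResid hSw hA t).mul ((hx t p.1).mul (hx t p.2))).pow 2).integrable
    (fun ω => by positivity) (h.integral_sq_sum_cov_score_le hd hSw hA hγ hγ1 T)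
    (show 0 < δ / 4 by positivity)
  obtain ⟨G₄, m₄, p₄, b₄⟩ := exists_measurableSet_le_div
    (AllLp.sum (s := Finset.univ) fun p _ => (AllLp.sum (s := Finset.range T) fun t _ =>
      (h.allLp_crossResid hSw hA t).mul ((hx (t + 1) p.1).mul (hx t p.2))).pow 2).integrable
    (fun ω => by positivity) (h.integral_sq_sum_cross_score_le hd hSw hA hγ hγ1 T)
    (show 0 < δ / 4 by positivity)
  refine ⟨G₁ ∩ G₂ ∩ (G₃ ∩ G₄), (m₁.inter m₂).inter (m₃.inter m₄),
    measureReal_inter_four_ge m₁ m₂ m₃ m₄ (p₁.trans (designFailure_le hd hδ0 hδ1 hT (by linarith)))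
      (p₂.trans (designFailure_le hd hδ0 hδ1 hT hhalf)) p₃ p₄, ?_⟩
  rintro ω ⟨⟨g₁, g₂⟩, g₃, g₄⟩
  refine ⟨fun S hS => ?_, fun N hN => ?_⟩
  · refine le_errorBound hτ hγ2 hδ0 (by omega) le_rfl
      (frobNorm_sq_le_of_isCovEstimate (by positivity) (stationaryCov_spec hA hSw).1.1.isHermitian
        (fun M hM => ?_) (b₃ ω g₃) hS)
    refine le_trans (mul_le_mul_of_nonneg_right ?_ (sq_nonneg _)) (b₁ ω g₁ M hM)
    linarith
  · refine le_errorBound hτ hγ2 hδ0 (by omega) (by norm_num)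
      (frobNorm_sq_le_of_isCrossEstimate (by positivity) (fun M => ?_) (b₄ ω g₄) hN)
    refine (le_trans (mul_le_mul_of_nonneg_right ?_ (sq_nonneg _)) (b₂ ω g₂ M)).trans
      (sum_range_two_mul_add_one_le
        (f := fun t => ((x (t + 1) ω).ofLp ⬝ᵥ M *ᵥ (x t ω).ofLp) ^ 2) (fun t => sq_nonneg _) T)
    linarith

end

end TVR

theorem theorem1 :
    ∃ c : ℝ, 0 < c ∧
      ∀ (d : ℕ) (A Sw : Matrix (Fin d) (Fin d) ℝ) (σ : ℝ≥0) (γ : ℝ),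
        Sw.PosSemidef → TVR.rho A < 1 → TVR.rho A < ENNReal.ofReal γ → γ < 1 →
      ∀ (Ω : Type*) [MeasurableSpace Ω] (μ : Measure Ω) [IsProbabilityMeasure μ]
        (β₀ : Ω → EuclideanSpace ℝ (Fin d)) (w x : ℕ → Ω → EuclideanSpace ℝ (Fin d))
        (ε : ℕ → Ω → ℝ),
        TVR.IsGaussianModel μ A Sw σ β₀ w x ε →
      ∀ (δ : ℝ) (T : ℕ), 0 < δ → δ < 1 →
        c * (d : ℝ) ^ 4 * Real.log (c * (d : ℝ) ^ 2 / δ) ≤ T →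
        ∃ G : Set Ω, MeasurableSet G ∧ 1 - δ ≤ μ.real G ∧ ∀ ω ∈ G,
          (∃ S, TVR.IsCovEstimate T σ (fun t => x t ω)
            (fun t => TVR.obs A β₀ w x ε t ω) S) ∧
          (∃ N, TVR.IsCrossEstimate T (fun t => x t ω)
            (fun t => TVR.obs A β₀ w x ε t ω) N) ∧
          (∀ S, TVR.IsCovEstimate T σ (fun t => x t ω)
              (fun t => TVR.obs A β₀ w x ε t ω) S →
            TVR.frobNorm (S - TVR.stationaryCov A Sw) ≤
              TVR.errorBound c 2 A Sw σ γ δ T) ∧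
          (∀ N, TVR.IsCrossEstimate T (fun t => x t ω)
              (fun t => TVR.obs A β₀ w x ε t ω) N →
            TVR.frobNorm (N - A * TVR.stationaryCov A Sw) ≤
              TVR.errorBound c 3 A Sw σ γ δ T) := by
  -- One constant serves both the sample-size condition and the error bounds.
  refine ⟨10 ^ 10, by positivity, ?_⟩
  intro d A Sw σ γ hSw hA hγ hγ1 Ω _ μ _ β₀ w x ε h δ T hδ0 hδ1 hT
  obtain ⟨G, hG, hp, hb⟩ := h.exists_event hSw hA hγ hγ1 hδ0 hδ1 hT
  exact ⟨G, hG, hp, fun ω hω => ⟨TVR.exists_isCovEstimate _ _ _ _,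
    TVR.exists_isCrossEstimate _ _ _, (hb ω hω).1, (hb ω hω).2⟩⟩
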